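/- Let $n,p\ge 1$, $X\in\mathbb R^{n\times p}$, $Y\in\mathbb R^n$, $\alpha,\xi\ge 0$, $\lambda_1,\lambda_2>0$, and assume that $\xi>0$ or $Y\neq 0$. For $\tau^2=(\tau_1^2,\dots,\tau_p^2)\in(0,\infty)^p$ and $\omega^2=(\omega_1^2,\dots,\omega_{p-1}^2)\in(0,\infty)^{p-1}$ let $\Sigma_{\tau,\omega}$ be the positive definite matrix with $$\beta^T\Sigma_{\tau,\omega}^{-1}\beta=\sum_{j=1}^p\frac{\beta_j^2}{\tau_j^2}+\sum_{j=1}^{p-1}\frac{(\beta_{j+1}-\beta_j)^2}{\omega_j^2}\qquad(\beta\in\mathbb R^p).$$ The Bayesian fused lasso model is $$Y\mid\beta,\sigma^2\sim N_n(X\beta,\sigma^2I_n),\qquad \beta\mid\tau^2,\omega^2,\sigma^2\sim N_p(0,\sigma^2\Sigma_{\tau,\omega}),$$ $$\pi(\tau^2,\omega^2)\propto\det(\Sigma_{\tau,\omega})^{1/2}\prod_{i=1}^p(\tau_i^2)^{-1/2}e^{-\lambda_1^2\tau_i^2/2}\prod_{i=1}^{p-1}(\omega_i^2)^{-1/2}e^{-\lambda_2^2\omega_i^2/2},\qquad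 \pi(\sigma^2)\propto(\sigma^2)^{-\alpha-1}e^{-\xi/\sigma^2}.$$ Let $\Pi$ be the posterior distribution of $(\beta,\sigma^2)$ given $Y$, on $\mathbb R^p\times(0,\infty)$. Put $A=X^TX+\Sigma_{\tau,\omega}^{-1}$ and consider the following conditional distributions. * $\pi(\tau^2,\omega^2\mid\beta,\sigma^2,Y)$: all components are independent, $1/\tau_j^2\sim\text{Inverse-Gaussian}\big(\sqrt{\lambda_1^2\sigma^2/\beta_j^2},\lambda_1^2\big)$ and $1/\omega_j^2\sim\text{Inverse-Gaussian}\big(\sqrt{\lambda_2^2\sigma^2/(\beta_{j+1}-\beta_j)^2},\lambda_2^2\big)$ (parameters: mean and shape; when the mean is infinite, the limiting Lévy law). * $\pi(\beta\mid\sigma^2,\tau^2,\omega^2,Y)$: $N_p(A^{-1}X^TY,\sigma^2A^{-1})$. * $\pi(\sigma^2\mid\tau^2,\omega^2,Y)$: $\text{Inverse-Gamma}\big(\tfrac n2+\alpha,\ \tfrac12Y^T(I_n-XA^{-1}X^T)Y+\xi\big)$ (parameters: shape and scale). * $\pi(\sigma^2\mid\beta,\tau^2,\omega^2,Y)$: $\text{Inverse-Gamma}\big(\tfrac{n+p+2\alpha}2,\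 \tfrac12(\|Y-X\beta\|_2^2+\beta^T\Sigma_{\tau,\omega}^{-1}\beta+2\xi)\big)$. The two-block and three-block Gibbs chains on $\mathbb R^p\times(0,\infty)$ have the transition densities $$k_{fl}[(\beta_0,\sigma_0^2),(\beta_1,\sigma_1^2)]=\int\!\!\int\pi(\beta_1\mid\sigma_1^2,\tau^2,\omega^2,Y)\,\pi(\sigma_1^2\mid\tau^2,\omega^2,Y)\,\pi(\tau^2,\omega^2\mid\beta_0,\sigma_0^2,Y)\,d\omega^2d\tau^2,$$ $$\tilde k_{fl}[(\beta_0,\sigma_0^2),(\beta_1,\sigma_1^2)]=\int\!\!\int\pi(\beta_1\mid\sigma_1^2,\tau^2,\omega^2,Y)\,\pi(\sigma_1^2\mid\beta_0,\tau^2,\omega^2,Y)\,\pi(\tau^2,\omega^2\mid\beta_0,\sigma_0^2,Y)\,d\omega^2d\tau^2.$$ Then: 1. The two-block chain is geometrically ergodic: it is a Markov chain with invariant probability measure $\Pi$, and there are $\rho\in[0,1)$ and a finite function $C$ such that for every starting point $x$ and every $m\ge 0$ the total variation distance $\sup_B|P^m(x,B)-\Pi(B)|$ between the law after $m$ steps and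 $\Pi$ is at most $C(x)\rho^m$. 2. The three-block chain is a Markov chain with invariant probability measure $\Pi$, and its Markov operator $f\mapsto\int\tilde k_{fl}(\cdot,y)f(y)\,dy$, a bounded operator on $L^2(\Pi)$, is not Hilbert–Schmidt. -/

import Mathlib

open MeasureTheory ProbabilityTheory
open scoped ENNReal Matrix

noncomputable section

namespace FusedLasso

/-! Throughout, the number of coefficients is `p = q + 1 ≥ 1`, so that there are `p` local scales
`t i = τᵢ²` and `p - 1 = q` fusion scales `w j = ωⱼ²`. -/

/-- The state space `ℝᵖ × ℝ₊` of the pairs `(β, σ²)`. -/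
abbrev State (q : ℕ) : Type := (Fin (q + 1) → ℝ) × Set.Ioi (0 : ℝ)

/-- Lebesgue measure on the state space. -/
def lebesgue (q : ℕ) : Measure (State q) :=
  (volume : Measure (Fin (q + 1) → ℝ)).prod ((volume : Measure ℝ).comap Subtype.val)

instance (q : ℕ) : SFinite (lebesgue q) := by
  have : LocallyCompactSpace (Set.Ioi (0 : ℝ)) :=
    isOpen_Ioi.isOpenEmbedding_subtypeVal.locallyCompactSpace
  have : IsFiniteMeasureOnCompacts
      ((volume : Measure ℝ).comap (Subtype.val : Set.Ioi (0 : ℝ) → ℝ)) :=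
    .comap' _ continuous_subtype_val (MeasurableEmbedding.subtype_coe measurableSet_Ioi)
  unfold lebesgue
  infer_instance

/-- The positive orthant `ℝ₊ᵏ`. -/
def posOrthant (k : ℕ) : Set (Fin k → ℝ) := {v | ∀ i, 0 < v i}

/-! ### The densities used -/

/-- Density of the normal distribution `N(m, S)` for an invertible covariance matrix `S`. -/
def normalPdf {k : ℕ} (m : Fin k → ℝ) (S : Matrix (Fin k) (Fin k) ℝ) (x : Fin k → ℝ) : ℝ :=
  (√((2 * Real.pi) ^ k * S.det))⁻¹ * Real.exp (-((x - m) ⬝ᵥ (S⁻¹ *ᵥ (x - m))) / 2)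

/-- Density at `s > 0` of the inverse-gamma distribution with shape `a` and scale `b`. -/
def invGammaPdf (a b s : ℝ) : ℝ :=
  b ^ a / Real.Gamma a * s ^ (-a - 1) * Real.exp (-b / s)

/-- Density at `u > 0` of the inverse-Gaussian distribution with shape `l` and mean `1 / ν`, that is
`√(l / (2πu³)) exp (-l (u - μ)² / (2μ²u))` with `μ = 1 / ν`. For `ν = 0` this is
the limiting law with infinite mean (the Lévy distribution). -/
def invGaussianPdf (ν l u : ℝ) : ℝ :=
  √(l / (2 * Real.pi * u ^ 3)) * Real.exp (-(l * (ν * u - 1) ^ 2) / (2 * u))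

/-- Density at `t > 0` of a random variable `T` whose reciprocal `1 / T` is inverse-Gaussian with
shape `l` and mean `1 / ν`. -/
def recipInvGaussianPdf (ν l t : ℝ) : ℝ :=
  invGaussianPdf ν l t⁻¹ * (t ^ 2)⁻¹

/-! ### The hierarchical model and its posterior -/

/-- The vector `e_{j+1} - e_j`, so that `fusionVec j ⬝ᵥ β = β_{j+1} - β_j`. -/
def fusionVec {q : ℕ} (j : Fin q) : Fin (q + 1) → ℝ :=
  Pi.single j.succ 1 - Pi.single j.castSucc 1

/-- The tridiagonal matrix `Σ_{τ,ω}⁻¹`, with diagonal entries `1/τᵢ² + 1/ωᵢ₋₁² + 1/ωᵢ²` (the terms in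
`ω` being absent at the two ends) and with `-1/ωⱼ²` next to the diagonal; equivalently
`βᵀ Σ⁻¹ β = ∑ βᵢ²/τᵢ² + ∑ (βⱼ₊₁ - βⱼ)²/ωⱼ²`. -/
def priorPrecision {q : ℕ} (t : Fin (q + 1) → ℝ) (w : Fin q → ℝ) :
    Matrix (Fin (q + 1)) (Fin (q + 1)) ℝ :=
  Matrix.diagonal (fun i => 1 / t i) +
    ∑ j, (1 / w j) • Matrix.vecMulVec (fusionVec j) (fusionVec j)

/-- The matrix `Σ_{τ,ω}`. -/
def priorCov {q : ℕ} (t : Fin (q + 1) → ℝ) (w : Fin q → ℝ) :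
    Matrix (Fin (q + 1)) (Fin (q + 1)) ℝ :=
  (priorPrecision t w)⁻¹

/-- The prior density of `(τ², ω²)`, up to its normalizing constant. -/
def scalePrior {q : ℕ} (lam₁ lam₂ : ℝ) (t : Fin (q + 1) → ℝ) (w : Fin q → ℝ) : ℝ :=
  √(priorCov t w).det *
    (∏ i, (t i) ^ (-(1 / 2) : ℝ) * Real.exp (-(lam₁ ^ 2 * t i) / 2)) *
    (∏ j, (w j) ^ (-(1 / 2) : ℝ) * Real.exp (-(lam₂ ^ 2 * w j) / 2))

/-- The (possibly improper) inverse-gamma prior density of `σ²`, up to its normalizing constant. -/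
def variancePrior (α ξ s : ℝ) : ℝ := s ^ (-α - 1) * Real.exp (-ξ / s)

/-- The joint density of `(Y, β, σ², τ², ω²)` at the observed `Y`, up to a constant factor. -/
def jointDensity {n q : ℕ} (X : Matrix (Fin n) (Fin (q + 1)) ℝ) (Y : Fin n → ℝ)
    (α ξ lam₁ lam₂ : ℝ) (x : State q) (t : Fin (q + 1) → ℝ) (w : Fin q → ℝ) : ℝ :=
  normalPdf (X *ᵥ x.1) ((x.2 : ℝ) • (1 : Matrix (Fin n) (Fin n) ℝ)) Y *
    normalPdf 0 ((x.2 : ℝ) • priorCov t w) x.1 *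
    scalePrior lam₁ lam₂ t w *
    variancePrior α ξ x.2

/-- The unnormalized `(β, σ²)`-marginal of the posterior. -/
def posteriorWeight {n q : ℕ} (X : Matrix (Fin n) (Fin (q + 1)) ℝ) (Y : Fin n → ℝ)
    (α ξ lam₁ lam₂ : ℝ) : Measure (State q) :=
  (lebesgue q).withDensity fun x =>
    ∫⁻ t in posOrthant (q + 1), ∫⁻ w in posOrthant q,
      ENNReal.ofReal (jointDensity X Y α ξ lam₁ lam₂ x t w)

/-- The posterior distribution of `(β, σ²)` given `Y`. -/
def posterior {n q : ℕ} (X : Matrix (Fin n) (Fin (q + 1)) ℝ) (Y : Fin n → ℝ)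
    (α ξ lam₁ lam₂ : ℝ) : Measure (State q) :=
  (posteriorWeight X Y α ξ lam₁ lam₂ Set.univ)⁻¹ • posteriorWeight X Y α ξ lam₁ lam₂

/-! ### The conditional densities of the Gibbs samplers -/

/-- `π(τ², ω² | β, σ², Y)`: independently, `1/τᵢ²` is inverse-Gaussian with mean
`√(λ₁²σ²/βᵢ²)` and shape `λ₁²`, and `1/ωⱼ²` is inverse-Gaussian with mean
`√(λ₂²σ²/(βⱼ₊₁ - βⱼ)²)` and shape `λ₂²`. -/
def scaleCond {q : ℕ} (lam₁ lam₂ : ℝ) (x : State q) (t : Fin (q + 1) → ℝ) (w : Fin q → ℝ) : ℝ :=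
  (∏ i, recipInvGaussianPdf √(x.1 i ^ 2 / (lam₁ ^ 2 * (x.2 : ℝ))) (lam₁ ^ 2) (t i)) *
    ∏ j, recipInvGaussianPdf
      √((x.1 (Fin.succ j) - x.1 (Fin.castSucc j)) ^ 2 / (lam₂ ^ 2 * (x.2 : ℝ)))
      (lam₂ ^ 2) (w j)

/-- The matrix `A = XᵀX + Σ_{τ,ω}⁻¹`. -/
def postPrecision {n q : ℕ} (X : Matrix (Fin n) (Fin (q + 1)) ℝ)
    (t : Fin (q + 1) → ℝ) (w : Fin q → ℝ) : Matrix (Fin (q + 1)) (Fin (q + 1)) ℝ :=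
  Xᵀ * X + priorPrecision t w

/-- `π(β | σ², τ², ω², Y)`, the density of `N(A⁻¹XᵀY, σ²A⁻¹)`. -/
def betaCond {n q : ℕ} (X : Matrix (Fin n) (Fin (q + 1)) ℝ) (Y : Fin n → ℝ)
    (s : ℝ) (t : Fin (q + 1) → ℝ) (w : Fin q → ℝ) (b : Fin (q + 1) → ℝ) : ℝ :=
  normalPdf ((postPrecision X t w)⁻¹ *ᵥ (Xᵀ *ᵥ Y)) (s • (postPrecision X t w)⁻¹) b

/-- `π(σ² | τ², ω², Y)`, the `σ²`-step of the two-block sampler. -/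
def varianceCond₂ {n q : ℕ} (X : Matrix (Fin n) (Fin (q + 1)) ℝ) (Y : Fin n → ℝ)
    (α ξ : ℝ) (t : Fin (q + 1) → ℝ) (w : Fin q → ℝ) (s : ℝ) : ℝ :=
  invGammaPdf (n / 2 + α)
    (Y ⬝ᵥ (((1 : Matrix (Fin n) (Fin n) ℝ) - X * (postPrecision X t w)⁻¹ * Xᵀ) *ᵥ Y) / 2 + ξ) s

/-- `π(σ² | β, τ², ω², Y)`, the `σ²`-step of the three-block sampler. -/
def varianceCond₃ {n q : ℕ} (X : Matrix (Fin n) (Fin (q + 1)) ℝ) (Y : Fin n → ℝ)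
    (α ξ : ℝ) (b : Fin (q + 1) → ℝ) (t : Fin (q + 1) → ℝ) (w : Fin q → ℝ) (s : ℝ) : ℝ :=
  invGammaPdf ((n + (q + 1 : ℕ) + 2 * α) / 2)
    (((Y - X *ᵥ b) ⬝ᵥ (Y - X *ᵥ b) + b ⬝ᵥ (priorPrecision t w *ᵥ b) + 2 * ξ) / 2) s

/-! ### The two Markov chains -/

/-- The transition density `k_fl` of the two-block Gibbs chain. -/
def twoBlockDensity {n q : ℕ} (X : Matrix (Fin n) (Fin (q + 1)) ℝ) (Y : Fin n → ℝ)
    (α ξ lam₁ lam₂ : ℝ) (x y : State q) : ℝ≥0∞ :=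
  ∫⁻ t in posOrthant (q + 1), ∫⁻ w in posOrthant q,
    ENNReal.ofReal (betaCond X Y y.2 t w y.1 * varianceCond₂ X Y α ξ t w y.2 *
      scaleCond lam₁ lam₂ x t w)

/-- The transition density `k̃_fl` of the three-block Gibbs chain. -/
def threeBlockDensity {n q : ℕ} (X : Matrix (Fin n) (Fin (q + 1)) ℝ) (Y : Fin n → ℝ)
    (α ξ lam₁ lam₂ : ℝ) (x y : State q) : ℝ≥0∞ :=
  ∫⁻ t in posOrthant (q + 1), ∫⁻ w in posOrthant q,
    ENNReal.ofReal (betaCond X Y y.2 t w y.1 * varianceCond₃ X Y α ξ x.1 t w y.2 *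
      scaleCond lam₁ lam₂ x t w)

/-- The transition kernel `P(x, A) = ∫_A k_fl(x, y) dy` of the two-block Gibbs chain. -/
def twoBlockKernel {n q : ℕ} (X : Matrix (Fin n) (Fin (q + 1)) ℝ) (Y : Fin n → ℝ)
    (α ξ lam₁ lam₂ : ℝ) : Kernel (State q) (State q) :=
  Kernel.withDensity (Kernel.const (State q) (lebesgue q))
    (twoBlockDensity X Y α ξ lam₁ lam₂)

/-- The transition kernel `P̃(x, A) = ∫_A k̃_fl(x, y) dy` of the three-block Gibbs chain. -/
def threeBlockKernel {n q : ℕ} (X : Matrix (Fin n) (Fin (q + 1)) ℝ) (Y : Fin n → ℝ)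
    (α ξ lam₁ lam₂ : ℝ) : Kernel (State q) (State q) :=
  Kernel.withDensity (Kernel.const (State q) (lebesgue q))
    (threeBlockDensity X Y α ξ lam₁ lam₂)

end FusedLasso

/-! ### Markov chains and operators in general -/

/-- `κ` is the transition kernel of a Markov chain with stationary distribution `π`. -/
structure IsStationaryChain {S : Type*} [MeasurableSpace S] (κ : Kernel S S) (π : Measure S) :
    Prop where
  markov : IsMarkovKernel κ
  prob : IsProbabilityMeasure π
  invariant : Kernel.Invariant κ π

/-- The chain with kernel `κ` and stationary distribution `π` is geometrically ergodic: from every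
starting point `x`, its law after `m` steps (`κ ^ m` is the `m`-fold composition) is within
`C x * ρ ^ m` of `π` in total variation, where `ρ < 1` and `C` is finite. -/
def GeometricallyErgodic {S : Type*} [MeasurableSpace S] (κ : Kernel S S) (π : Measure S) : Prop :=
  IsStationaryChain κ π ∧
    ∃ (C : S → ℝ) (ρ : ℝ), 0 ≤ ρ ∧ ρ < 1 ∧ ∀ (x : S) (m : ℕ) (A : Set S), MeasurableSet A →
      |((κ ^ m) x).real A - π.real A| ≤ C x * ρ ^ m

/-- `T` is the Markov operator `f ↦ ∫ f(y) κ(·, dy)` of `κ` on `L²(π)`. -/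
def IsMarkovOperator {S : Type*} [MeasurableSpace S] (κ : Kernel S S) (π : Measure S)
    (T : Lp ℝ 2 π →L[ℝ] Lp ℝ 2 π) : Prop :=
  ∀ f : Lp ℝ 2 π, T f =ᵐ[π] fun x => ∫ y, f y ∂(κ x)

/-- A bounded operator is Hilbert–Schmidt if `∑ ‖T eᵢ‖² < ∞` for some orthonormal basis `e`
(equivalently, for every one). -/
def IsHilbertSchmidt {E : Type*} [NormedAddCommGroup E] [InnerProductSpace ℝ E]
    (T : E →L[ℝ] E) : Prop :=
  ∃ (ι : Set E) (e : HilbertBasis ι ℝ E), Summable fun i => ‖T (e i)‖ ^ 2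

end

noncomputable section

/-! ### Harris' theorem -/

section Harris

variable {S : Type*} [MeasurableSpace S]

lemma Kernel.isMarkovKernel_pow (κ : Kernel S S) [IsMarkovKernel κ] (m : ℕ) :
    IsMarkovKernel (κ ^ m) := by
  induction m with
  | zero => rw [pow_zero]; change IsMarkovKernel Kernel.id; infer_instance
  | succ m ih => rw [pow_succ]; change IsMarkovKernel (_ ∘ₖ _); infer_instance

/-- The mass of `η` is left free because the bound serves both for `κ x` and for the residual
measure `κ x - ν`. -/
lemma abs_integral_le_of_abs_le_weight {η : Measure S} [IsFiniteMeasure η] {V ψ : S → ℝ}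
    (hV : Integrable V η) {c b : ℝ} (h : ∀ x, |ψ x| ≤ c * (1 + b * V x)) :
    |∫ x, ψ x ∂η| ≤ c * (η.real Set.univ + b * ∫ x, V x ∂η) := by
  have hi : Integrable (fun x => c * (1 + b * V x)) η :=
    ((integrable_const (1 : ℝ)).add (hV.const_mul b)).const_mul c
  calc |∫ x, ψ x ∂η| ≤ ∫ x, c * (1 + b * V x) ∂η := by
        rw [← Real.norm_eq_abs]
        exact norm_integral_le_of_norm_le hi (Filter.Eventually.of_forall h)
    _ = _ := by
        rw [integral_const_mul, integral_add (integrable_const _) (hV.const_mul b),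
          integral_const_mul]
        simp

/-- A function with weighted oscillation at most `c` is, up to a constant, bounded by the weight. -/
lemma exists_abs_sub_le_of_weighted_osc {S : Type*} [Nonempty S] {φ W : S → ℝ}
    (h : ∀ x y, |φ x - φ y| ≤ W x + W y) : ∃ d, ∀ x, |φ x - d| ≤ W x := by
  have hb : ∀ y, φ y + W y ∈ upperBounds (Set.range fun x => φ x - W x) := by
    rintro y _ ⟨x, rfl⟩
    have := (abs_le.1 (h x y)).2
    simp only
    linarith
  refine ⟨⨆ x, (φ x - W x), fun x => ?_⟩
  have h1 : (⨆ x, (φ x - W x)) ≤ φ x + W x := ciSup_le fun y => hb x ⟨y, rfl⟩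
  have h2 : φ x - W x ≤ ⨆ x, (φ x - W x) := le_ciSup ⟨_, hb x⟩ x
  rw [abs_le]
  constructor <;> linarith

lemma integrable_of_lintegral_ofReal_le {η : Measure S} {V : S → ℝ} (hVm : Measurable V)
    (hV0 : ∀ x, 0 ≤ V x) {B : ℝ} (hB : 0 ≤ B) (h : ∫⁻ y, ENNReal.ofReal (V y) ∂η ≤ .ofReal B) :
    Integrable V η ∧ ∫ y, V y ∂η ≤ B := by
  have hi : Integrable V η := by
    refine ⟨hVm.aestronglyMeasurable, ?_⟩
    rw [hasFiniteIntegral_iff_ofReal (Filter.Eventually.of_forall hV0)]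
    exact h.trans_lt ENNReal.ofReal_lt_top
  refine ⟨hi, ?_⟩
  rw [← ofReal_integral_eq_lintegral_ofReal hi (Filter.Eventually.of_forall hV0)] at h
  exact (ENNReal.ofReal_le_ofReal_iff hB).1 h

/-- One step of a chain satisfying a drift and a minorization condition contracts the weighted
oscillation of functions. -/
lemma weighted_osc_contraction {κ : Kernel S S} [IsMarkovKernel κ] {V : S → ℝ}
    (hVm : Measurable V) (hV0 : ∀ x, 0 ≤ V x) {γ K R a b : ℝ} (hγ : 0 ≤ γ) (hK : 0 < K)
    (hdrift : ∀ x, ∫⁻ y, ENNReal.ofReal (V y) ∂(κ x) ≤ .ofReal (γ * V x + K))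
    {ν : Measure S} [IsFiniteMeasure ν] (hνa : ν.real Set.univ = a)
    (hmin : ∀ x, V x ≤ R → ν ≤ κ x) (hb : 0 ≤ b) {ρ : ℝ}
    (hρ₁ : ∀ s, R ≤ s → 2 + b * γ * s + 2 * b * K ≤ ρ * (2 + b * s))
    (hρ₂ : ∀ s, 0 ≤ s → 2 - 2 * a + b * γ * s + 2 * b * K ≤ ρ * (2 + b * s))
    {φ : S → ℝ} (hφm : Measurable φ) {B : ℝ} (hφB : ∀ x, |φ x| ≤ B) {c : ℝ} (hc : 0 ≤ c)
    (hφ : ∀ x y, |φ x - φ y| ≤ c * (2 + b * V x + b * V y)) (x y : S) :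
    |∫ z, φ z ∂(κ x) - ∫ z, φ z ∂(κ y)| ≤ ρ * c * (2 + b * V x + b * V y) := by
  have : Nonempty S := ⟨x⟩
  -- Subtracting a constant turns the oscillation bound into a pointwise bound and, as `κ x` and `κ
  -- y` are probability measures, does not change the difference of the integrals.
  obtain ⟨d, hd⟩ := exists_abs_sub_le_of_weighted_osc (φ := φ) (W := fun x => c * (1 + b * V x))
    fun x y => (hφ x y).trans_eq (by ring)
  have hVi : ∀ x, Integrable V (κ x) ∧ ∫ z, V z ∂(κ x) ≤ γ * V x + K := fun x =>
    integrable_of_lintegral_ofReal_le hVm hV0 (by have := hV0 x; positivity) (hdrift x)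
  have hφi : ∀ η : Measure S, IsFiniteMeasure η → Integrable (fun z => φ z - d) η := fun η _ =>
    (Integrable.of_bound hφm.aestronglyMeasurable B
      (Filter.Eventually.of_forall fun x => by simpa using hφB x)).sub (integrable_const d)
  have hsub : ∀ x, ∫ z, φ z ∂(κ x) = ∫ z, (φ z - d) ∂(κ x) + d := fun x => by
    have h := integral_add (hφi (κ x) inferInstance) (integrable_const d)
    simpa using h
  rw [hsub x, hsub y, add_sub_add_right_eq_sub]
  have hx := hV0 x
  have hy := hV0 y
  -- For a far pair the drift alone contracts. For a near pair both points satisfy `V ≤ R`, as `V ≥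
  -- 0`, so `ν` can be split off both measures; its contributions cancel and each residual has mass
  -- `1 - a`.
  rcases le_or_gt R (V x + V y) with hR | hR
  · have h1 := abs_integral_le_of_abs_le_weight (hVi x).1 hd
    have h2 := abs_integral_le_of_abs_le_weight (hVi y).1 hd
    simp only [probReal_univ] at h1 h2
    calc _ ≤ _ := abs_sub _ _
      _ ≤ c * (1 + b * (γ * V x + K)) + c * (1 + b * (γ * V y + K)) := by
        refine add_le_add (h1.trans ?_) (h2.trans ?_)
        · gcongr; exact (hVi x).2
        · gcongr; exact (hVi y).2
      _ = c * (2 + b * γ * (V x + V y) + 2 * b * K) := by ring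
      _ ≤ c * (ρ * (2 + b * (V x + V y))) := by gcongr; exact hρ₁ _ hR
      _ = _ := by ring
  · have key : ∀ x, V x ≤ R → ∃ η : Measure S, ∃ _ : IsFiniteMeasure η,
        κ x = η + ν ∧ |∫ z, (φ z - d) ∂η| ≤ c * (1 - a + b * (γ * V x + K)) := by
      intro x hxR
      have hsum := Measure.sub_add_cancel_of_le (hmin x hxR)
      have hle : κ x - ν ≤ κ x := Measure.sub_le
      have hfin : IsFiniteMeasure (κ x - ν) := isFiniteMeasure_of_le _ hle
      refine ⟨κ x - ν, hfin, hsum.symm, ?_⟩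
      have h1 := abs_integral_le_of_abs_le_weight ((hVi x).1.mono_measure hle) hd
      have h2 : (κ x - ν).real Set.univ = 1 - a := by
        have : (κ x).real Set.univ = (κ x - ν).real Set.univ + ν.real Set.univ := by
          rw [← measureReal_add_apply, hsum]
        rw [probReal_univ, hνa] at this
        linarith
      rw [h2] at h1
      refine h1.trans ?_
      gcongr
      exact (integral_mono_measure hle (Filter.Eventually.of_forall hV0) (hVi x).1).trans (hVi x).2
    obtain ⟨ηx, _, hηx, h1⟩ := key x (by linarith)
    obtain ⟨ηy, _, hηy, h2⟩ := key y (by linarith)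
    rw [hηx, hηy, integral_add_measure (hφi _ inferInstance) (hφi _ inferInstance),
      integral_add_measure (hφi _ inferInstance) (hφi _ inferInstance), add_sub_add_right_eq_sub]
    calc _ ≤ _ := abs_sub _ _
      _ ≤ _ := add_le_add h1 h2
      _ = c * (2 - 2 * a + b * γ * (V x + V y) + 2 * b * K) := by ring
      _ ≤ c * (ρ * (2 + b * (V x + V y))) := by gcongr; exact hρ₂ _ (by positivity)
      _ = _ := by ring

/-- **Harris' theorem**: a stationary chain satisfying a drift condition and a minorization
condition on a large enough sublevel set of the drift function is geometrically ergodic. -/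
theorem geometricallyErgodic_of_drift_of_minorization {κ : Kernel S S} {π : Measure S}
    (hst : IsStationaryChain κ π) {V : S → ℝ} (hVm : Measurable V) (hV0 : ∀ x, 0 ≤ V x)
    {γ K R : ℝ} (hγ : 0 ≤ γ) (hγ1 : γ < 1) (hK : 0 < K)
    (hdrift : ∀ x, ∫⁻ y, ENNReal.ofReal (V y) ∂(κ x) ≤ .ofReal (γ * V x + K))
    (hR : 2 * K < (1 - γ) * R) {ν : Measure S} (hν : ν Set.univ ≠ 0)
    (hmin : ∀ x, V x ≤ R → ν ≤ κ x) (hx₀ : ∃ x, V x ≤ R) (hπ : Integrable V π) :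
    GeometricallyErgodic κ π := by
  have := hst.markov
  have := hst.prob
  obtain ⟨x₀, hx₀⟩ := hx₀
  have hRpos : 0 < R := by nlinarith
  have hνfin : IsFiniteMeasure ν := isFiniteMeasure_of_le _ (hmin x₀ hx₀)
  obtain ⟨a, hνa⟩ : ∃ a, ν.real Set.univ = a := ⟨_, rfl⟩
  have ha0 : 0 < a := by
    rw [← hνa]
    exact ENNReal.toReal_pos hν (measure_ne_top _ _)
  -- With this weight the drift constant costs `2bK = a` in the near case, half of the `2a` gained
  -- from the minorization.
  obtain ⟨b, hb⟩ : ∃ b, b = a / (2 * K) := ⟨_, rfl⟩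
  have hb0 : 0 < b := by rw [hb]; positivity
  have hbK : 2 * b * K = a := by rw [hb]; field_simp
  -- The contraction ratio of a far pair at the threshold `s = R`. It is below one exactly because
  -- `2K < (1 - γ)R`, and it suffices for `s ≥ R` because `γ ≤ α₁`.
  obtain ⟨α₁, hα₁⟩ : ∃ r, r = (2 + b * γ * R + 2 * b * K) / (2 + b * R) := ⟨_, rfl⟩
  have hden : 0 < 2 + b * R := by positivity
  have hα₁1 : α₁ < 1 := by
    rw [hα₁, div_lt_one hden]
    nlinarith
  have hα₁γ : γ ≤ α₁ := by
    rw [hα₁, le_div_iff₀ hden]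
    nlinarith
  have hα₁e : α₁ * (2 + b * R) = 2 + b * γ * R + 2 * b * K := by
    rw [hα₁]; field_simp
  -- The value `1 - a / 2` is the near-pair ratio at `s = 0`, namely `(2 - a) / 2`.
  obtain ⟨ρ, hρ⟩ : ∃ r, r = max α₁ (1 - a / 2) := ⟨_, rfl⟩
  have hρα : α₁ ≤ ρ := hρ ▸ le_max_left _ _
  have hρa : 1 - a / 2 ≤ ρ := hρ ▸ le_max_right _ _
  have hρ1 : ρ < 1 := by rw [hρ]; exact max_lt hα₁1 (by linarith)
  have hρ0 : 0 ≤ ρ := (hγ.trans hα₁γ).trans hρα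
  have hρ₁ : ∀ s, R ≤ s → 2 + b * γ * s + 2 * b * K ≤ ρ * (2 + b * s) := fun s hs => by
    have h1 : α₁ * (2 + b * s) ≤ ρ * (2 + b * s) := by
      have : 0 ≤ 2 + b * s := by have := hRpos.le.trans hs; positivity
      gcongr
    have h2 : 0 ≤ (α₁ - γ) * (b * (s - R)) :=
      mul_nonneg (by linarith) (mul_nonneg hb0.le (by linarith))
    nlinarith
  have hρ₂ : ∀ s, 0 ≤ s → 2 - 2 * a + b * γ * s + 2 * b * K ≤ ρ * (2 + b * s) := fun s hs => by
    have h1 : 0 ≤ (ρ - γ) * (b * s) :=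
      mul_nonneg (by linarith) (mul_nonneg hb0.le hs)
    nlinarith
  -- The contraction is iterated on the functions `z ↦ κ^m(z, A)`, starting from an indicator, whose
  -- oscillation is at most one.
  have hosc : ∀ (m : ℕ) (A : Set S), MeasurableSet A → ∀ x y,
      |((κ ^ m) x).real A - ((κ ^ m) y).real A| ≤ ρ ^ m * (2 + b * V x + b * V y) := by
    intro m A hA
    have hreal_le : ∀ m x, ((κ ^ m) x).real A ≤ 1 := fun m x => by
      have := Kernel.isMarkovKernel_pow κ m
      exact measureReal_le_one
    induction m with
    | zero =>
      intro x y
      have h1 : ((κ ^ 0) x).real A ≤ 1 := hreal_le 0 x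
      have h2 : ((κ ^ 0) y).real A ≤ 1 := hreal_le 0 y
      have h3 : 0 ≤ ((κ ^ 0) x).real A := measureReal_nonneg
      have h4 : 0 ≤ ((κ ^ 0) y).real A := measureReal_nonneg
      have h5 := mul_nonneg hb0.le (hV0 x)
      have h6 := mul_nonneg hb0.le (hV0 y)
      rw [pow_zero ρ, abs_le]
      constructor <;> linarith
    | succ m ih =>
      intro x y
      have hmeas : Measurable fun z => ((κ ^ m) z).real A :=
        (Kernel.measurable_coe (κ ^ m) hA).ennreal_toReal
      have hstep : ∀ x, ((κ ^ (m + 1)) x).real A = ∫ z, ((κ ^ m) z).real A ∂(κ x) := fun x => by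
        have := Kernel.isMarkovKernel_pow κ m
        have hcomp : κ ^ (m + 1) = (κ ^ m) ∘ₖ κ := pow_succ κ m
        rw [measureReal_def, hcomp, Kernel.comp_apply' _ _ _ hA,
          integral_eq_lintegral_of_nonneg_ae (Filter.Eventually.of_forall fun _ => measureReal_nonneg)
            hmeas.aestronglyMeasurable]
        congr 1
        refine lintegral_congr fun z => ?_
        rw [ofReal_measureReal]
      rw [hstep, hstep, pow_succ' ρ]
      exact weighted_osc_contraction hVm hV0 hγ hK hdrift hνa hmin hb0.le hρ₁ hρ₂ hmeas (B := 1)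
        (fun z => by rw [abs_of_nonneg measureReal_nonneg]; exact hreal_le m z)
        (pow_nonneg hρ0 m) ih x y
  refine ⟨hst, fun x => 2 + b * V x + b * ∫ y, V y ∂π, ρ, hρ0, hρ1, fun x m A hA => ?_⟩
  have hinv : ∀ m, Kernel.Invariant (κ ^ m) π := fun m => by
    induction m with
    | zero => rw [pow_zero]; exact Measure.id_comp
    | succ m ih => rw [pow_succ]; exact ih.comp hst.invariant
  have hmeas : Measurable fun z => ((κ ^ m) z).real A :=
    (Kernel.measurable_coe (κ ^ m) hA).ennreal_toReal
  have := Kernel.isMarkovKernel_pow κ m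
  have hint : Integrable (fun z => ((κ ^ m) z).real A) π :=
    Integrable.of_bound hmeas.aestronglyMeasurable 1 (Filter.Eventually.of_forall fun z => by
      rw [Real.norm_of_nonneg measureReal_nonneg]; exact measureReal_le_one)
  -- By invariance `π A` is the `π`-average of `κ^m(z, A)`, so the distance to `π` is at most an
  -- average of oscillations, finite because `V` is integrable.
  have hπA : π.real A = ∫ z, ((κ ^ m) z).real A ∂π := by
    rw [integral_eq_lintegral_of_nonneg_ae (Filter.Eventually.of_forall fun _ => measureReal_nonneg)
      hmeas.aestronglyMeasurable, measureReal_def]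
    congr 1
    conv_lhs => rw [← (hinv m).def, Measure.bind_apply hA (Kernel.aemeasurable _)]
    refine lintegral_congr fun z => ?_
    rw [ofReal_measureReal]
  have hc : ((κ ^ m) x).real A - π.real A
      = ∫ z, (((κ ^ m) x).real A - ((κ ^ m) z).real A) ∂π := by
    rw [integral_sub (integrable_const _) hint, ← hπA]
    simp
  rw [hc]
  have hbd : Integrable (fun z => ρ ^ m * (2 + b * V x + b * V z)) π :=
    ((integrable_const _).add (hπ.const_mul b)).const_mul _
  calc _ ≤ ∫ z, ρ ^ m * (2 + b * V x + b * V z) ∂π := by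
        rw [← Real.norm_eq_abs]
        exact norm_integral_le_of_norm_le hbd (Filter.Eventually.of_forall (hosc m A hA x))
    _ = _ := by
        rw [integral_const_mul, integral_add (integrable_const _) (hπ.const_mul b),
          integral_const_mul]
        simp only [integral_const, probReal_univ, one_smul]
        ring

end Harris

/-! ### Hilbert–Schmidt operators and Markov operators -/

section HilbertSchmidt

open scoped RealInnerProductSpace

variable {E : Type*} [NormedAddCommGroup E] [InnerProductSpace ℝ E]

/-- Parseval's identity in `ℝ≥0∞`, where double sums can be exchanged without summability
conditions. -/
lemma HilbertBasis.tsum_ofReal_inner_sq {ι : Type*} (b : HilbertBasis ι ℝ E) (x : E) :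
    ∑' i, ENNReal.ofReal (⟪b i, x⟫ ^ 2) = ENNReal.ofReal (‖x‖ ^ 2) := by
  have h := b.hasSum_inner_mul_inner x x
  have he : (fun i => ⟪x, b i⟫ * ⟪b i, x⟫) = fun i => ⟪b i, x⟫ ^ 2 := by
    ext i
    rw [real_inner_comm, sq]
  rw [he, real_inner_self_eq_norm_sq] at h
  rw [← ENNReal.ofReal_tsum_of_nonneg (fun i => sq_nonneg _) h.summable, h.tsum_eq]

lemma Orthonormal.tsum_ofReal_inner_sq_le {ι : Type*} {v : ι → E} (hv : Orthonormal ℝ v) (x : E) :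
    ∑' i, ENNReal.ofReal (⟪v i, x⟫ ^ 2) ≤ ENNReal.ofReal (‖x‖ ^ 2) := by
  have h := hv.inner_products_summable x
  have h2 := hv.tsum_inner_products_le x
  simp only [Real.norm_eq_abs, sq_abs] at h h2
  rw [← ENNReal.ofReal_tsum_of_nonneg (fun i => sq_nonneg _) h]
  exact ENNReal.ofReal_le_ofReal h2

/-- The squared norms of the images of an orthonormal family under a Hilbert–Schmidt operator are
summable. -/
lemma IsHilbertSchmidt.summable_of_orthonormal [CompleteSpace E] {T : E →L[ℝ] E}
    (hT : IsHilbertSchmidt T) {κ : Type*} {v : κ → E} (hv : Orthonormal ℝ v) :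
    Summable fun k => ‖T (v k)‖ ^ 2 := by
  obtain ⟨ι, b, hb⟩ := hT
  -- Expand `T (v k)` in the basis, apply Bessel to `v` for each adjoint vector, then expand the
  -- adjoint vectors back by Parseval: the adjoint has the same Hilbert–Schmidt norm as `T`.
  have key : ∑' k, ENNReal.ofReal (‖T (v k)‖ ^ 2) ≤ ∑' i, ENNReal.ofReal (‖T (b i)‖ ^ 2) := by
    calc ∑' k, ENNReal.ofReal (‖T (v k)‖ ^ 2)
        = ∑' k, ∑' i, ENNReal.ofReal (⟪v k, T.adjoint (b i)⟫ ^ 2) := by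
          refine tsum_congr fun k => ?_
          rw [← b.tsum_ofReal_inner_sq]
          refine tsum_congr fun i => ?_
          rw [ContinuousLinearMap.adjoint_inner_right, real_inner_comm]
      _ = ∑' i, ∑' k, ENNReal.ofReal (⟪v k, T.adjoint (b i)⟫ ^ 2) := ENNReal.tsum_comm
      _ ≤ ∑' i, ENNReal.ofReal (‖T.adjoint (b i)‖ ^ 2) :=
          ENNReal.tsum_le_tsum fun i => hv.tsum_ofReal_inner_sq_le _
      _ = ∑' i, ∑' j, ENNReal.ofReal (⟪b j, T.adjoint (b i)⟫ ^ 2) :=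
          tsum_congr fun i => (b.tsum_ofReal_inner_sq _).symm
      _ = ∑' j, ∑' i, ENNReal.ofReal (⟪b j, T.adjoint (b i)⟫ ^ 2) := ENNReal.tsum_comm
      _ = ∑' j, ENNReal.ofReal (‖T (b j)‖ ^ 2) := by
          refine tsum_congr fun j => ?_
          rw [← b.tsum_ofReal_inner_sq]
          refine tsum_congr fun i => ?_
          rw [ContinuousLinearMap.adjoint_inner_right, real_inner_comm]
  have hfin : ∑' k, ENNReal.ofReal (‖T (v k)‖ ^ 2) ≠ ∞ := by
    refine ne_top_of_le_ne_top ?_ key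
    rw [← ENNReal.ofReal_tsum_of_nonneg (fun i => sq_nonneg _) hb]
    exact ENNReal.ofReal_ne_top
  simpa using ENNReal.summable_toReal hfin

end HilbertSchmidt

/-! ### Markov operators on `L²` of a stationary distribution. -/

section MarkovOperator

variable {S : Type*} [MeasurableSpace S] {κ : Kernel S S} {π : Measure S}

/-- Invariance makes `π`-null sets null for almost every `κ x`; hence `∫ f dκ(x)` depends only on
the class of `f`, and the Markov operator is well defined. -/
lemma IsStationaryChain.ae_ae (hst : IsStationaryChain κ π) {p : S → Prop} (h : ∀ᵐ y ∂π, p y) :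
    ∀ᵐ x ∂π, ∀ᵐ y ∂(κ x), p y :=
  Measure.ae_ae_of_ae_comp (by rwa [hst.invariant.def])

lemma IsStationaryChain.lintegral_lintegral (hst : IsStationaryChain κ π) {f : S → ℝ≥0∞}
    (hf : Measurable f) : ∫⁻ x, ∫⁻ y, f y ∂(κ x) ∂π = ∫⁻ y, f y ∂π := by
  conv_rhs => rw [← hst.invariant.def]
  rw [Measure.lintegral_bind κ.aemeasurable hf.aemeasurable]

/-- The `L¹` norm is at most the `L²` norm under each probability measure `κ x`; squaring and
integrating over the invariant `π` gives a contraction. -/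
lemma IsStationaryChain.eLpNorm_integral_le (hst : IsStationaryChain κ π) (f : Lp ℝ 2 π) :
    eLpNorm (fun x => ∫ y, f y ∂(κ x)) 2 π ≤ eLpNorm f 2 π := by
  have := hst.markov
  have hf := (Lp.stronglyMeasurable f)
  rw [eLpNorm_eq_lintegral_rpow_enorm_toReal (by norm_num) (by norm_num),
    eLpNorm_eq_lintegral_rpow_enorm_toReal (by norm_num) (by norm_num)]
  refine ENNReal.rpow_le_rpow ?_ (by norm_num)
  rw [← hst.lintegral_lintegral (hf.measurable.enorm.pow_const _)]
  refine lintegral_mono fun x => ?_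
  have h1 : ‖∫ y, f y ∂(κ x)‖ₑ ≤ eLpNorm f 2 (κ x) := by
    calc _ ≤ ∫⁻ y, ‖f y‖ₑ ∂(κ x) := enorm_integral_le_lintegral_enorm _
      _ = eLpNorm f 1 (κ x) := eLpNorm_one_eq_lintegral_enorm.symm
      _ ≤ _ := eLpNorm_le_eLpNorm_of_exponent_le (by norm_num) hf.aestronglyMeasurable
  rw [eLpNorm_eq_lintegral_rpow_enorm_toReal (by norm_num) (by norm_num)] at h1
  calc _ ≤ _ := ENNReal.rpow_le_rpow h1 (by norm_num)
    _ = _ := by rw [← ENNReal.rpow_mul]; norm_num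

lemma IsStationaryChain.ae_integrable (hst : IsStationaryChain κ π) (f : Lp ℝ 2 π) :
    ∀ᵐ x ∂π, Integrable f (κ x) := by
  have := hst.markov
  have := hst.prob
  have hf := Lp.stronglyMeasurable f
  have hi : Integrable f π := (Lp.memLp f).integrable (by norm_num)
  have h := hi.2
  rw [HasFiniteIntegral, ← hst.lintegral_lintegral hf.measurable.enorm] at h
  filter_upwards [ae_lt_top (Measurable.lintegral_kernel hf.measurable.enorm) h.ne] with x hx
  exact ⟨hf.aestronglyMeasurable, hx⟩

/-- The Markov operator of a stationary chain is a bounded operator on `L²`. -/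
theorem IsStationaryChain.exists_isMarkovOperator (hst : IsStationaryChain κ π) :
    ∃ T : Lp ℝ 2 π →L[ℝ] Lp ℝ 2 π, IsMarkovOperator κ π T := by
  have := hst.markov
  have hmem : ∀ f : Lp ℝ 2 π, MemLp (fun x => ∫ y, f y ∂(κ x)) 2 π := fun f =>
    ⟨(Lp.stronglyMeasurable f).integral_kernel.aestronglyMeasurable,
      (hst.eLpNorm_integral_le f).trans_lt (Lp.memLp f).2⟩
  let L : Lp ℝ 2 π →ₗ[ℝ] Lp ℝ 2 π :=
    { toFun := fun f => (hmem f).toLp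
      map_add' := fun f g => by
        ext1
        filter_upwards [(hmem (f + g)).coeFn_toLp, (hmem f).coeFn_toLp, (hmem g).coeFn_toLp,
          Lp.coeFn_add (hmem f).toLp (hmem g).toLp, hst.ae_ae (Lp.coeFn_add f g),
          hst.ae_integrable f, hst.ae_integrable g] with x h1 h2 h3 h4 h5 h6 h7
        rw [h1, h4, Pi.add_apply, h2, h3, integral_congr_ae h5]
        exact integral_add h6 h7
      map_smul' := fun c f => by
        ext1
        filter_upwards [(hmem (c • f)).coeFn_toLp, (hmem f).coeFn_toLp,
          Lp.coeFn_smul c (hmem f).toLp, hst.ae_ae (Lp.coeFn_smul c f)] with x h1 h2 h3 h4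
        rw [h1, RingHom.id_apply, h3, Pi.smul_apply, h2, integral_congr_ae h4]
        exact integral_smul c f }
  refine ⟨L.mkContinuous 1 fun f => ?_, fun f => (hmem f).coeFn_toLp⟩
  rw [one_mul, Lp.norm_def, Lp.norm_def]
  refine ENNReal.toReal_mono (Lp.memLp f).2.ne ?_
  exact (eLpNorm_congr_ae (hmem f).coeFn_toLp).trans_le (hst.eLpNorm_integral_le f)

open scoped RealInnerProductSpace

/-- If there are infinitely many disjoint sets of positive mass that the chain does not leave
with probability bounded below, its Markov operator is not Hilbert–Schmidt. -/
theorem not_isHilbertSchmidt_of_pairwise_disjoint (hst : IsStationaryChain κ π)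
    {T : Lp ℝ 2 π →L[ℝ] Lp ℝ 2 π} (hT : IsMarkovOperator κ π T) {B : ℕ → Set S}
    (hBm : ∀ k, MeasurableSet (B k)) (hdisj : Pairwise (Function.onFun Disjoint B))
    (hpos : ∀ k, π (B k) ≠ 0) {c : ℝ} (hc : 0 < c) (hB : ∀ k, ∀ x ∈ B k, c ≤ (κ x).real (B k)) :
    ¬ IsHilbertSchmidt T := by
  intro hHS
  have := hst.prob
  have := hst.markov
  have hp : ∀ k, 0 < π.real (B k) := fun k => ENNReal.toReal_pos (hpos k) (measure_ne_top _ _)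
  let g : ℕ → Lp ℝ 2 π := fun k => indicatorConstLp 2 (hBm k) (measure_ne_top π _) (1 : ℝ)
  have hgg : ∀ j k, ⟪g j, g k⟫ = π.real (B j ∩ B k) := fun j k =>
    L2.inner_indicatorConstLp_one_indicatorConstLp_one (hBm j) (hBm k) _ _
  let v : ℕ → Lp ℝ 2 π := fun k => (√(π.real (B k)))⁻¹ • g k
  have hv : Orthonormal ℝ v := by
    rw [orthonormal_iff_ite]
    intro j k
    simp only [v, real_inner_smul_left, real_inner_smul_right, hgg]
    split_ifs with h
    · subst h
      have h1 := Real.sq_sqrt (hp j).le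
      have h2 := Real.sqrt_pos.2 (hp j)
      rw [Set.inter_self]
      field_simp
      exact h1.symm
    · rw [(hdisj h).inter_eq]
      simp
  -- The pairing of the indicator with its image is the stationary probability of being in `B k` now
  -- and one step later, at least `c π(B k)`. Normalization and Cauchy–Schwarz then bound `‖T (v
  -- k)‖` below.
  have hTv : ∀ k, c ≤ ‖T (v k)‖ := fun k => by
    have h1 : ⟪g k, T (g k)⟫ = ∫ x in B k, (κ x).real (B k) ∂π := by
      rw [L2.inner_indicatorConstLp_one]
      refine integral_congr_ae (ae_restrict_of_ae ?_)
      filter_upwards [hT (g k), hst.ae_ae (indicatorConstLp_coeFn (p := 2) (hs := hBm k)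
        (hμs := measure_ne_top π _) (c := (1 : ℝ)))] with x h1 h2
      rw [h1, integral_congr_ae h2, integral_indicator_const _ (hBm k)]
      simp
    have h2 : c * π.real (B k) ≤ ⟪g k, T (g k)⟫ := by
      rw [h1]
      have hm : Measurable fun x => (κ x).real (B k) :=
        (Kernel.measurable_coe κ (hBm k)).ennreal_toReal
      have hi : Integrable (fun x => (κ x).real (B k)) π :=
        Integrable.of_bound hm.aestronglyMeasurable 1 (Filter.Eventually.of_forall fun z => by
          rw [Real.norm_of_nonneg measureReal_nonneg]; exact measureReal_le_one)
      calc c * π.real (B k) = ∫ _ in B k, c ∂π := by simp [mul_comm]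
        _ ≤ _ := setIntegral_mono_on (integrable_const c).integrableOn hi.integrableOn
          (hBm k) (hB k)
    have h3 : ⟪v k, T (v k)⟫ = (π.real (B k))⁻¹ * ⟪g k, T (g k)⟫ := by
      simp only [v, map_smul, real_inner_smul_left, real_inner_smul_right]
      rw [← mul_assoc, ← mul_inv, Real.mul_self_sqrt (hp k).le]
    calc c = (π.real (B k))⁻¹ * (c * π.real (B k)) := by have := (hp k).ne'; field_simp
      _ ≤ ⟪v k, T (v k)⟫ := by rw [h3]; have := hp k; gcongr
      _ ≤ ‖v k‖ * ‖T (v k)‖ := real_inner_le_norm _ _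
      _ = _ := by rw [hv.1 k, one_mul]
  have hlim := (hHS.summable_of_orthonormal hv).tendsto_atTop_zero
  have : c ^ 2 ≤ 0 := ge_of_tendsto' hlim fun k => by have := hTv k; gcongr
  nlinarith

end MarkovOperator

/-! ### One-dimensional integrals -/

section OneDim

open Set Real

lemma lintegral_Ioi_comp_inv (F : ℝ → ℝ≥0∞) :
    ∫⁻ x in Ioi (0 : ℝ), F x = ∫⁻ s in Ioi (0 : ℝ), ENNReal.ofReal (s ^ 2)⁻¹ * F s⁻¹ := by
  have himg : (fun s : ℝ => s⁻¹) '' Ioi 0 = Ioi 0 := by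
    ext x
    refine ⟨?_, fun hx => ⟨x⁻¹, mem_Ioi.2 (inv_pos.2 hx), inv_inv x⟩⟩
    rintro ⟨s, hs, rfl⟩
    exact inv_pos.2 (mem_Ioi.1 hs)
  have h := lintegral_image_eq_lintegral_abs_deriv_mul (s := Ioi (0 : ℝ)) measurableSet_Ioi
    (f := fun s => s⁻¹) (f' := fun s => -(s ^ 2)⁻¹)
    (fun x hx => (hasDerivAt_inv (ne_of_gt (mem_Ioi.1 hx))).hasDerivWithinAt)
    (fun x _ y _ h => inv_injective h) F
  rw [himg] at h
  rw [h]
  refine lintegral_congr fun s => ?_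
  rw [abs_neg, abs_of_nonneg (by positivity)]

lemma lintegral_Ioi_comp_sq (F : ℝ → ℝ≥0∞) :
    ∫⁻ x in Ioi (0 : ℝ), F x = ∫⁻ r in Ioi (0 : ℝ), ENNReal.ofReal (2 * r) * F (r ^ 2) := by
  have himg : (fun s : ℝ => s ^ 2) '' Ioi 0 = Ioi 0 := by
    ext x
    refine ⟨?_, fun hx => ⟨√x, sqrt_pos.2 hx, sq_sqrt (le_of_lt hx)⟩⟩
    rintro ⟨s, hs, rfl⟩
    exact pow_pos (mem_Ioi.1 hs) 2
  have h := lintegral_image_eq_lintegral_abs_deriv_mul (s := Ioi (0 : ℝ)) measurableSet_Ioi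
    (f := fun s => s ^ 2) (f' := fun s => 2 * s)
    (fun x _ => by simpa using (hasDerivAt_pow 2 x).hasDerivWithinAt)
    (fun x hx y hy h => (pow_left_inj₀ (le_of_lt hx) (le_of_lt hy) two_ne_zero).1 h) F
  rw [himg] at h
  rw [h]
  refine setLIntegral_congr_fun measurableSet_Ioi fun s hs => ?_
  have : (0 : ℝ) < s := hs
  rw [abs_of_nonneg (by positivity)]

/-- The **Cauchy–Schlömilch transformation**. -/
lemma two_mul_lintegral_Ioi_sub_div {ν : ℝ} (hν : 0 < ν) {G : ℝ → ℝ≥0∞} (hGm : Measurable G)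
    (hG : ∀ v, G (-v) = G v) :
    2 * ∫⁻ r in Ioi (0 : ℝ), G (r - ν / r) = ∫⁻ v, G v := by
  have hd : ∀ x ∈ Ioi (0 : ℝ), HasDerivAt (fun r : ℝ => ν / r) (-(ν / x ^ 2)) x := fun x hx => by
    have h := (hasDerivAt_inv (ne_of_gt (mem_Ioi.1 hx))).const_mul ν
    rw [show -(ν / x ^ 2) = ν * -(x ^ 2)⁻¹ by ring]
    simpa only [div_eq_mul_inv] using h
  have himg : (fun r : ℝ => r - ν / r) '' Ioi 0 = univ := by
    -- The witness is the positive root of `r² - v r - ν = 0`.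
    refine eq_univ_of_forall fun v => ⟨(v + √(v ^ 2 + 4 * ν)) / 2, ?_, ?_⟩
    · have h1 : |v| < √(v ^ 2 + 4 * ν) := by
        rw [← sqrt_sq_eq_abs]
        exact sqrt_lt_sqrt (sq_nonneg v) (by linarith)
      have h2 := neg_abs_le v
      exact mem_Ioi.2 (half_pos (by linarith))
    · have h1 : |v| < √(v ^ 2 + 4 * ν) := by
        rw [← sqrt_sq_eq_abs]
        exact sqrt_lt_sqrt (sq_nonneg v) (by linarith)
      have h2 := neg_abs_le v
      have h3 : v + √(v ^ 2 + 4 * ν) ≠ 0 := (by linarith : 0 < v + √(v ^ 2 + 4 * ν)).ne'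
      have h4 : √(v ^ 2 + 4 * ν) ^ 2 = v ^ 2 + 4 * ν := sq_sqrt (by positivity)
      field_simp
      linear_combination h4
  have himg' : (fun r : ℝ => ν / r) '' Ioi 0 = Ioi 0 := by
    ext x
    refine ⟨?_, fun hx => ⟨ν / x, div_pos hν hx, div_div_cancel₀ hν.ne'⟩⟩
    rintro ⟨s, hs, rfl⟩
    exact div_pos hν hs
  have hinj : InjOn (fun r : ℝ => r - ν / r) (Ioi 0) := by
    refine StrictMonoOn.injOn fun x hx y hy hxy => ?_
    have : ν / y < ν / x := div_lt_div_of_pos_left hν hx hxy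
    linarith
  -- The substitution `v = r - ν/r` carries the Jacobian `1 + ν/r²`. The reflection `r ↦ ν/r` sends
  -- `r - ν/r` to its negative and so turns the second copy of the half-line integral into the part
  -- with weight `ν/r²`.
  have h1 := lintegral_image_eq_lintegral_abs_deriv_mul (s := Ioi (0 : ℝ)) measurableSet_Ioi
    (f := fun r => r - ν / r) (f' := fun r => 1 - -(ν / r ^ 2))
    (fun x hx => ((hasDerivAt_id x).sub (hd x hx)).hasDerivWithinAt) hinj G
  have h2 := lintegral_image_eq_lintegral_abs_deriv_mul (s := Ioi (0 : ℝ)) measurableSet_Ioi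
    (f := fun r => ν / r) (f' := fun r => -(ν / r ^ 2))
    (fun x hx => (hd x hx).hasDerivWithinAt)
    (fun x _ y _ h => by simpa [div_eq_mul_inv, hν.ne'] using h) (fun r => G (r - ν / r))
  rw [himg, setLIntegral_univ] at h1
  rw [himg'] at h2
  rw [h1, two_mul]
  nth_rewrite 2 [h2]
  have hm : Measurable fun r : ℝ => G (r - ν / r) :=
    hGm.comp (measurable_id.sub (measurable_const.div measurable_id))
  rw [← lintegral_add_left hm]
  refine setLIntegral_congr_fun measurableSet_Ioi fun r hr => ?_
  have hr : (0 : ℝ) < r := hr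
  have hp : 0 ≤ ν / r ^ 2 := by positivity
  have he : ν / r - ν / (ν / r) = -(r - ν / r) := by
    rw [div_div_cancel₀ hν.ne']
    ring
  rw [he, hG, abs_neg, abs_of_nonneg hp, sub_neg_eq_add, abs_of_nonneg (by positivity),
    ENNReal.ofReal_add zero_le_one hp, add_mul, ENNReal.ofReal_one, one_mul]

lemma lintegral_gaussian {b : ℝ} (hb : 0 < b) :
    ∫⁻ x : ℝ, ENNReal.ofReal (exp (-b * x ^ 2)) = ENNReal.ofReal √(π / b) := by
  rw [← integral_gaussian, ofReal_integral_eq_lintegral_ofReal (integrable_exp_neg_mul_sq hb)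
    (Filter.Eventually.of_forall fun x => (exp_pos _).le)]

/-- The value does not depend on `ν`. The case `ν = 0`, where the substitution degenerates, is the
Lévy law met at a vanishing coefficient or increment. -/
lemma two_mul_lintegral_Ioi_gaussian {b ν : ℝ} (hb : 0 < b) (hν : 0 ≤ ν) :
    2 * ∫⁻ r in Ioi (0 : ℝ), ENNReal.ofReal (exp (-b * (r - ν / r) ^ 2))
      = ENNReal.ofReal √(π / b) := by
  rcases hν.eq_or_lt with rfl | hν
  · simp only [zero_div, sub_zero]
    rw [← ofReal_integral_eq_lintegral_ofReal (integrable_exp_neg_mul_sq hb).integrableOn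
      (Filter.Eventually.of_forall fun x => (exp_pos _).le), integral_gaussian_Ioi,
      show (2 : ℝ≥0∞) = ENNReal.ofReal 2 by simp, ← ENNReal.ofReal_mul (by norm_num)]
    congr 1
    ring
  · rw [two_mul_lintegral_Ioi_sub_div hν (G := fun v => ENNReal.ofReal (exp (-b * v ^ 2)))
      (by fun_prop) (fun v => by simp), lintegral_gaussian hb]

end OneDim

/-! ### The reciprocal inverse-Gaussian and inverse-gamma laws. -/

namespace FusedLasso

open Set Real

lemma recipInvGaussianPdf_eq {ν l t : ℝ} (ht : 0 < t) :
    recipInvGaussianPdf ν l t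
      = √(l / (2 * π)) * t ^ (-(1 / 2) : ℝ) * exp (-(l * (ν - t) ^ 2) / (2 * t)) := by
  unfold recipInvGaussianPdf invGaussianPdf
  have h1 : √(l / (2 * π * t⁻¹ ^ 3)) = √(l / (2 * π)) * (√(t ^ 3)) := by
    rw [← sqrt_mul' _ (by positivity)]
    congr 1
    field_simp
  have h2 : √(t ^ 3) = t ^ 2 * t ^ (-(1 / 2) : ℝ) := by
    rw [sqrt_eq_rpow, ← rpow_natCast t 3, ← rpow_mul ht.le, ← rpow_natCast t 2, ← rpow_add ht]
    norm_num
  have h3 : -(l * (ν * t⁻¹ - 1) ^ 2) / (2 * t⁻¹) = -(l * (ν - t) ^ 2) / (2 * t) := by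
    field_simp
  rw [h1, h2, h3]
  field_simp

lemma recipInvGaussianPdf_nonneg {ν l t : ℝ} : 0 ≤ recipInvGaussianPdf ν l t := by
  unfold recipInvGaussianPdf invGaussianPdf
  positivity

lemma measurable_recipInvGaussianPdf :
    Measurable fun z : ℝ × ℝ × ℝ => recipInvGaussianPdf z.1 z.2.1 z.2.2 := by
  unfold recipInvGaussianPdf invGaussianPdf
  fun_prop

/-- With `t = r²` the factor `t^(-1/2) dt` becomes `2 dr` and the exponent becomes `-(l/2)(r -
ν/r)²`, a Cauchy–Schlömilch integral. -/
lemma lintegral_recipInvGaussianPdf {ν l : ℝ} (hν : 0 ≤ ν) (hl : 0 < l) :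
    ∫⁻ t in Ioi (0 : ℝ), ENNReal.ofReal (recipInvGaussianPdf ν l t) = 1 := by
  rw [lintegral_Ioi_comp_sq]
  have h : ∀ r ∈ Ioi (0 : ℝ), ENNReal.ofReal (2 * r) * ENNReal.ofReal (recipInvGaussianPdf ν l (r ^ 2))
      = ENNReal.ofReal √(l / (2 * π)) *
        (2 * ENNReal.ofReal (exp (-(l / 2) * (r - ν / r) ^ 2))) := fun r hr => by
    have hr : (0 : ℝ) < r := hr
    rw [recipInvGaussianPdf_eq (by positivity), show (2 : ℝ≥0∞) = ENNReal.ofReal 2 by simp,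
      ← ENNReal.ofReal_mul (by positivity), ← ENNReal.ofReal_mul (by positivity),
      ← ENNReal.ofReal_mul (by positivity)]
    congr 1
    have h1 : (r ^ 2) ^ (-(1 / 2) : ℝ) = r⁻¹ := by
      rw [← rpow_natCast r 2, ← rpow_mul hr.le, ← rpow_neg_one]
      norm_num
    have h2 : -(l * (ν - r ^ 2) ^ 2) / (2 * r ^ 2) = -(l / 2) * (r - ν / r) ^ 2 := by
      field_simp
      ring
    rw [h1, h2]
    field_simp
  rw [setLIntegral_congr_fun measurableSet_Ioi h, lintegral_const_mul _ (by fun_prop),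
    lintegral_const_mul _ (by fun_prop), two_mul_lintegral_Ioi_gaussian (by positivity) hν,
    ← ENNReal.ofReal_mul (by positivity), ← sqrt_mul (by positivity)]
  rw [show l / (2 * π) * (π / (l / 2)) = 1 by field_simp]
  simp

/-- The mean of the reciprocal of an inverse-Gaussian variable with mean `1 / ν` grows at most
linearly in `ν`. -/
lemma exists_lintegral_mul_recipInvGaussianPdf_le {l : ℝ} (hl : 0 < l) :
    ∃ C, 0 ≤ C ∧ ∀ ν, 0 ≤ ν →
      ∫⁻ t in Ioi (0 : ℝ), ENNReal.ofReal (t * recipInvGaussianPdf ν l t) ≤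
        ENNReal.ofReal (2 * ν + C) := by
  let h : ℝ → ℝ := fun t => √(l / (2 * π)) * (t ^ (1 / 2 : ℝ) * exp (-(l / 8) * t ^ (1 : ℝ)))
  have hi : IntegrableOn h (Ioi 0) :=
    (integrableOn_rpow_mul_exp_neg_mul_rpow (by norm_num) one_pos (by positivity)).const_mul _
  have h0 : ∀ᵐ t ∂(volume.restrict (Ioi (0 : ℝ))), 0 ≤ h t :=
    (ae_restrict_iff' measurableSet_Ioi).2 (Filter.Eventually.of_forall fun t ht => by
      have ht : (0 : ℝ) < t := ht
      positivity)
  refine ⟨∫ t in Ioi 0, h t, integral_nonneg_of_ae h0, fun ν hν => ?_⟩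
  rw [ENNReal.ofReal_add (by positivity) (integral_nonneg_of_ae h0),
    ofReal_integral_eq_lintegral_ofReal hi h0]
  have hm : Measurable fun t => recipInvGaussianPdf ν l t :=
    measurable_recipInvGaussianPdf.comp (by fun_prop : Measurable fun t : ℝ => (ν, l, t))
  calc _ ≤ ∫⁻ t in Ioi (0 : ℝ), (ENNReal.ofReal (2 * ν) *
        ENNReal.ofReal (recipInvGaussianPdf ν l t) + ENNReal.ofReal (h t)) := by
        refine setLIntegral_mono' measurableSet_Ioi fun t ht => ?_
        have ht : (0 : ℝ) < t := ht
        have hp := recipInvGaussianPdf_nonneg (ν := ν) (l := l) (t := t)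
        have hh : 0 ≤ h t := by positivity
        rw [← ENNReal.ofReal_mul (by positivity), ← ENNReal.ofReal_add (by positivity) hh]
        refine ENNReal.ofReal_le_ofReal ?_
        -- Up to `2ν` the factor `t` is bounded by `2ν` and the density has mass one. Beyond it `(ν
        -- - t)² ≥ t²/4`, so the integrand is below the envelope `h`, which is free of `ν`.
        rcases le_or_gt t (2 * ν) with htν | htν
        · have := mul_le_mul_of_nonneg_right htν hp
          linarith
        · have h1 : t * recipInvGaussianPdf ν l t ≤ h t := by
            rw [recipInvGaussianPdf_eq ht]
            have h2 : t ^ (1 / 2 : ℝ) = t * t ^ (-(1 / 2) : ℝ) := by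
              nth_rewrite 2 [← rpow_one t]
              rw [← rpow_add ht]
              norm_num
            have h3 : exp (-(l * (ν - t) ^ 2) / (2 * t)) ≤ exp (-(l / 8) * t ^ (1 : ℝ)) := by
              rw [rpow_one, exp_le_exp, div_le_iff₀ (by positivity)]
              have : t ^ 2 / 4 ≤ (ν - t) ^ 2 := by nlinarith
              nlinarith
            calc _ = √(l / (2 * π)) * (t * t ^ (-(1 / 2) : ℝ) *
                  exp (-(l * (ν - t) ^ 2) / (2 * t))) := by ring
              _ ≤ _ := by
                simp only [h, h2]
                gcongr
          have : 0 ≤ 2 * ν * recipInvGaussianPdf ν l t := by positivity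
          linarith
    _ = _ := by
        rw [lintegral_add_left (by fun_prop), lintegral_const_mul _ (by fun_prop),
          lintegral_recipInvGaussianPdf hν hl, mul_one]

/-- Uniformity over `ν ∈ [0, M]` is the point: it gives the minorization, and later the bound
uniform over the boxes of all sizes. -/
lemma exists_le_recipInvGaussianPdf {l : ℝ} (hl : 0 < l) (M : ℝ) :
    ∃ c, 0 < c ∧ ∀ ν, 0 ≤ ν → ν ≤ M → ∀ t ∈ Icc (1 : ℝ) 2, c ≤ recipInvGaussianPdf ν l t := by
  refine ⟨√(l / (2 * π)) * 2 ^ (-(1 / 2) : ℝ) * exp (-(l * (M + 2) ^ 2)), by positivity,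
    fun ν hν hνM t ht => ?_⟩
  have ht0 : 0 < t := by linarith [ht.1]
  rw [recipInvGaussianPdf_eq ht0]
  have h1 : (2 : ℝ) ^ (-(1 / 2) : ℝ) ≤ t ^ (-(1 / 2) : ℝ) :=
    rpow_le_rpow_of_nonpos ht0 ht.2 (by norm_num)
  have h2 : exp (-(l * (M + 2) ^ 2)) ≤ exp (-(l * (ν - t) ^ 2) / (2 * t)) := by
    rw [exp_le_exp, le_div_iff₀ (by positivity)]
    have h3 : (ν - t) ^ 2 ≤ (M + 2) ^ 2 := by
      apply sq_le_sq' <;> linarith [ht.1, ht.2]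
    have h4 : l * (ν - t) ^ 2 ≤ l * (M + 2) ^ 2 := by gcongr
    have h5 : 0 ≤ l * (M + 2) ^ 2 := by positivity
    nlinarith [ht.1]
  gcongr

lemma invGammaPdf_pos {a b s : ℝ} (ha : 0 < a) (hb : 0 < b) (hs : 0 < s) :
    0 < invGammaPdf a b s := by
  unfold invGammaPdf
  have := Gamma_pos_of_pos ha
  positivity

/-- Inversion `s ↦ 1/s` reduces this to the gamma law. -/
lemma lintegral_invGammaPdf {a b : ℝ} (ha : 0 < a) (hb : 0 < b) :
    ∫⁻ s in Ioi (0 : ℝ), ENNReal.ofReal (invGammaPdf a b s) = 1 := by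
  have h1 : ∫⁻ x in Ioi (0 : ℝ), gammaPDF a b x = 1 := by
    have h := lintegral_add_compl (μ := volume) (fun x => gammaPDF a b x)
      (measurableSet_Ici (a := (0 : ℝ)))
    rw [compl_Ici, lintegral_gammaPDF_of_nonpos le_rfl, add_zero,
      lintegral_gammaPDF_eq_one ha hb] at h
    rw [setLIntegral_congr Ioi_ae_eq_Ici, h]
  rw [← h1, lintegral_Ioi_comp_inv (gammaPDF a b)]
  refine setLIntegral_congr_fun measurableSet_Ioi fun s hs => ?_
  have hs : (0 : ℝ) < s := hs
  rw [gammaPDF_of_nonneg (by positivity), ← ENNReal.ofReal_mul (by positivity)]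
  congr 1
  unfold invGammaPdf
  have h2 : (s ^ 2)⁻¹ * s⁻¹ ^ (a - 1) = s ^ (-a - 1) := by
    rw [inv_rpow hs.le, ← rpow_natCast, ← rpow_neg hs.le, ← rpow_neg hs.le, ← rpow_add hs]
    congr 1
    push_cast
    ring
  rw [← h2, div_eq_mul_inv (-b) s, neg_mul]
  ring

/-- Weighting by `b / s` raises the shape by one, so `b / s` has mean `a` whatever the scale `b` is.
-/
lemma div_mul_invGammaPdf {a b s : ℝ} (ha : 0 < a) (hb : 0 < b) (hs : 0 < s) :
    b / s * invGammaPdf a b s = a * invGammaPdf (a + 1) b s := by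
  unfold invGammaPdf
  rw [Gamma_add_one ha.ne', rpow_add_one hb.ne', show -(a + 1) - 1 = (-a - 1) - 1 by ring,
    rpow_sub_one hs.ne' (-a - 1)]
  have := Gamma_pos_of_pos ha
  field_simp

lemma lintegral_div_mul_invGammaPdf {a b : ℝ} (ha : 0 < a) (hb : 0 < b) :
    ∫⁻ s in Ioi (0 : ℝ), ENNReal.ofReal (b / s * invGammaPdf a b s) = ENNReal.ofReal a := by
  rw [setLIntegral_congr_fun measurableSet_Ioi (g := fun s => ENNReal.ofReal a *
    ENNReal.ofReal (invGammaPdf (a + 1) b s)), lintegral_const_mul _ (by unfold invGammaPdf; fun_prop),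
    lintegral_invGammaPdf (by positivity) hb, mul_one]
  intro s hs
  simp only
  rw [div_mul_invGammaPdf ha hb hs, ENNReal.ofReal_mul ha.le]

end FusedLasso

/-! ### Exponential integrals and integrals of products. -/

open Set Real

/-- Substituting `v = s^(-1/2)` gives a gamma integral. Near `s = 0` a decay `exp (-δ/√s)` is all
that will be available for the variance. -/
lemma integrableOn_rpow_mul_exp_neg_div_sqrt {a δ : ℝ} (ha : 0 < a) (hδ : 0 < δ) :
    IntegrableOn (fun s : ℝ => s ^ (-a - 1) * exp (-δ / √s)) (Ioi 0) := by
  have h1 : IntegrableOn (fun v : ℝ => v ^ (2 * a - 1) * exp (-δ * v ^ (1 : ℝ))) (Ioi 0) :=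
    integrableOn_rpow_mul_exp_neg_mul_rpow (by linarith) one_pos hδ
  refine ((integrableOn_Ioi_comp_rpow_iff' _ (p := -(1 / 2)) (by norm_num)).2 h1).congr_fun ?_
    measurableSet_Ioi
  intro s hs
  have hs : (0 : ℝ) < s := hs
  simp only [smul_eq_mul, rpow_one]
  rw [← mul_assoc, ← rpow_mul hs.le, ← rpow_add hs, rpow_neg hs.le (1 / 2), ← sqrt_eq_rpow]
  congr 2
  ring

lemma lintegral_exp_neg_mul_abs {c : ℝ} (hc : 0 < c) :
    ∫⁻ x : ℝ, ENNReal.ofReal (exp (-c * |x|)) = ENNReal.ofReal (2 / c) := by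
  have h1 : ∫⁻ x in Ioi (0 : ℝ), ENNReal.ofReal (exp (-c * |x|)) = ENNReal.ofReal (1 / c) := by
    have hi := integrableOn_exp_mul_Ioi (neg_lt_zero.2 hc) 0
    have he := integral_exp_mul_Ioi (neg_lt_zero.2 hc) 0
    rw [setLIntegral_congr_fun measurableSet_Ioi (g := fun x => ENNReal.ofReal (exp (-c * x)))
      (fun x hx => by simp only; rw [abs_of_pos hx]),
      ← ofReal_integral_eq_lintegral_ofReal hi (Filter.Eventually.of_forall fun x => (exp_pos _).le),
      he]
    simp
  have h2 : ∫⁻ x in Iic (0 : ℝ), ENNReal.ofReal (exp (-c * |x|)) = ENNReal.ofReal (1 / c) := by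
    have hi := integrableOn_exp_mul_Iic hc 0
    have he := integral_exp_mul_Iic hc 0
    rw [setLIntegral_congr_fun measurableSet_Iic (g := fun x => ENNReal.ofReal (exp (c * x)))
      (fun x hx => by simp only; rw [abs_of_nonpos hx, neg_mul_neg]),
      ← ofReal_integral_eq_lintegral_ofReal hi (Filter.Eventually.of_forall fun x => (exp_pos _).le),
      he]
    simp
  rw [← lintegral_add_compl _ measurableSet_Ioi, compl_Ioi, h1, h2,
    ← ENNReal.ofReal_add (by positivity) (by positivity)]
  congr 1
  ring

lemma lintegral_fin_prod {k : ℕ} (μ : Fin k → Measure ℝ) [∀ i, SigmaFinite (μ i)]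
    {f : Fin k → ℝ → ℝ≥0∞} (hf : ∀ i, Measurable (f i)) :
    ∫⁻ x, ∏ i, f i (x i) ∂(Measure.pi μ) = ∏ i, ∫⁻ t, f i t ∂(μ i) := by
  induction k with
  | zero => simp
  | succ k ih =>
    have h1 := (measurePreserving_piFinSuccAbove μ 0).symm.lintegral_comp_emb
      (MeasurableEquiv.measurableEmbedding _) (fun x => ∏ i, f i (x i))
    have h2 : ∀ z : ℝ × (Fin k → ℝ), ∏ i, f i ((MeasurableEquiv.piFinSuccAbove (fun _ => ℝ) 0).symm
        z i) = f 0 z.1 * ∏ i : Fin k, f i.succ (z.2 i) := fun z => by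
      rw [Fin.prod_univ_succ]
      rfl
    rw [← h1, Fin.prod_univ_succ, ← ih (fun i => μ i.succ) (fun i => hf i.succ)]
    simp only [h2]
    exact lintegral_prod_mul (hf 0).aemeasurable (Finset.measurable_prod _ fun (i : Fin k) _ =>
      (hf i.succ).comp (measurable_pi_apply i)).aemeasurable

/-! ### Gaussian integrals and quadratic forms -/

namespace FusedLasso

open Set Real Matrix

lemma lintegral_comp_mulVec {k : ℕ} {C : Matrix (Fin k) (Fin k) ℝ} (hC : C.det ≠ 0)
    {F : (Fin k → ℝ) → ℝ≥0∞} (hF : Measurable F) :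
    ∫⁻ x, F (C *ᵥ x) = ENNReal.ofReal |(C.det)⁻¹| * ∫⁻ z, F z := by
  have h := Real.map_matrix_volume_pi_eq_smul_volume_pi hC
  have hm : Measurable (toLin' C) := (LinearMap.continuous_on_pi (toLin' C)).measurable
  rw [← smul_eq_mul, ← lintegral_smul_measure, ← h, lintegral_map hF hm]
  rfl

lemma lintegral_exp_neg_half_dotProduct_self (k : ℕ) :
    ∫⁻ z : Fin k → ℝ, ENNReal.ofReal (exp (-(z ⬝ᵥ z) / 2)) = ENNReal.ofReal √((2 * π) ^ k) := by
  have h : ∀ z : Fin k → ℝ, ENNReal.ofReal (exp (-(z ⬝ᵥ z) / 2))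
      = ∏ i, ENNReal.ofReal (exp (-(1 / 2) * z i ^ 2)) := fun z => by
    rw [← ENNReal.ofReal_prod_of_nonneg (fun i _ => (exp_pos _).le), ← exp_sum]
    congr 2
    rw [← Finset.mul_sum, dotProduct]
    simp only [sq]
    ring
  simp only [h]
  rw [volume_pi, lintegral_fin_prod (fun _ => volume) (f := fun _ x => ENNReal.ofReal (exp (-(1 / 2) * x ^ 2)))
    (fun i => by fun_prop), Finset.prod_const, lintegral_gaussian (by norm_num), Finset.card_univ,
    Fintype.card_fin, ← ENNReal.ofReal_pow (by positivity)]
  congr 1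
  rw [show π / (1 / 2) = 2 * π by ring, sqrt_eq_rpow, sqrt_eq_rpow, ← rpow_natCast,
    ← rpow_natCast, ← rpow_mul (by positivity), ← rpow_mul (by positivity), mul_comm (k : ℝ)]

/-- Write `P = CᵀC` and substitute `z = Cx`; the Jacobian is `|det C| = √det P`. -/
lemma lintegral_exp_neg_quadForm {k : ℕ} {P : Matrix (Fin k) (Fin k) ℝ} (hP : P.PosDef)
    (m : Fin k → ℝ) :
    ∫⁻ x, ENNReal.ofReal (exp (-((x - m) ⬝ᵥ (P *ᵥ (x - m))) / 2))
      = ENNReal.ofReal (√((2 * π) ^ k) / √P.det) := by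
  obtain ⟨C, hC⟩ : ∃ C : Matrix (Fin k) (Fin k) ℝ, P = Cᵀ * C := by
    open scoped MatrixOrder in
    obtain ⟨a, ha⟩ := CStarAlgebra.nonneg_iff_eq_star_mul_self.mp hP.posSemidef.nonneg
    exact ⟨a, by rw [ha, star_eq_conjTranspose, conjTranspose_eq_transpose_of_trivial]⟩
  have hdet : P.det = C.det ^ 2 := by rw [hC, det_mul, det_transpose, sq]
  have hdetC : C.det ≠ 0 := fun h => by
    have := hP.det_pos
    rw [hdet, h] at this
    norm_num at this
  rw [lintegral_sub_right_eq_self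
    (fun x : Fin k → ℝ => ENNReal.ofReal (exp (-(x ⬝ᵥ (P *ᵥ x)) / 2))) m]
  have h : ∀ x : Fin k → ℝ, x ⬝ᵥ (P *ᵥ x) = (C *ᵥ x) ⬝ᵥ (C *ᵥ x) := fun x => by
    rw [hC, ← mulVec_mulVec, dotProduct_mulVec, vecMul_transpose]
  simp only [h]
  have hm : Measurable fun z : Fin k → ℝ => ENNReal.ofReal (exp (-(z ⬝ᵥ z) / 2)) := by
    unfold dotProduct
    fun_prop
  rw [lintegral_comp_mulVec hdetC hm, lintegral_exp_neg_half_dotProduct_self,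
    ← ENNReal.ofReal_mul (by positivity), hdet, sqrt_sq_eq_abs, abs_inv]
  congr 1
  ring

/-- Every normal law of the model has covariance `s • A⁻¹` with an explicit precision `A`; in this
form no matrix inverse is left in the quadratic form. -/
lemma normalPdf_smul_inv {k : ℕ} {A : Matrix (Fin k) (Fin k) ℝ} (hA : A.PosDef) {s : ℝ} (hs : 0 < s)
    (m x : Fin k → ℝ) :
    normalPdf m (s • A⁻¹) x = (√((2 * π) ^ k))⁻¹ * (√(s ^ k))⁻¹ * √A.det *
      exp (-((x - m) ⬝ᵥ (A *ᵥ (x - m))) / (2 * s)) := by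
  have hdet := hA.det_pos
  have hu : IsUnit A.det := hdet.ne'.isUnit
  have hu' : IsUnit (A⁻¹).det := by
    rw [det_nonsing_inv, Ring.inverse_eq_inv']
    exact (inv_pos.2 hdet).ne'.isUnit
  have hinv : (s • A⁻¹)⁻¹ = s⁻¹ • A := by
    have := Matrix.inv_smul' (A := A⁻¹) (Units.mk0 s hs.ne') hu'
    rw [nonsing_inv_nonsing_inv A hu] at this
    exact this
  unfold normalPdf
  rw [hinv, det_smul, Fintype.card_fin, det_nonsing_inv, Ring.inverse_eq_inv', smul_mulVec,
    dotProduct_smul, smul_eq_mul, sqrt_mul (by positivity), sqrt_mul (by positivity), sqrt_inv]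
  have : √A.det ≠ 0 := (sqrt_pos.2 hdet).ne'
  have h2 : -(s⁻¹ * (x - m) ⬝ᵥ A *ᵥ (x - m)) / 2 = -((x - m) ⬝ᵥ A *ᵥ (x - m)) / (2 * s) := by
    field_simp
  rw [h2]
  field_simp

lemma lintegral_normalPdf_smul_inv {k : ℕ} {A : Matrix (Fin k) (Fin k) ℝ} (hA : A.PosDef) {s : ℝ}
    (hs : 0 < s) (m : Fin k → ℝ) :
    ∫⁻ x, ENNReal.ofReal (normalPdf m (s • A⁻¹) x) = 1 := by
  have hP : (s⁻¹ • A).PosDef := hA.smul (inv_pos.2 hs)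
  have hdet := hA.det_pos
  have h : ∀ x, normalPdf m (s • A⁻¹) x = ((√((2 * π) ^ k))⁻¹ * (√(s ^ k))⁻¹ * √A.det) *
      exp (-((x - m) ⬝ᵥ ((s⁻¹ • A) *ᵥ (x - m))) / 2) := fun x => by
    rw [normalPdf_smul_inv hA hs, smul_mulVec, dotProduct_smul, smul_eq_mul]
    congr 2
    field_simp
  simp only [h]
  simp only [ENNReal.ofReal_mul (show 0 ≤ (√((2 * π) ^ k))⁻¹ * (√(s ^ k))⁻¹ * √A.det by positivity)]
  rw [lintegral_const_mul' _ _ ENNReal.ofReal_ne_top, lintegral_exp_neg_quadForm hP,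
    ← ENNReal.ofReal_mul (by positivity), det_smul, Fintype.card_fin, sqrt_mul (by positivity),
    inv_pow, sqrt_inv]
  have h1 : √A.det ≠ 0 := (sqrt_pos.2 hdet).ne'
  have h2 : √(s ^ k) ≠ 0 := (sqrt_pos.2 (by positivity)).ne'
  have h3 : √((2 * π) ^ k) ≠ 0 := (sqrt_pos.2 (by positivity)).ne'
  rw [show (√((2 * π) ^ k))⁻¹ * (√(s ^ k))⁻¹ * √A.det * (√((2 * π) ^ k) / ((√(s ^ k))⁻¹ * √A.det)) = 1 by
    field_simp]
  exact ENNReal.ofReal_one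

variable {n q : ℕ}

lemma fusionVec_dotProduct (j : Fin q) (b : Fin (q + 1) → ℝ) :
    fusionVec j ⬝ᵥ b = b j.succ - b j.castSucc := by
  simp [fusionVec, sub_dotProduct]

lemma priorPrecision_quadForm (t : Fin (q + 1) → ℝ) (w : Fin q → ℝ) (b : Fin (q + 1) → ℝ) :
    b ⬝ᵥ (priorPrecision t w *ᵥ b)
      = ∑ i, b i ^ 2 / t i + ∑ j : Fin q, (b j.succ - b j.castSucc) ^ 2 / w j := by
  unfold priorPrecision
  rw [add_mulVec, dotProduct_add, sum_mulVec, dotProduct_sum]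
  congr 1
  · simp only [dotProduct, mulVec_diagonal]
    refine Finset.sum_congr rfl fun i _ => ?_
    ring
  · refine Finset.sum_congr rfl fun j _ => ?_
    rw [smul_mulVec, dotProduct_smul, vecMulVec_mulVec, dotProduct_smul, fusionVec_dotProduct,
      dotProduct_comm, fusionVec_dotProduct]
    simp only [smul_eq_mul, MulOpposite.smul_eq_mul_unop, MulOpposite.unop_op]
    ring

lemma posDef_priorPrecision {t : Fin (q + 1) → ℝ} {w : Fin q → ℝ} (ht : t ∈ posOrthant (q + 1))
    (hw : w ∈ posOrthant q) : (priorPrecision t w).PosDef := by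
  refine PosDef.add_posSemidef (.diagonal fun i => one_div_pos.2 (ht i)) (posSemidef_sum _ fun j _ => ?_)
  have h := posSemidef_vecMulVec_self_star (fusionVec j)
  rw [star_trivial] at h
  exact h.smul (one_div_pos.2 (hw j)).le

lemma posDef_postPrecision (X : Matrix (Fin n) (Fin (q + 1)) ℝ) {t : Fin (q + 1) → ℝ}
    {w : Fin q → ℝ} (ht : t ∈ posOrthant (q + 1)) (hw : w ∈ posOrthant q) :
    (postPrecision X t w).PosDef := by
  have h := posSemidef_conjTranspose_mul_self X
  rw [conjTranspose_eq_transpose_of_trivial] at h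
  exact .posSemidef_add h (posDef_priorPrecision ht hw)

/-- The generalized-ridge criterion `‖Y - Xβ‖² + βᵀ Σ⁻¹ β`. -/
def penalizedRSS (X : Matrix (Fin n) (Fin (q + 1)) ℝ) (Y : Fin n → ℝ) (t : Fin (q + 1) → ℝ)
    (w : Fin q → ℝ) (b : Fin (q + 1) → ℝ) : ℝ :=
  (Y - X *ᵥ b) ⬝ᵥ (Y - X *ᵥ b) + b ⬝ᵥ (priorPrecision t w *ᵥ b)

/-- The minimum of the generalized-ridge criterion. -/
def minRSS (X : Matrix (Fin n) (Fin (q + 1)) ℝ) (Y : Fin n → ℝ) (t : Fin (q + 1) → ℝ)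
    (w : Fin q → ℝ) : ℝ :=
  Y ⬝ᵥ (((1 : Matrix (Fin n) (Fin n) ℝ) - X * (postPrecision X t w)⁻¹ * Xᵀ) *ᵥ Y)

lemma dotProduct_self_nonneg' {k : ℕ} (v : Fin k → ℝ) : 0 ≤ v ⬝ᵥ v :=
  Finset.sum_nonneg fun i _ => mul_self_nonneg (v i)

lemma dotProduct_self_pos {k : ℕ} {v : Fin k → ℝ} (hv : v ≠ 0) : 0 < v ⬝ᵥ v :=
  (dotProduct_self_nonneg' v).lt_of_ne' fun h => hv (dotProduct_self_eq_zero.1 h)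

/-- Completing the square. -/
lemma penalizedRSS_eq (X : Matrix (Fin n) (Fin (q + 1)) ℝ) (Y : Fin n → ℝ) {t : Fin (q + 1) → ℝ}
    {w : Fin q → ℝ} (ht : t ∈ posOrthant (q + 1)) (hw : w ∈ posOrthant q) (b : Fin (q + 1) → ℝ) :
    (b - (postPrecision X t w)⁻¹ *ᵥ (Xᵀ *ᵥ Y)) ⬝ᵥ
      (postPrecision X t w *ᵥ (b - (postPrecision X t w)⁻¹ *ᵥ (Xᵀ *ᵥ Y)))
      = penalizedRSS X Y t w b - minRSS X Y t w := by
  have hA := posDef_postPrecision X ht hw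
  have hu : IsUnit (postPrecision X t w).det := hA.det_pos.ne'.isUnit
  obtain ⟨m, hm⟩ : ∃ m, m = (postPrecision X t w)⁻¹ *ᵥ (Xᵀ *ᵥ Y) := ⟨_, rfl⟩
  have hAm : postPrecision X t w *ᵥ m = Xᵀ *ᵥ Y := by
    rw [hm, mulVec_mulVec, mul_nonsing_inv _ hu, one_mulVec]
  have hmA : m ⬝ᵥ (postPrecision X t w *ᵥ b) = b ⬝ᵥ (Xᵀ *ᵥ Y) := by
    have hs : (postPrecision X t w)ᵀ = postPrecision X t w := by
      have := hA.isHermitian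
      rwa [IsHermitian, conjTranspose_eq_transpose_of_trivial] at this
    rw [dotProduct_mulVec, ← mulVec_transpose, hs, hAm, dotProduct_comm]
  have hXb : Y ⬝ᵥ (X *ᵥ b) = b ⬝ᵥ (Xᵀ *ᵥ Y) := by
    rw [dotProduct_mulVec, ← mulVec_transpose, dotProduct_comm]
  have hXX : b ⬝ᵥ (postPrecision X t w *ᵥ b)
      = (X *ᵥ b) ⬝ᵥ (X *ᵥ b) + b ⬝ᵥ (priorPrecision t w *ᵥ b) := by
    unfold postPrecision
    rw [add_mulVec, dotProduct_add, ← mulVec_mulVec, dotProduct_mulVec b, vecMul_transpose]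
  have hmin : minRSS X Y t w = Y ⬝ᵥ Y - m ⬝ᵥ (Xᵀ *ᵥ Y) := by
    unfold minRSS
    rw [sub_mulVec, one_mulVec, dotProduct_sub, ← mulVec_mulVec, ← mulVec_mulVec, ← hm,
      dotProduct_mulVec, ← mulVec_transpose, dotProduct_comm m]
  rw [← hm, mulVec_sub, hAm, dotProduct_sub, sub_dotProduct, sub_dotProduct, hmA, hXX, hmin]
  unfold penalizedRSS
  rw [dotProduct_sub, sub_dotProduct, sub_dotProduct, dotProduct_comm (X *ᵥ b) Y, hXb]
  ring

lemma priorPrecision_quadForm_nonneg {t : Fin (q + 1) → ℝ} {w : Fin q → ℝ}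
    (ht : t ∈ posOrthant (q + 1)) (hw : w ∈ posOrthant q) (b : Fin (q + 1) → ℝ) :
    0 ≤ b ⬝ᵥ (priorPrecision t w *ᵥ b) := by
  rw [priorPrecision_quadForm]
  exact add_nonneg (Finset.sum_nonneg fun i _ => div_nonneg (sq_nonneg _) (ht i).le)
    (Finset.sum_nonneg fun j _ => div_nonneg (sq_nonneg _) (hw j).le)

lemma penalizedRSS_nonneg (X : Matrix (Fin n) (Fin (q + 1)) ℝ) (Y : Fin n → ℝ)
    {t : Fin (q + 1) → ℝ} {w : Fin q → ℝ} (ht : t ∈ posOrthant (q + 1)) (hw : w ∈ posOrthant q)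
    (b : Fin (q + 1) → ℝ) : 0 ≤ penalizedRSS X Y t w b :=
  add_nonneg (dotProduct_self_nonneg' _) (priorPrecision_quadForm_nonneg ht hw b)

lemma penalizedRSS_pos (X : Matrix (Fin n) (Fin (q + 1)) ℝ) {Y : Fin n → ℝ} (hY : Y ≠ 0)
    {t : Fin (q + 1) → ℝ} {w : Fin q → ℝ} (ht : t ∈ posOrthant (q + 1)) (hw : w ∈ posOrthant q)
    (b : Fin (q + 1) → ℝ) : 0 < penalizedRSS X Y t w b := by
  by_cases hb : b = 0
  · subst hb
    simpa [penalizedRSS] using dotProduct_self_pos hY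
  · have := (posDef_priorPrecision ht hw).dotProduct_mulVec_pos hb
    rw [star_trivial] at this
    exact add_pos_of_nonneg_of_pos (dotProduct_self_nonneg' _) this

/-- The completed square vanishes at its centre. Positivity of `minRSS` is thus inherited from the
criterion itself. -/
lemma minRSS_eq_penalizedRSS (X : Matrix (Fin n) (Fin (q + 1)) ℝ) (Y : Fin n → ℝ)
    {t : Fin (q + 1) → ℝ} {w : Fin q → ℝ} (ht : t ∈ posOrthant (q + 1)) (hw : w ∈ posOrthant q) :
    minRSS X Y t w = penalizedRSS X Y t w ((postPrecision X t w)⁻¹ *ᵥ (Xᵀ *ᵥ Y)) := by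
  have := penalizedRSS_eq X Y ht hw ((postPrecision X t w)⁻¹ *ᵥ (Xᵀ *ᵥ Y))
  rw [sub_self, zero_dotProduct] at this
  linarith

end FusedLasso

/-! ### Factorizations of the joint density -/

namespace FusedLasso

open Set Real Matrix

variable {n q : ℕ}

/-- The factor of the joint density that depends on the scales only. -/
def scaleFactor (lam₁ lam₂ : ℝ) (t : Fin (q + 1) → ℝ) (w : Fin q → ℝ) : ℝ :=
  (∏ i, (t i) ^ (-(1 / 2) : ℝ) * exp (-(lam₁ ^ 2 * t i) / 2)) *
    ∏ j, (w j) ^ (-(1 / 2) : ℝ) * exp (-(lam₂ ^ 2 * w j) / 2)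

lemma scaleFactor_pos (lam₁ lam₂ : ℝ) {t : Fin (q + 1) → ℝ} {w : Fin q → ℝ}
    (ht : t ∈ posOrthant (q + 1)) (hw : w ∈ posOrthant q) : 0 < scaleFactor lam₁ lam₂ t w :=
  mul_pos (Finset.prod_pos fun i _ => mul_pos (rpow_pos_of_pos (ht i) _) (exp_pos _))
    (Finset.prod_pos fun j _ => mul_pos (rpow_pos_of_pos (hw j) _) (exp_pos _))

/-- The power of `2π` in the joint density. -/
def gaussConst (n q : ℕ) : ℝ := (√((2 * π) ^ n))⁻¹ * (√((2 * π) ^ (q + 1)))⁻¹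

lemma gaussConst_pos (n q : ℕ) : 0 < gaussConst n q := by
  unfold gaussConst
  positivity

lemma sqrt_pow_eq_rpow {s : ℝ} (hs : 0 < s) (k : ℕ) : √(s ^ k) = s ^ ((k : ℝ) / 2) := by
  rw [sqrt_eq_rpow, ← rpow_natCast, ← rpow_mul hs.le]
  congr 1
  ring

/-- The factor `√det Σ` of the scale prior cancels the determinant of the normal density of `β`;
what remains is an inverse-gamma kernel in the variance with rate given by the ridge criterion. -/
lemma jointDensity_eq (X : Matrix (Fin n) (Fin (q + 1)) ℝ) (Y : Fin n → ℝ) (α ξ lam₁ lam₂ : ℝ)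
    (x : State q) {t : Fin (q + 1) → ℝ} {w : Fin q → ℝ} (ht : t ∈ posOrthant (q + 1))
    (hw : w ∈ posOrthant q) :
    jointDensity X Y α ξ lam₁ lam₂ x t w = gaussConst n q * scaleFactor lam₁ lam₂ t w *
      ((x.2 : ℝ) ^ (-((n + (q + 1 : ℕ) + 2 * α) / 2) - 1) *
        exp (-((penalizedRSS X Y t w x.1 + 2 * ξ) / 2) / x.2)) := by
  obtain ⟨b, s, hs⟩ := x
  have hs : 0 < s := hs
  have hP := posDef_priorPrecision ht hw
  have hdet := hP.det_pos
  have hsq : √(priorPrecision t w).det ≠ 0 := (sqrt_pos.2 hdet).ne'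
  have h1 : normalPdf (X *ᵥ b) (s • (1 : Matrix (Fin n) (Fin n) ℝ)) Y
      = (√((2 * π) ^ n))⁻¹ * s ^ (-((n : ℝ) / 2)) *
        exp (-((Y - X *ᵥ b) ⬝ᵥ (Y - X *ᵥ b)) / (2 * s)) := by
    have h := normalPdf_smul_inv (A := (1 : Matrix (Fin n) (Fin n) ℝ)) .one hs (X *ᵥ b) Y
    rw [inv_one, det_one, sqrt_one, mul_one, one_mulVec, sqrt_pow_eq_rpow hs, ← rpow_neg hs.le] at h
    exact h
  have h2 : normalPdf 0 (s • priorCov t w) b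
      = (√((2 * π) ^ (q + 1)))⁻¹ * s ^ (-(((q + 1 : ℕ) : ℝ) / 2)) * √(priorPrecision t w).det *
        exp (-(b ⬝ᵥ (priorPrecision t w *ᵥ b)) / (2 * s)) := by
    have h := normalPdf_smul_inv hP hs 0 b
    rw [sub_zero, sqrt_pow_eq_rpow hs, ← rpow_neg hs.le] at h
    exact h
  have h3 : √(priorCov t w).det = (√(priorPrecision t w).det)⁻¹ := by
    rw [priorCov, det_nonsing_inv, Ring.inverse_eq_inv', sqrt_inv]
  have hexp : exp (-((penalizedRSS X Y t w b + 2 * ξ) / 2) / s)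
      = exp (-((Y - X *ᵥ b) ⬝ᵥ (Y - X *ᵥ b)) / (2 * s)) *
        exp (-(b ⬝ᵥ (priorPrecision t w *ᵥ b)) / (2 * s)) * exp (-ξ / s) := by
    rw [← exp_add, ← exp_add]
    congr 1
    unfold penalizedRSS
    field_simp
    ring
  have hpow : s ^ (-((n + (q + 1 : ℕ) + 2 * α) / 2) - 1)
      = s ^ (-((n : ℝ) / 2)) * s ^ (-(((q + 1 : ℕ) : ℝ) / 2)) * s ^ (-α - 1) := by
    rw [← rpow_add hs, ← rpow_add hs]
    congr 1
    ring
  unfold jointDensity scalePrior variancePrior gaussConst scaleFactor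
  simp only
  rw [h1, h2, h3, hexp, hpow]
  field_simp

section Positivity

variable {X : Matrix (Fin n) (Fin (q + 1)) ℝ} {Y : Fin n → ℝ} {ξ : ℝ}

/-- The assumption `ξ > 0` or `Y ≠ 0` is what keeps the inverse-gamma scale parameters positive,
even at `β = 0`. -/
lemma penalizedRSS_add_pos (hξ : 0 ≤ ξ) (hY : 0 < ξ ∨ Y ≠ 0) {t : Fin (q + 1) → ℝ}
    {w : Fin q → ℝ} (ht : t ∈ posOrthant (q + 1)) (hw : w ∈ posOrthant q) (b : Fin (q + 1) → ℝ) :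
    0 < (penalizedRSS X Y t w b + 2 * ξ) / 2 := by
  rcases hY with h | h
  · have := penalizedRSS_nonneg X Y ht hw b
    linarith
  · have := penalizedRSS_pos X h ht hw b
    linarith

lemma minRSS_add_pos (hξ : 0 ≤ ξ) (hY : 0 < ξ ∨ Y ≠ 0) {t : Fin (q + 1) → ℝ}
    {w : Fin q → ℝ} (ht : t ∈ posOrthant (q + 1)) (hw : w ∈ posOrthant q) :
    0 < minRSS X Y t w / 2 + ξ := by
  have := penalizedRSS_add_pos (X := X) hξ hY ht hw ((postPrecision X t w)⁻¹ *ᵥ (Xᵀ *ᵥ Y))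
  rw [minRSS_eq_penalizedRSS X Y ht hw]
  linarith

end Positivity

variable (X : Matrix (Fin n) (Fin (q + 1)) ℝ) (Y : Fin n → ℝ) (α ξ lam₁ lam₂ : ℝ)

/-- The joint density with `σ²` integrated out. -/
def coefScaleDensity (b : Fin (q + 1) → ℝ) (t : Fin (q + 1) → ℝ) (w : Fin q → ℝ) : ℝ :=
  gaussConst n q * scaleFactor lam₁ lam₂ t w * (Gamma ((n + (q + 1 : ℕ) + 2 * α) / 2) /
    ((penalizedRSS X Y t w b + 2 * ξ) / 2) ^ ((n + (q + 1 : ℕ) + 2 * α) / 2 : ℝ))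

/-- The joint density with `(β, σ²)` integrated out. -/
def scaleMarginal (t : Fin (q + 1) → ℝ) (w : Fin q → ℝ) : ℝ :=
  (√((2 * π) ^ n))⁻¹ * scaleFactor lam₁ lam₂ t w * (√(postPrecision X t w).det)⁻¹ *
    (Gamma (n / 2 + α) / (minRSS X Y t w / 2 + ξ) ^ (n / 2 + α : ℝ))

/-- The joint density with `β` integrated out. -/
def varianceScaleDensity (s : ℝ) (t : Fin (q + 1) → ℝ) (w : Fin q → ℝ) : ℝ :=
  varianceCond₂ X Y α ξ t w s * scaleMarginal X Y α ξ lam₁ lam₂ t w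

/-- The joint density with the scales integrated out. -/
def stateMarginal (x : State q) : ℝ :=
  gaussConst n q * (lam₁ / √(2 * π))⁻¹ ^ (q + 1) * (lam₂ / √(2 * π))⁻¹ ^ q *
    ((x.2 : ℝ) ^ (-((n + (q + 1 : ℕ) + 2 * α) / 2) - 1) *
      exp (-(((Y - X *ᵥ x.1) ⬝ᵥ (Y - X *ᵥ x.1) + 2 * ξ) / 2) / x.2)) *
    exp (-((lam₁ * ∑ i, |x.1 i| + lam₂ * ∑ j : Fin q, |x.1 j.succ - x.1 j.castSucc|) / √x.2))

variable {X Y α ξ lam₁ lam₂}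

lemma varianceCond₃_eq (b : Fin (q + 1) → ℝ) (t : Fin (q + 1) → ℝ) (w : Fin q → ℝ) (s : ℝ) :
    varianceCond₃ X Y α ξ b t w s = invGammaPdf ((n + (q + 1 : ℕ) + 2 * α) / 2)
      ((penalizedRSS X Y t w b + 2 * ξ) / 2) s := rfl

lemma varianceCond₂_eq (t : Fin (q + 1) → ℝ) (w : Fin q → ℝ) (s : ℝ) :
    varianceCond₂ X Y α ξ t w s = invGammaPdf (n / 2 + α) (minRSS X Y t w / 2 + ξ) s := rfl

section

variable (hα : 0 ≤ α) (hξ : 0 ≤ ξ) (hY : 0 < ξ ∨ Y ≠ 0)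

lemma shape₃_pos (n q : ℕ) (hα : 0 ≤ α) : (0 : ℝ) < (n + (q + 1 : ℕ) + 2 * α) / 2 := by positivity

lemma shape₂_pos (hn : 0 < n) (hα : 0 ≤ α) : (0 : ℝ) < n / 2 + α := by
  have : (0 : ℝ) < n := by exact_mod_cast hn
  positivity

include hα hξ hY in
lemma scaleMarginal_pos (hn : 0 < n) {t : Fin (q + 1) → ℝ} {w : Fin q → ℝ}
    (ht : t ∈ posOrthant (q + 1)) (hw : w ∈ posOrthant q) :
    0 < scaleMarginal X Y α ξ lam₁ lam₂ t w := by
  have h1 := Gamma_pos_of_pos (shape₂_pos hn hα)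
  have h2 := minRSS_add_pos (X := X) hξ hY ht hw
  have h3 := scaleFactor_pos lam₁ lam₂ ht hw
  have h4 := (posDef_postPrecision X ht hw).det_pos
  unfold scaleMarginal
  positivity

include hα hξ hY in
lemma jointDensity_eq_varianceCond₃_mul (x : State q) {t : Fin (q + 1) → ℝ} {w : Fin q → ℝ}
    (ht : t ∈ posOrthant (q + 1)) (hw : w ∈ posOrthant q) :
    jointDensity X Y α ξ lam₁ lam₂ x t w
      = varianceCond₃ X Y α ξ x.1 t w x.2 * coefScaleDensity X Y α ξ lam₁ lam₂ x.1 t w := by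
  have h1 := Gamma_pos_of_pos (shape₃_pos n q hα)
  have h2 := rpow_pos_of_pos (penalizedRSS_add_pos (X := X) hξ hY ht hw x.1)
    ((n + (q + 1 : ℕ) + 2 * α) / 2)
  rw [jointDensity_eq X Y α ξ lam₁ lam₂ x ht hw, varianceCond₃_eq]
  unfold invGammaPdf coefScaleDensity
  field_simp

include hα hξ hY in
-- Completing the square splits the exponent into the normal law of `β` and `minRSS`. The
-- normalization of that law takes up `p/2` powers of the variance, so the shape drops to `n/2 + α`.
lemma jointDensity_eq_betaCond_mul (hn : 0 < n) (x : State q) {t : Fin (q + 1) → ℝ} {w : Fin q → ℝ}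
    (ht : t ∈ posOrthant (q + 1)) (hw : w ∈ posOrthant q) :
    jointDensity X Y α ξ lam₁ lam₂ x t w
      = betaCond X Y x.2 t w x.1 * varianceScaleDensity X Y α ξ lam₁ lam₂ x.2 t w := by
  obtain ⟨b, s, hs⟩ := x
  have hs : 0 < s := hs
  have hA := posDef_postPrecision X ht hw
  have h1 := Gamma_pos_of_pos (shape₂_pos hn hα)
  have h2 := rpow_pos_of_pos (minRSS_add_pos (X := X) hξ hY ht hw) (n / 2 + α)
  have h3 : √(postPrecision X t w).det ≠ 0 := (sqrt_pos.2 hA.det_pos).ne'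
  rw [jointDensity_eq X Y α ξ lam₁ lam₂ _ ht hw]
  unfold betaCond varianceScaleDensity
  simp only
  rw [normalPdf_smul_inv hA hs, penalizedRSS_eq X Y ht hw, varianceCond₂_eq]
  unfold invGammaPdf scaleMarginal gaussConst
  have hexp : exp (-((penalizedRSS X Y t w b + 2 * ξ) / 2) / s)
      = exp (-(penalizedRSS X Y t w b - minRSS X Y t w) / (2 * s)) *
        exp (-(minRSS X Y t w / 2 + ξ) / s) := by
    rw [← exp_add]
    congr 1
    field_simp
    ring
  have hpow : s ^ (-((n + (q + 1 : ℕ) + 2 * α) / 2) - 1)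
      = (√(s ^ (q + 1)))⁻¹ * s ^ (-(n / 2 + α) - 1) := by
    rw [sqrt_pow_eq_rpow hs, ← rpow_neg hs.le, ← rpow_add hs]
    congr 1
    ring
  rw [hexp, hpow]
  generalize (minRSS X Y t w / 2 + ξ) ^ (n / 2 + α : ℝ) = r at h2 ⊢
  field_simp

end

/-- Expanding the square in the exponent leaves a cross term `lam |b| / √s` free of `t`: this is the
Laplace law as a scale mixture of normal laws. -/
lemma recipInvGaussianPdf_sqrt {lam s : ℝ} (hlam : 0 < lam) (hs : 0 < s) (b : ℝ) {t : ℝ}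
    (ht : 0 < t) :
    recipInvGaussianPdf √(b ^ 2 / (lam ^ 2 * s)) (lam ^ 2) t
      = lam / √(2 * π) * (t ^ (-(1 / 2) : ℝ) * exp (-(lam ^ 2 * t) / 2)) *
        exp (-(b ^ 2 / t) / (2 * s)) * exp (lam * |b| / √s) := by
  have hsq : √s ^ 2 = s := sq_sqrt hs.le
  have hss : 0 < √s := sqrt_pos.2 hs
  have h1 : √(b ^ 2 / (lam ^ 2 * s)) = |b| / (lam * √s) := by
    rw [sqrt_div (sq_nonneg b), sqrt_sq_eq_abs, sqrt_mul (sq_nonneg lam), sqrt_sq hlam.le]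
  have h2 : √(lam ^ 2 / (2 * π)) = lam / √(2 * π) := by
    rw [sqrt_div (sq_nonneg lam), sqrt_sq hlam.le]
  have h3 : exp (-(lam ^ 2 * (|b| / (lam * √s) - t) ^ 2) / (2 * t))
      = exp (-(lam ^ 2 * t) / 2) * exp (-(b ^ 2 / t) / (2 * s)) * exp (lam * |b| / √s) := by
    rw [← exp_add, ← exp_add]
    congr 1
    rw [← sq_abs b]
    conv_rhs => rw [← hsq, sqrt_sq hss.le]
    field_simp
    ring
  rw [recipInvGaussianPdf_eq ht, h1, h2, h3]
  ring

/-- Applied to every coefficient and every increment, the mixture identity collects the cross terms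
into the fused lasso penalty of `stateMarginal`. -/
lemma jointDensity_eq_stateMarginal_mul (hlam₁ : 0 < lam₁) (hlam₂ : 0 < lam₂) (x : State q)
    {t : Fin (q + 1) → ℝ} {w : Fin q → ℝ} (ht : t ∈ posOrthant (q + 1)) (hw : w ∈ posOrthant q) :
    jointDensity X Y α ξ lam₁ lam₂ x t w
      = stateMarginal X Y α ξ lam₁ lam₂ x * scaleCond lam₁ lam₂ x t w := by
  obtain ⟨b, s, hs⟩ := x
  have hs : 0 < s := hs
  rw [jointDensity_eq X Y α ξ lam₁ lam₂ _ ht hw]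
  unfold scaleCond stateMarginal
  simp only
  rw [Finset.prod_congr rfl fun i _ => recipInvGaussianPdf_sqrt hlam₁ hs (b i) (ht i),
    Finset.prod_congr rfl fun (j : Fin q) _ =>
      recipInvGaussianPdf_sqrt hlam₂ hs (b j.succ - b j.castSucc) (hw j)]
  simp only [Finset.prod_mul_distrib, ← exp_sum, Finset.prod_const, Finset.card_univ,
    Fintype.card_fin]
  have hexp : exp (-((penalizedRSS X Y t w b + 2 * ξ) / 2) / s)
      = exp (-(((Y - X *ᵥ b) ⬝ᵥ (Y - X *ᵥ b) + 2 * ξ) / 2) / s) *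
        (exp (-((lam₁ * ∑ i, |b i| + lam₂ * ∑ j : Fin q, |b j.succ - b j.castSucc|) / √s)) *
        exp (∑ i, -(b i ^ 2 / t i) / (2 * s)) * exp (∑ i, lam₁ * |b i| / √s) *
        exp (∑ j : Fin q, -((b j.succ - b j.castSucc) ^ 2 / w j) / (2 * s)) *
        exp (∑ j : Fin q, lam₂ * |b j.succ - b j.castSucc| / √s)) := by
    simp only [← exp_add]
    congr 1
    unfold penalizedRSS
    rw [priorPrecision_quadForm]
    simp only [← Finset.sum_div, ← Finset.mul_sum, Finset.sum_neg_distrib]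
    have : √s ≠ 0 := (sqrt_pos.2 hs).ne'
    field_simp
    ring
  have h₁ : lam₁ / √(2 * π) ≠ 0 := by positivity
  have h₂ : lam₂ / √(2 * π) ≠ 0 := by positivity
  rw [hexp]
  unfold scaleFactor
  generalize lam₁ / √(2 * π) = c₁ at h₁ ⊢
  generalize lam₂ / √(2 * π) = c₂ at h₂ ⊢
  simp only [inv_pow]
  simp only [Finset.prod_mul_distrib, ← exp_sum]
  field_simp

lemma stateMarginal_pos (hlam₁ : 0 < lam₁) (hlam₂ : 0 < lam₂) (x : State q) :
    0 < stateMarginal X Y α ξ lam₁ lam₂ x := by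
  have hs : (0 : ℝ) < x.2 := x.2.2
  have := gaussConst_pos n q
  unfold stateMarginal
  positivity

end FusedLasso

/-! ### Measurability -/

section Measurability

open Matrix

variable {Ω : Type*} [MeasurableSpace Ω]

lemma measurable_dotProduct {k : ℕ} {v v' : Ω → Fin k → ℝ} (hv : Measurable v)
    (hv' : Measurable v') : Measurable fun a => v a ⬝ᵥ v' a := by
  unfold dotProduct
  fun_prop

lemma measurable_mulVec {k l : ℕ} {M : Ω → Matrix (Fin k) (Fin l) ℝ}
    (hM : ∀ i j, Measurable fun a => M a i j) {v : Ω → Fin l → ℝ} (hv : Measurable v) :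
    Measurable fun a => M a *ᵥ v a := by
  refine measurable_pi_iff.2 fun i => ?_
  simp only [mulVec, dotProduct]
  exact Finset.measurable_sum _ fun j _ => (hM i j).mul ((measurable_pi_apply j).comp hv)

lemma measurable_matrix_mul_apply {k l m : ℕ} {M : Ω → Matrix (Fin k) (Fin l) ℝ}
    {N : Ω → Matrix (Fin l) (Fin m) ℝ} (hM : ∀ i j, Measurable fun a => M a i j)
    (hN : ∀ i j, Measurable fun a => N a i j) (i j) : Measurable fun a => (M a * N a) i j := by
  simp only [mul_apply]
  exact Finset.measurable_sum _ fun r _ => (hM i r).mul (hN r j)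

lemma measurable_det {k : ℕ} {M : Ω → Matrix (Fin k) (Fin k) ℝ}
    (hM : ∀ i j, Measurable fun a => M a i j) : Measurable fun a => (M a).det := by
  simp only [det_apply]
  exact Finset.measurable_sum _ fun σ _ =>
    (Finset.measurable_prod _ fun i _ => hM _ _).const_smul _

/-- The adjugate formula makes each entry a quotient of measurable determinants. It also covers
singular matrices, whose inverse is zero by convention, so no invertibility is assumed. -/
lemma measurable_matrix_inv_apply {k : ℕ} {M : Ω → Matrix (Fin k) (Fin k) ℝ}
    (hM : ∀ i j, Measurable fun a => M a i j) (i j) : Measurable fun a => (M a)⁻¹ i j := by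
  simp only [inv_def, Matrix.smul_apply, Ring.inverse_eq_inv', smul_eq_mul, adjugate_apply]
  refine (measurable_det hM).inv.mul (measurable_det fun r l => ?_)
  simp only [updateRow_apply]
  split_ifs
  · exact measurable_const
  · exact hM _ _

end Measurability

namespace FusedLasso

open Set Real Matrix

variable {Ω : Type*} [MeasurableSpace Ω] {n q : ℕ}

lemma measurable_normalPdf {k : ℕ} {m x : Ω → Fin k → ℝ} {S : Ω → Matrix (Fin k) (Fin k) ℝ}
    (hm : Measurable m) (hS : ∀ i j, Measurable fun a => S a i j) (hx : Measurable x) :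
    Measurable fun a => normalPdf (m a) (S a) (x a) := by
  unfold normalPdf
  have h1 := measurable_det hS
  have h2 := measurable_dotProduct (hx.sub hm)
    (measurable_mulVec (measurable_matrix_inv_apply hS) (hx.sub hm))
  exact ((h1.const_mul _).sqrt.inv).mul (h2.neg.div_const 2).exp

lemma measurable_invGammaPdf (a : ℝ) {b s : Ω → ℝ} (hb : Measurable b) (hs : Measurable s) :
    Measurable fun z => invGammaPdf a (b z) (s z) := by
  unfold invGammaPdf
  fun_prop

section

variable {x : Ω → State q} {s : Ω → ℝ} {b t : Ω → Fin (q + 1) → ℝ} {w : Ω → Fin q → ℝ}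
  (X : Matrix (Fin n) (Fin (q + 1)) ℝ) (Y : Fin n → ℝ) (α ξ : ℝ)

lemma measurable_priorPrecision_apply (ht : Measurable t) (hw : Measurable w) (i j) :
    Measurable fun a => priorPrecision (t a) (w a) i j := by
  simp only [priorPrecision, Matrix.add_apply, Matrix.sum_apply, Matrix.smul_apply, diagonal_apply, smul_eq_mul]
  refine Measurable.add ?_ (Finset.measurable_sum _ fun r _ => Measurable.mul_const (by fun_prop) _)
  split_ifs
  · fun_prop
  · exact measurable_const

lemma measurable_postPrecision_apply (ht : Measurable t) (hw : Measurable w) (i j) :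
    Measurable fun a => postPrecision X (t a) (w a) i j := by
  simp only [postPrecision, Matrix.add_apply]
  exact (measurable_priorPrecision_apply ht hw i j).const_add _

lemma measurable_betaCond (hs : Measurable s) (ht : Measurable t) (hw : Measurable w)
    (hb : Measurable b) : Measurable fun a => betaCond X Y (s a) (t a) (w a) (b a) := by
  have h := measurable_matrix_inv_apply (measurable_postPrecision_apply X ht hw)
  refine measurable_normalPdf (measurable_mulVec h measurable_const) (fun i j => ?_) hb
  simp only [Matrix.smul_apply, smul_eq_mul]
  exact hs.mul (h i j)

lemma measurable_varianceCond₂ (hs : Measurable s) (ht : Measurable t) (hw : Measurable w) :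
    Measurable fun a => varianceCond₂ X Y α ξ (t a) (w a) (s a) := by
  refine measurable_invGammaPdf _ (((measurable_dotProduct measurable_const
    (measurable_mulVec (fun i j => ?_) measurable_const)).div_const 2).add_const ξ) hs
  simp only [Matrix.sub_apply]
  refine Measurable.const_sub (measurable_matrix_mul_apply (N := fun _ => Xᵀ)
    (measurable_matrix_mul_apply (M := fun _ => X) (fun _ _ => measurable_const)
      (measurable_matrix_inv_apply (measurable_postPrecision_apply X ht hw)))
    (fun _ _ => measurable_const) i j) _

lemma measurable_penalizedRSS (hb : Measurable b) (ht : Measurable t) (hw : Measurable w) :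
    Measurable fun a => penalizedRSS X Y (t a) (w a) (b a) := by
  have h : Measurable fun a => Y - X *ᵥ b a :=
    (measurable_mulVec (M := fun _ => X) (fun _ _ => measurable_const) hb).const_sub Y
  exact (measurable_dotProduct h h).add (measurable_dotProduct hb
    (measurable_mulVec (measurable_priorPrecision_apply ht hw) hb))

lemma measurable_varianceCond₃ (hb : Measurable b) (hs : Measurable s) (ht : Measurable t)
    (hw : Measurable w) : Measurable fun a => varianceCond₃ X Y α ξ (b a) (t a) (w a) (s a) := by
  simp only [varianceCond₃_eq]
  exact measurable_invGammaPdf _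
    (((measurable_penalizedRSS X Y hb ht hw).add_const _).div_const 2) hs

lemma measurable_scaleCond (lam₁ lam₂ : ℝ) (hx : Measurable x) (ht : Measurable t)
    (hw : Measurable w) : Measurable fun a => scaleCond lam₁ lam₂ (x a) (t a) (w a) := by
  have hs : Measurable fun a => ((x a).2 : ℝ) := measurable_subtype_coe.comp hx.snd
  have hb : Measurable fun a => (x a).1 := hx.fst
  have hbi : ∀ i, Measurable fun a => (x a).1 i := fun i => (measurable_pi_apply i).comp hb
  refine (Finset.measurable_prod _ fun i _ => ?_).mul (Finset.measurable_prod _ fun j _ => ?_)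
  · exact measurable_recipInvGaussianPdf.comp ((((hbi i).pow_const 2).div
      (hs.const_mul _)).sqrt.prodMk (measurable_const.prodMk ((measurable_pi_apply i).comp ht)))
  · exact measurable_recipInvGaussianPdf.comp (((((hbi j.succ).sub (hbi j.castSucc)).pow_const 2).div
      (hs.const_mul _)).sqrt.prodMk (measurable_const.prodMk ((measurable_pi_apply j).comp hw)))

lemma measurable_stateMarginal (lam₁ lam₂ : ℝ) :
    Measurable (stateMarginal X Y α ξ lam₁ lam₂) := by
  have hs : Measurable fun x : State q => (x.2 : ℝ) := measurable_subtype_coe.comp measurable_snd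
  have hbi : ∀ i, Measurable fun x : State q => x.1 i :=
    fun i => (measurable_pi_apply i).comp measurable_fst
  have h : Measurable fun x : State q => Y - X *ᵥ x.1 :=
    (measurable_mulVec (M := fun _ => X) (fun _ _ => measurable_const) measurable_fst).const_sub Y
  have hd := measurable_dotProduct h h
  unfold stateMarginal
  fun_prop

end

/-! ### The space of scales and the state space -/

/-- Lebesgue measure on the positive scales `(τ², ω²)`. -/
def scaleMeasure (q : ℕ) : Measure ((Fin (q + 1) → ℝ) × (Fin q → ℝ)) :=
  (volume.restrict (posOrthant (q + 1))).prod (volume.restrict (posOrthant q))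

instance (q : ℕ) : SFinite (scaleMeasure q) := by
  unfold scaleMeasure
  infer_instance

lemma posOrthant_eq_pi (k : ℕ) : posOrthant k = Set.pi univ fun _ => Ioi (0 : ℝ) := by
  ext v
  simp [posOrthant]

lemma measurableSet_posOrthant (k : ℕ) : MeasurableSet (posOrthant k) := by
  rw [posOrthant_eq_pi]
  exact MeasurableSet.univ_pi fun _ => measurableSet_Ioi

lemma volume_restrict_posOrthant (k : ℕ) : (volume : Measure (Fin k → ℝ)).restrict (posOrthant k)
    = Measure.pi fun _ => volume.restrict (Ioi (0 : ℝ)) := by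
  rw [posOrthant_eq_pi, volume_pi, Measure.restrict_pi_pi]

lemma ae_scaleMeasure (q : ℕ) :
    ∀ᵐ u ∂(scaleMeasure q), u.1 ∈ posOrthant (q + 1) ∧ u.2 ∈ posOrthant q := by
  unfold scaleMeasure
  rw [Measure.prod_restrict]
  exact ae_restrict_mem ((measurableSet_posOrthant _).prod (measurableSet_posOrthant _))

lemma lintegral_scaleMeasure {F : (Fin (q + 1) → ℝ) × (Fin q → ℝ) → ℝ≥0∞} (hF : Measurable F) :
    ∫⁻ u, F u ∂(scaleMeasure q)
      = ∫⁻ t in posOrthant (q + 1), ∫⁻ w in posOrthant q, F (t, w) :=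
  lintegral_prod _ hF.aemeasurable

lemma lintegral_scaleMeasure_prod {f : Fin (q + 1) → ℝ → ℝ≥0∞} {g : Fin q → ℝ → ℝ≥0∞}
    (hf : ∀ i, Measurable (f i)) (hg : ∀ i, Measurable (g i)) :
    ∫⁻ u, (∏ i, f i (u.1 i)) * ∏ j, g j (u.2 j) ∂(scaleMeasure q)
      = (∏ i, ∫⁻ t in Ioi (0 : ℝ), f i t) * ∏ j, ∫⁻ t in Ioi (0 : ℝ), g j t := by
  have h1 : Measurable fun t : Fin (q + 1) → ℝ => ∏ i, f i (t i) :=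
    Finset.measurable_prod _ fun i _ => (hf i).comp (measurable_pi_apply i)
  have h2 : Measurable fun w : Fin q → ℝ => ∏ j, g j (w j) :=
    Finset.measurable_prod _ fun i _ => (hg i).comp (measurable_pi_apply i)
  unfold scaleMeasure
  rw [lintegral_prod_mul h1.aemeasurable h2.aemeasurable, volume_restrict_posOrthant,
    volume_restrict_posOrthant, lintegral_fin_prod _ hf, lintegral_fin_prod _ hg]

instance sFinite_comap_volume_Ioi :
    SFinite ((volume : Measure ℝ).comap (Subtype.val : Ioi (0 : ℝ) → ℝ)) := by
  have : LocallyCompactSpace (Ioi (0 : ℝ)) :=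
    isOpen_Ioi.isOpenEmbedding_subtypeVal.locallyCompactSpace
  have : IsFiniteMeasureOnCompacts
      ((volume : Measure ℝ).comap (Subtype.val : Ioi (0 : ℝ) → ℝ)) :=
    .comap' _ continuous_subtype_val (MeasurableEmbedding.subtype_coe measurableSet_Ioi)
  infer_instance

lemma lintegral_lebesgue {G : (Fin (q + 1) → ℝ) × ℝ → ℝ≥0∞} (hG : Measurable G) :
    ∫⁻ x, G (x.1, (x.2 : ℝ)) ∂(lebesgue q) = ∫⁻ b, ∫⁻ s in Ioi (0 : ℝ), G (b, s) := by
  have hm : Measurable fun x : State q => G (x.1, (x.2 : ℝ)) :=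
    hG.comp (measurable_fst.prodMk (measurable_subtype_coe.comp measurable_snd))
  unfold lebesgue
  rw [lintegral_prod _ hm.aemeasurable]
  refine lintegral_congr fun b => ?_
  exact lintegral_subtype_comap measurableSet_Ioi fun s => G (b, s)

lemma lintegral_lebesgue_symm {G : (Fin (q + 1) → ℝ) × ℝ → ℝ≥0∞} (hG : Measurable G) :
    ∫⁻ x, G (x.1, (x.2 : ℝ)) ∂(lebesgue q) = ∫⁻ s in Ioi (0 : ℝ), ∫⁻ b, G (b, s) := by
  rw [lintegral_lebesgue hG]
  exact lintegral_lintegral_swap (by exact hG.aemeasurable)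

/-! ### Normalization of the conditional densities -/

section

variable {X : Matrix (Fin n) (Fin (q + 1)) ℝ} {Y : Fin n → ℝ} {α ξ lam₁ lam₂ : ℝ}

lemma scaleCond_nonneg (x : State q) (t : Fin (q + 1) → ℝ) (w : Fin q → ℝ) :
    0 ≤ scaleCond lam₁ lam₂ x t w :=
  mul_nonneg (Finset.prod_nonneg fun _ _ => recipInvGaussianPdf_nonneg)
    (Finset.prod_nonneg fun _ _ => recipInvGaussianPdf_nonneg)

lemma betaCond_nonneg (s : ℝ) (t : Fin (q + 1) → ℝ) (w : Fin q → ℝ) (b : Fin (q + 1) → ℝ) :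
    0 ≤ betaCond X Y s t w b := by
  unfold betaCond normalPdf
  positivity

lemma lintegral_scaleCond (hlam₁ : 0 < lam₁) (hlam₂ : 0 < lam₂) (x : State q) :
    ∫⁻ u, ENNReal.ofReal (scaleCond lam₁ lam₂ x u.1 u.2) ∂(scaleMeasure q) = 1 := by
  simp only [scaleCond]
  simp only [ENNReal.ofReal_mul (Finset.prod_nonneg fun _ _ => recipInvGaussianPdf_nonneg),
    ENNReal.ofReal_prod_of_nonneg fun _ _ => recipInvGaussianPdf_nonneg]
  have hm : ∀ ν l, Measurable fun t => ENNReal.ofReal (recipInvGaussianPdf ν l t) := fun ν l =>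
    (measurable_recipInvGaussianPdf.comp
      (by fun_prop : Measurable fun t : ℝ => (ν, l, t))).ennreal_ofReal
  rw [lintegral_scaleMeasure_prod
    (f := fun i t => ENNReal.ofReal (recipInvGaussianPdf √(x.1 i ^ 2 / (lam₁ ^ 2 * (x.2 : ℝ)))
      (lam₁ ^ 2) t))
    (g := fun j t => ENNReal.ofReal (recipInvGaussianPdf
      √((x.1 (Fin.succ j) - x.1 (Fin.castSucc j)) ^ 2 / (lam₂ ^ 2 * (x.2 : ℝ))) (lam₂ ^ 2) t))
    (fun i => hm _ _) (fun i => hm _ _)]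
  rw [Finset.prod_congr rfl fun i _ => lintegral_recipInvGaussianPdf (sqrt_nonneg _)
    (by positivity : 0 < lam₁ ^ 2),
    Finset.prod_congr rfl fun i _ => lintegral_recipInvGaussianPdf (sqrt_nonneg _)
    (by positivity : 0 < lam₂ ^ 2)]
  simp

lemma lintegral_betaCond {s : ℝ} (hs : 0 < s) {t : Fin (q + 1) → ℝ} {w : Fin q → ℝ}
    (ht : t ∈ posOrthant (q + 1)) (hw : w ∈ posOrthant q) :
    ∫⁻ b, ENNReal.ofReal (betaCond X Y s t w b) = 1 :=
  lintegral_normalPdf_smul_inv (posDef_postPrecision X ht hw) hs _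

variable (hα : 0 ≤ α) (hξ : 0 ≤ ξ) (hY : 0 < ξ ∨ Y ≠ 0)

include hα hξ hY

lemma lintegral_varianceCond₂ (hn : 0 < n) {t : Fin (q + 1) → ℝ} {w : Fin q → ℝ}
    (ht : t ∈ posOrthant (q + 1)) (hw : w ∈ posOrthant q) :
    ∫⁻ s in Ioi (0 : ℝ), ENNReal.ofReal (varianceCond₂ X Y α ξ t w s) = 1 :=
  lintegral_invGammaPdf (shape₂_pos hn hα) (minRSS_add_pos hξ hY ht hw)

lemma varianceCond₂_pos (hn : 0 < n) {t : Fin (q + 1) → ℝ} {w : Fin q → ℝ}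
    (ht : t ∈ posOrthant (q + 1)) (hw : w ∈ posOrthant q) {s : ℝ} (hs : 0 < s) :
    0 < varianceCond₂ X Y α ξ t w s :=
  invGammaPdf_pos (shape₂_pos hn hα) (minRSS_add_pos hξ hY ht hw) hs

lemma lintegral_varianceCond₃ (b : Fin (q + 1) → ℝ) {t : Fin (q + 1) → ℝ} {w : Fin q → ℝ}
    (ht : t ∈ posOrthant (q + 1)) (hw : w ∈ posOrthant q) :
    ∫⁻ s in Ioi (0 : ℝ), ENNReal.ofReal (varianceCond₃ X Y α ξ b t w s) = 1 :=
  lintegral_invGammaPdf (shape₃_pos n q hα) (penalizedRSS_add_pos hξ hY ht hw b)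

lemma varianceCond₃_pos (b : Fin (q + 1) → ℝ) {t : Fin (q + 1) → ℝ} {w : Fin q → ℝ}
    (ht : t ∈ posOrthant (q + 1)) (hw : w ∈ posOrthant q) {s : ℝ} (hs : 0 < s) :
    0 < varianceCond₃ X Y α ξ b t w s :=
  invGammaPdf_pos (shape₃_pos n q hα) (penalizedRSS_add_pos hξ hY ht hw b) hs

end

end FusedLasso

/-! ### Stationarity of the two chains -/

/-- A chain whose transition density preserves the weight `g` has the normalization of `g` as its
stationary distribution. -/
lemma isStationaryChain_withDensity {S : Type*} [MeasurableSpace S] {μ : Measure S} [SFinite μ]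
    {g : S → ℝ≥0∞} (hg : Measurable g) (h0 : ∫⁻ x, g x ∂μ ≠ 0) (htop : ∫⁻ x, g x ∂μ ≠ ∞)
    {k : S → S → ℝ≥0∞} (hk : Measurable (Function.uncurry k)) (hk1 : ∀ x, ∫⁻ y, k x y ∂μ = 1)
    (hinv : ∀ y, ∫⁻ x, g x * k x y ∂μ = g y) :
    IsStationaryChain (Kernel.withDensity (Kernel.const S μ) k)
      ((μ.withDensity g Set.univ)⁻¹ • μ.withDensity g) := by
  have hZ : μ.withDensity g Set.univ = ∫⁻ x, g x ∂μ := by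
    rw [withDensity_apply _ .univ, setLIntegral_univ]
  refine ⟨⟨fun x => ⟨?_⟩⟩, ⟨?_⟩, ?_⟩
  · rw [Kernel.withDensity_apply _ hk, Kernel.const_apply, withDensity_apply _ .univ,
      setLIntegral_univ, hk1]
  · rw [Measure.smul_apply, smul_eq_mul, hZ, ENNReal.inv_mul_cancel h0 htop]
  · rw [Kernel.Invariant]
    ext A hA
    have hkA : Measurable fun x => ∫⁻ y in A, k x y ∂μ :=
      Measurable.lintegral_prod_right' (ν := μ.restrict A) hk
    have h1 : ∀ x, Kernel.withDensity (Kernel.const S μ) k x A = ∫⁻ y in A, k x y ∂μ := fun x => by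
      rw [Kernel.withDensity_apply _ hk, Kernel.const_apply, withDensity_apply _ hA]
    rw [Measure.bind_apply hA (Kernel.aemeasurable _), lintegral_smul_measure]
    simp only [h1]
    rw [lintegral_withDensity_eq_lintegral_mul _ hg hkA, Measure.smul_apply, withDensity_apply _ hA]
    congr 1
    simp only [Pi.mul_apply]
    calc ∫⁻ x, g x * ∫⁻ y in A, k x y ∂μ ∂μ = ∫⁻ x, ∫⁻ y in A, g x * k x y ∂μ ∂μ := by
          refine lintegral_congr fun x => ?_
          rw [lintegral_const_mul (g x) (f := k x) (hk.comp measurable_prodMk_left)]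
      _ = ∫⁻ y in A, ∫⁻ x, g x * k x y ∂μ ∂μ :=
          lintegral_lintegral_swap ((hg.comp measurable_fst).mul hk).aemeasurable
      _ = ∫⁻ y in A, g y ∂μ := by simp only [hinv]

namespace FusedLasso

open Set Real Matrix

variable {n q : ℕ} {X : Matrix (Fin n) (Fin (q + 1)) ℝ} {Y : Fin n → ℝ} {α ξ lam₁ lam₂ : ℝ}

section

variable {Ω : Type*} [MeasurableSpace Ω]

lemma measurable_state_snd {x : Ω → State q} (hx : Measurable x) :
    Measurable fun a => ((x a).2 : ℝ) := measurable_subtype_coe.comp hx.snd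

variable (X Y α ξ lam₁ lam₂)

/-- The transition density of the `(β, σ²)`-step of the two-block chain. -/
def stateCond₂ (u : (Fin (q + 1) → ℝ) × (Fin q → ℝ)) (y : State q) : ℝ≥0∞ :=
  ENNReal.ofReal (betaCond X Y y.2 u.1 u.2 y.1) *
    ENNReal.ofReal (varianceCond₂ X Y α ξ u.1 u.2 y.2)

/-- The transition density of the `(β, σ²)`-step of the three-block chain. -/
def stateCond₃ (b : Fin (q + 1) → ℝ) (u : (Fin (q + 1) → ℝ) × (Fin q → ℝ)) (y : State q) : ℝ≥0∞ :=
  ENNReal.ofReal (betaCond X Y y.2 u.1 u.2 y.1) *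
    ENNReal.ofReal (varianceCond₃ X Y α ξ b u.1 u.2 y.2)

/-- The transition density of the scale step. -/
def scaleCondENN (x : State q) (u : (Fin (q + 1) → ℝ) × (Fin q → ℝ)) : ℝ≥0∞ :=
  ENNReal.ofReal (scaleCond lam₁ lam₂ x u.1 u.2)

variable {u : Ω → (Fin (q + 1) → ℝ) × (Fin q → ℝ)} {x y : Ω → State q} {b : Ω → Fin (q + 1) → ℝ}

lemma measurable_stateCond₂ (hu : Measurable u) (hy : Measurable y) :
    Measurable fun a => stateCond₂ X Y α ξ (u a) (y a) :=
  (measurable_betaCond X Y (measurable_state_snd hy) hu.fst hu.snd hy.fst).ennreal_ofReal.mul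
    (measurable_varianceCond₂ X Y α ξ (measurable_state_snd hy) hu.fst hu.snd).ennreal_ofReal

lemma measurable_stateCond₃ (hb : Measurable b) (hu : Measurable u) (hy : Measurable y) :
    Measurable fun a => stateCond₃ X Y α ξ (b a) (u a) (y a) :=
  (measurable_betaCond X Y (measurable_state_snd hy) hu.fst hu.snd hy.fst).ennreal_ofReal.mul
    (measurable_varianceCond₃ X Y α ξ hb (measurable_state_snd hy) hu.fst hu.snd).ennreal_ofReal

lemma measurable_scaleCondENN (hx : Measurable x) (hu : Measurable u) :
    Measurable fun a => scaleCondENN lam₁ lam₂ (x a) (u a) :=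
  (measurable_scaleCond lam₁ lam₂ hx hu.fst hu.snd).ennreal_ofReal

lemma twoBlockDensity_eq (x y : State q) : twoBlockDensity X Y α ξ lam₁ lam₂ x y
    = ∫⁻ u, stateCond₂ X Y α ξ u y * scaleCondENN lam₁ lam₂ x u ∂(scaleMeasure q) := by
  rw [lintegral_scaleMeasure (F := fun u => stateCond₂ X Y α ξ u y * scaleCondENN lam₁ lam₂ x u)
    ((measurable_stateCond₂ X Y α ξ measurable_id measurable_const).mul
    (measurable_scaleCondENN lam₁ lam₂ measurable_const measurable_id))]
  unfold twoBlockDensity stateCond₂ scaleCondENN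
  simp only [ENNReal.ofReal_mul' (scaleCond_nonneg _ _ _), ENNReal.ofReal_mul (betaCond_nonneg _ _ _ _)]

lemma threeBlockDensity_eq (x y : State q) : threeBlockDensity X Y α ξ lam₁ lam₂ x y
    = ∫⁻ u, stateCond₃ X Y α ξ x.1 u y * scaleCondENN lam₁ lam₂ x u ∂(scaleMeasure q) := by
  rw [lintegral_scaleMeasure
    (F := fun u => stateCond₃ X Y α ξ x.1 u y * scaleCondENN lam₁ lam₂ x u)
    ((measurable_stateCond₃ X Y α ξ measurable_const measurable_id
    measurable_const).mul (measurable_scaleCondENN lam₁ lam₂ measurable_const measurable_id))]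
  unfold threeBlockDensity stateCond₃ scaleCondENN
  simp only [ENNReal.ofReal_mul' (scaleCond_nonneg _ _ _), ENNReal.ofReal_mul (betaCond_nonneg _ _ _ _)]

lemma measurable_twoBlockDensity :
    Measurable (Function.uncurry (twoBlockDensity X Y α ξ lam₁ lam₂)) := by
  simp only [Function.uncurry_def, twoBlockDensity_eq]
  exact ((measurable_stateCond₂ X Y α ξ (Ω := (State q × State q) × _)
    measurable_snd measurable_fst.snd).mul
    (measurable_scaleCondENN lam₁ lam₂ measurable_fst.fst measurable_snd)).lintegral_prod_right'

lemma measurable_threeBlockDensity :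
    Measurable (Function.uncurry (threeBlockDensity X Y α ξ lam₁ lam₂)) := by
  simp only [Function.uncurry_def, threeBlockDensity_eq]
  exact ((measurable_stateCond₃ X Y α ξ (Ω := (State q × State q) × _)
    measurable_fst.fst.fst measurable_snd measurable_fst.snd).mul
    (measurable_scaleCondENN lam₁ lam₂ measurable_fst.fst measurable_snd)).lintegral_prod_right'

end

lemma lintegral_scaleCondENN (hlam₁ : 0 < lam₁) (hlam₂ : 0 < lam₂) (x : State q) :
    ∫⁻ u, scaleCondENN lam₁ lam₂ x u ∂(scaleMeasure q) = 1 :=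
  lintegral_scaleCond hlam₁ hlam₂ x

/-- The scale conditional has mass one, so integrating out the scales leaves the explicit,
everywhere positive density `stateMarginal`. -/
lemma posteriorWeight_eq (hlam₁ : 0 < lam₁) (hlam₂ : 0 < lam₂) :
    posteriorWeight X Y α ξ lam₁ lam₂
      = (lebesgue q).withDensity fun x => ENNReal.ofReal (stateMarginal X Y α ξ lam₁ lam₂ x) := by
  unfold posteriorWeight
  congr 1
  funext x
  have h := lintegral_scaleMeasure (F := scaleCondENN lam₁ lam₂ x)
    (measurable_scaleCondENN lam₁ lam₂ measurable_const measurable_id)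
  calc _ = ∫⁻ t in posOrthant (q + 1), ∫⁻ w in posOrthant q,
        ENNReal.ofReal (stateMarginal X Y α ξ lam₁ lam₂ x) * scaleCondENN lam₁ lam₂ x (t, w) := by
        refine setLIntegral_congr_fun (measurableSet_posOrthant _) fun t ht => ?_
        refine setLIntegral_congr_fun (measurableSet_posOrthant _) fun w hw => ?_
        rw [jointDensity_eq_stateMarginal_mul hlam₁ hlam₂ x ht hw,
          ENNReal.ofReal_mul (stateMarginal_pos hlam₁ hlam₂ x).le]
        rfl
    _ = ENNReal.ofReal (stateMarginal X Y α ξ lam₁ lam₂ x) *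
        ∫⁻ t in posOrthant (q + 1), ∫⁻ w in posOrthant q, scaleCondENN lam₁ lam₂ x (t, w) := by
        simp only [lintegral_const_mul' _ _ ENNReal.ofReal_ne_top]
    _ = _ := by rw [← h, lintegral_scaleCondENN hlam₁ hlam₂, mul_one]

variable (hn : 0 < n) (hα : 0 ≤ α) (hξ : 0 ≤ ξ) (hY : 0 < ξ ∨ Y ≠ 0)

include hα hξ hY

include hn in
lemma lintegral_stateCond₂ {u : (Fin (q + 1) → ℝ) × (Fin q → ℝ)} (ht : u.1 ∈ posOrthant (q + 1))
    (hw : u.2 ∈ posOrthant q) : ∫⁻ y, stateCond₂ X Y α ξ u y ∂(lebesgue q) = 1 := by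
  have hm : Measurable fun y : (Fin (q + 1) → ℝ) × ℝ =>
      ENNReal.ofReal (betaCond X Y y.2 u.1 u.2 y.1) *
        ENNReal.ofReal (varianceCond₂ X Y α ξ u.1 u.2 y.2) :=
    (measurable_betaCond X Y measurable_snd measurable_const measurable_const
      measurable_fst).ennreal_ofReal.mul (measurable_varianceCond₂ X Y α ξ measurable_snd
      measurable_const measurable_const).ennreal_ofReal
  refine (lintegral_lebesgue_symm hm).trans ?_
  rw [← lintegral_varianceCond₂ (X := X) hα hξ hY hn ht hw]
  refine setLIntegral_congr_fun measurableSet_Ioi fun s hs => ?_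
  simp only
  rw [lintegral_mul_const' _ _ ENNReal.ofReal_ne_top, lintegral_betaCond hs ht hw, one_mul]

lemma lintegral_stateCond₃ (b : Fin (q + 1) → ℝ) {u : (Fin (q + 1) → ℝ) × (Fin q → ℝ)}
    (ht : u.1 ∈ posOrthant (q + 1)) (hw : u.2 ∈ posOrthant q) :
    ∫⁻ y, stateCond₃ X Y α ξ b u y ∂(lebesgue q) = 1 := by
  have hm : Measurable fun y : (Fin (q + 1) → ℝ) × ℝ =>
      ENNReal.ofReal (betaCond X Y y.2 u.1 u.2 y.1) *
        ENNReal.ofReal (varianceCond₃ X Y α ξ b u.1 u.2 y.2) :=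
    (measurable_betaCond X Y measurable_snd measurable_const measurable_const
      measurable_fst).ennreal_ofReal.mul (measurable_varianceCond₃ X Y α ξ measurable_const
      measurable_snd measurable_const measurable_const).ennreal_ofReal
  refine (lintegral_lebesgue_symm hm).trans ?_
  rw [← lintegral_varianceCond₃ (X := X) hα hξ hY b ht hw]
  refine setLIntegral_congr_fun measurableSet_Ioi fun s hs => ?_
  simp only
  rw [lintegral_mul_const' _ _ ENNReal.ofReal_ne_top, lintegral_betaCond hs ht hw, one_mul]

variable (hlam₁ : 0 < lam₁) (hlam₂ : 0 < lam₂)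

include hlam₁ hlam₂

include hn in
-- Bayes' formula: two factorizations of the same joint density of state and scales.
lemma stateMarginal_mul_scaleCondENN₂ (x : State q) {u : (Fin (q + 1) → ℝ) × (Fin q → ℝ)}
    (ht : u.1 ∈ posOrthant (q + 1)) (hw : u.2 ∈ posOrthant q) :
    ENNReal.ofReal (stateMarginal X Y α ξ lam₁ lam₂ x) * scaleCondENN lam₁ lam₂ x u
      = stateCond₂ X Y α ξ u x * ENNReal.ofReal (scaleMarginal X Y α ξ lam₁ lam₂ u.1 u.2) := by
  unfold scaleCondENN stateCond₂
  rw [← ENNReal.ofReal_mul (stateMarginal_pos hlam₁ hlam₂ x).le,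
    ← jointDensity_eq_stateMarginal_mul hlam₁ hlam₂ x ht hw,
    jointDensity_eq_betaCond_mul hα hξ hY hn x ht hw, varianceScaleDensity,
    ENNReal.ofReal_mul (betaCond_nonneg _ _ _ _),
    ENNReal.ofReal_mul (varianceCond₂_pos hα hξ hY hn ht hw x.2.2).le, mul_assoc]

lemma stateMarginal_mul_scaleCondENN₃ (x : State q) {u : (Fin (q + 1) → ℝ) × (Fin q → ℝ)}
    (ht : u.1 ∈ posOrthant (q + 1)) (hw : u.2 ∈ posOrthant q) :
    ENNReal.ofReal (stateMarginal X Y α ξ lam₁ lam₂ x) * scaleCondENN lam₁ lam₂ x u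
      = ENNReal.ofReal (varianceCond₃ X Y α ξ x.1 u.1 u.2 x.2) *
        ENNReal.ofReal (coefScaleDensity X Y α ξ lam₁ lam₂ x.1 u.1 u.2) := by
  unfold scaleCondENN
  rw [← ENNReal.ofReal_mul (stateMarginal_pos hlam₁ hlam₂ x).le,
    ← jointDensity_eq_stateMarginal_mul hlam₁ hlam₂ x ht hw,
    jointDensity_eq_varianceCond₃_mul hα hξ hY x ht hw,
    ENNReal.ofReal_mul (varianceCond₃_pos hα hξ hY _ ht hw x.2.2).le]

include hn in
lemma lintegral_stateMarginal_mul_scaleCondENN {u : (Fin (q + 1) → ℝ) × (Fin q → ℝ)}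
    (ht : u.1 ∈ posOrthant (q + 1)) (hw : u.2 ∈ posOrthant q) :
    ∫⁻ x, ENNReal.ofReal (stateMarginal X Y α ξ lam₁ lam₂ x) * scaleCondENN lam₁ lam₂ x u
      ∂(lebesgue q) = ENNReal.ofReal (scaleMarginal X Y α ξ lam₁ lam₂ u.1 u.2) := by
  simp only [stateMarginal_mul_scaleCondENN₂ hn hα hξ hY hlam₁ hlam₂ _ ht hw]
  rw [lintegral_mul_const' _ _ ENNReal.ofReal_ne_top, lintegral_stateCond₂ hn hα hξ hY ht hw,
    one_mul]

omit hα hξ hY hlam₁ hlam₂ in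
-- Tonelli with the starting state integrated first. The factor `c` may depend on that state, as it
-- does in the three-block chain.
lemma lintegral_mul_mixture {c : State q → (Fin (q + 1) → ℝ) × (Fin q → ℝ) → ℝ≥0∞}
    (hc : Measurable (Function.uncurry c)) :
    ∫⁻ x, ENNReal.ofReal (stateMarginal X Y α ξ lam₁ lam₂ x) *
        ∫⁻ u, c x u * scaleCondENN lam₁ lam₂ x u ∂(scaleMeasure q) ∂(lebesgue q)
      = ∫⁻ u, ∫⁻ x, c x u * (ENNReal.ofReal (stateMarginal X Y α ξ lam₁ lam₂ x) *
        scaleCondENN lam₁ lam₂ x u) ∂(lebesgue q) ∂(scaleMeasure q) := by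
  rw [← lintegral_lintegral_swap]
  · refine lintegral_congr fun x => ?_
    rw [← lintegral_const_mul' _ _ ENNReal.ofReal_ne_top]
    refine lintegral_congr fun u => ?_
    ring
  · exact (hc.mul (((measurable_stateMarginal X Y α ξ lam₁ lam₂).ennreal_ofReal.comp
      measurable_fst).mul (measurable_scaleCondENN lam₁ lam₂ measurable_fst
      measurable_snd))).aemeasurable

omit hα hξ hY hlam₁ hlam₂ in
lemma stateCond₂_ne_top (u : (Fin (q + 1) → ℝ) × (Fin q → ℝ)) (y : State q) :
    stateCond₂ X Y α ξ u y ≠ ∞ :=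
  ENNReal.mul_ne_top ENNReal.ofReal_ne_top ENNReal.ofReal_ne_top

include hn in
-- Integrating out the old state leaves the marginal of the scales; drawing the new state given the
-- scales restores the joint density at `y`, whose scales then integrate out.
lemma lintegral_stateMarginal_mul_twoBlockDensity (y : State q) :
    ∫⁻ x, ENNReal.ofReal (stateMarginal X Y α ξ lam₁ lam₂ x) *
      twoBlockDensity X Y α ξ lam₁ lam₂ x y ∂(lebesgue q)
      = ENNReal.ofReal (stateMarginal X Y α ξ lam₁ lam₂ y) := by
  simp only [twoBlockDensity_eq]
  rw [lintegral_mul_mixture (c := fun _ u => stateCond₂ X Y α ξ u y)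
    (measurable_stateCond₂ X Y α ξ measurable_snd measurable_const)]
  calc _ = ∫⁻ u, ENNReal.ofReal (stateMarginal X Y α ξ lam₁ lam₂ y) * scaleCondENN lam₁ lam₂ y u
        ∂(scaleMeasure q) := by
        refine lintegral_congr_ae ?_
        filter_upwards [ae_scaleMeasure q] with u hu
        rw [stateMarginal_mul_scaleCondENN₂ hn hα hξ hY hlam₁ hlam₂ _ hu.1 hu.2,
          lintegral_const_mul' _ _ (stateCond₂_ne_top u y),
          lintegral_stateMarginal_mul_scaleCondENN hn hα hξ hY hlam₁ hlam₂ hu.1 hu.2]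
    _ = _ := by
        rw [lintegral_const_mul' _ _ ENNReal.ofReal_ne_top, lintegral_scaleCondENN hlam₁ hlam₂,
          mul_one]

omit hlam₁ hlam₂ in
include hn in
-- For fixed scales and variance the integrand is the joint density, which is then read as the
-- normal law of `β` times a factor free of `β`.
lemma lintegral_coefScaleDensity_mul {u : (Fin (q + 1) → ℝ) × (Fin q → ℝ)}
    (ht : u.1 ∈ posOrthant (q + 1)) (hw : u.2 ∈ posOrthant q) {s : ℝ} (hs : 0 < s) :
    ∫⁻ b, ENNReal.ofReal (varianceCond₃ X Y α ξ b u.1 u.2 s) *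
        ENNReal.ofReal (coefScaleDensity X Y α ξ lam₁ lam₂ b u.1 u.2)
      = ENNReal.ofReal (varianceScaleDensity X Y α ξ lam₁ lam₂ s u.1 u.2) := by
  have h : ∀ b, ENNReal.ofReal (varianceCond₃ X Y α ξ b u.1 u.2 s) *
        ENNReal.ofReal (coefScaleDensity X Y α ξ lam₁ lam₂ b u.1 u.2)
      = ENNReal.ofReal (betaCond X Y s u.1 u.2 b) *
        ENNReal.ofReal (varianceScaleDensity X Y α ξ lam₁ lam₂ s u.1 u.2) := fun b => by
    rw [← ENNReal.ofReal_mul (varianceCond₃_pos hα hξ hY _ ht hw hs).le,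
      ← ENNReal.ofReal_mul (betaCond_nonneg _ _ _ _)]
    congr 1
    exact (jointDensity_eq_varianceCond₃_mul hα hξ hY (b, ⟨s, hs⟩) ht hw).symm.trans
      (jointDensity_eq_betaCond_mul hα hξ hY hn (b, ⟨s, hs⟩) ht hw)
  simp only [h]
  rw [lintegral_mul_const' _ _ ENNReal.ofReal_ne_top, lintegral_betaCond hs ht hw, one_mul]

omit hα hξ hY hlam₁ hlam₂ in
lemma measurable_coefScaleDensity (u : (Fin (q + 1) → ℝ) × (Fin q → ℝ)) :
    Measurable fun b => coefScaleDensity X Y α ξ lam₁ lam₂ b u.1 u.2 := by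
  have := measurable_penalizedRSS X Y (t := fun _ : Fin (q + 1) → ℝ => u.1) (w := fun _ => u.2)
    measurable_id measurable_const measurable_const
  simp only [id] at this
  unfold coefScaleDensity
  fun_prop

include hn in
lemma lintegral_stateMarginal_mul_threeBlockDensity (y : State q) :
    ∫⁻ x, ENNReal.ofReal (stateMarginal X Y α ξ lam₁ lam₂ x) *
      threeBlockDensity X Y α ξ lam₁ lam₂ x y ∂(lebesgue q)
      = ENNReal.ofReal (stateMarginal X Y α ξ lam₁ lam₂ y) := by
  simp only [threeBlockDensity_eq]
  rw [lintegral_mul_mixture (c := fun x u => stateCond₃ X Y α ξ x.1 u y)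
    (measurable_stateCond₃ X Y α ξ measurable_fst.fst measurable_snd measurable_const)]
  have hy : (0 : ℝ) < y.2 := y.2.2
  calc _ = ∫⁻ u, ENNReal.ofReal (stateMarginal X Y α ξ lam₁ lam₂ y) * scaleCondENN lam₁ lam₂ y u
        ∂(scaleMeasure q) := by
        refine lintegral_congr_ae ?_
        filter_upwards [ae_scaleMeasure q] with u hu
        simp only [stateMarginal_mul_scaleCondENN₃ hα hξ hY hlam₁ hlam₂ _ hu.1 hu.2, stateCond₃]
        have hmv : ∀ s : (Fin (q + 1) → ℝ) × ℝ → ℝ, Measurable s → Measurable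
            fun z : (Fin (q + 1) → ℝ) × ℝ => ENNReal.ofReal
              (varianceCond₃ X Y α ξ z.1 u.1 u.2 (s z)) := fun s hs =>
          (measurable_varianceCond₃ X Y α ξ measurable_fst hs measurable_const
            measurable_const).ennreal_ofReal
        have hmc : Measurable fun z : (Fin (q + 1) → ℝ) × ℝ => ENNReal.ofReal
            (coefScaleDensity X Y α ξ lam₁ lam₂ z.1 u.1 u.2) :=
          ((measurable_coefScaleDensity u).comp measurable_fst).ennreal_ofReal
        refine (lintegral_lebesgue (G := fun z => ENNReal.ofReal (betaCond X Y y.2 u.1 u.2 y.1) *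
          ENNReal.ofReal (varianceCond₃ X Y α ξ z.1 u.1 u.2 y.2) *
          (ENNReal.ofReal (varianceCond₃ X Y α ξ z.1 u.1 u.2 z.2) *
          ENNReal.ofReal (coefScaleDensity X Y α ξ lam₁ lam₂ z.1 u.1 u.2)))
          (((hmv (fun _ => y.2) measurable_const).const_mul _).mul
            ((hmv _ measurable_snd).mul hmc))).trans ?_
        simp only
        -- The old variance occurs only in its own conditional density, which has mass one. What
        -- remains lets the new variance and the old `β` have the joint law given by the model, from
        -- which `β` is then integrated out and redrawn.
        have hin : ∀ b, ∫⁻ s in Ioi (0 : ℝ), ENNReal.ofReal (betaCond X Y y.2 u.1 u.2 y.1) *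
            ENNReal.ofReal (varianceCond₃ X Y α ξ b u.1 u.2 y.2) *
            (ENNReal.ofReal (varianceCond₃ X Y α ξ b u.1 u.2 s) *
            ENNReal.ofReal (coefScaleDensity X Y α ξ lam₁ lam₂ b u.1 u.2))
            = ENNReal.ofReal (betaCond X Y y.2 u.1 u.2 y.1) *
            (ENNReal.ofReal (varianceCond₃ X Y α ξ b u.1 u.2 y.2) *
            ENNReal.ofReal (coefScaleDensity X Y α ξ lam₁ lam₂ b u.1 u.2)) := fun b => by
          rw [lintegral_const_mul' _ _ (ENNReal.mul_ne_top ENNReal.ofReal_ne_top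
            ENNReal.ofReal_ne_top), lintegral_mul_const' _ _ ENNReal.ofReal_ne_top,
            lintegral_varianceCond₃ hα hξ hY b hu.1 hu.2, one_mul, mul_assoc]
        simp only [hin]
        rw [lintegral_const_mul' _ _ ENNReal.ofReal_ne_top,
          lintegral_coefScaleDensity_mul hn hα hξ hY hu.1 hu.2 hy,
          ← ENNReal.ofReal_mul (betaCond_nonneg _ _ _ _),
          ← jointDensity_eq_betaCond_mul hα hξ hY hn y hu.1 hu.2,
          jointDensity_eq_varianceCond₃_mul hα hξ hY y hu.1 hu.2,
          ENNReal.ofReal_mul (varianceCond₃_pos hα hξ hY _ hu.1 hu.2 hy).le]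
    _ = _ := by
        rw [lintegral_const_mul' _ _ ENNReal.ofReal_ne_top, lintegral_scaleCondENN hlam₁ hlam₂,
          mul_one]

omit hα hξ hY hlam₁ hlam₂ in
lemma lintegral_mixture {x : State q} {c : State q → (Fin (q + 1) → ℝ) × (Fin q → ℝ) → ℝ≥0∞}
    (hc : Measurable (Function.uncurry c)) {F : State q → ℝ≥0∞} (hF : Measurable F) :
    ∫⁻ y, F y * ∫⁻ u, c y u * scaleCondENN lam₁ lam₂ x u ∂(scaleMeasure q) ∂(lebesgue q)
      = ∫⁻ u, (∫⁻ y, F y * c y u ∂(lebesgue q)) * scaleCondENN lam₁ lam₂ x u ∂(scaleMeasure q) := by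
  have hs : Measurable (scaleCondENN lam₁ lam₂ x) :=
    measurable_scaleCondENN lam₁ lam₂ measurable_const measurable_id
  calc _ = ∫⁻ y, ∫⁻ u, F y * c y u * scaleCondENN lam₁ lam₂ x u ∂(scaleMeasure q) ∂(lebesgue q) := by
        refine lintegral_congr fun y => ?_
        rw [← lintegral_const_mul (F y) (f := fun u => c y u * scaleCondENN lam₁ lam₂ x u)
          ((hc.comp measurable_prodMk_left).mul hs)]
        refine lintegral_congr fun u => ?_
        rw [mul_assoc]
    _ = ∫⁻ u, ∫⁻ y, F y * c y u * scaleCondENN lam₁ lam₂ x u ∂(lebesgue q) ∂(scaleMeasure q) :=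
        lintegral_lintegral_swap (((hF.comp measurable_fst).mul hc).mul
          (hs.comp measurable_snd)).aemeasurable
    _ = _ := by
        refine lintegral_congr fun u => ?_
        rw [lintegral_mul_const' _ _ (by unfold scaleCondENN; exact ENNReal.ofReal_ne_top)]

include hn in
lemma lintegral_twoBlockDensity (x : State q) :
    ∫⁻ y, twoBlockDensity X Y α ξ lam₁ lam₂ x y ∂(lebesgue q) = 1 := by
  have h := lintegral_mixture (lam₁ := lam₁) (lam₂ := lam₂) (x := x) (c := fun y u => stateCond₂ X Y α ξ u y)
    (measurable_stateCond₂ X Y α ξ measurable_snd measurable_fst) (F := fun _ => 1) measurable_const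
  simp only [one_mul] at h
  simp only [twoBlockDensity_eq]
  rw [h, ← lintegral_scaleCondENN hlam₁ hlam₂ x]
  refine lintegral_congr_ae ?_
  filter_upwards [ae_scaleMeasure q] with u hu
  rw [lintegral_stateCond₂ hn hα hξ hY hu.1 hu.2, one_mul]

lemma lintegral_threeBlockDensity (x : State q) :
    ∫⁻ y, threeBlockDensity X Y α ξ lam₁ lam₂ x y ∂(lebesgue q) = 1 := by
  have h := lintegral_mixture (lam₁ := lam₁) (lam₂ := lam₂) (x := x) (c := fun y u => stateCond₃ X Y α ξ x.1 u y)
    (measurable_stateCond₃ X Y α ξ measurable_const measurable_snd measurable_fst)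
    (F := fun _ => 1) measurable_const
  simp only [one_mul] at h
  simp only [threeBlockDensity_eq]
  rw [h, ← lintegral_scaleCondENN hlam₁ hlam₂ x]
  refine lintegral_congr_ae ?_
  filter_upwards [ae_scaleMeasure q] with u hu
  rw [lintegral_stateCond₃ hα hξ hY x.1 hu.1 hu.2, one_mul]

end FusedLasso

/-! ### Propriety of the posterior -/

namespace FusedLasso

open Set Real Matrix

variable {n q : ℕ} {X : Matrix (Fin n) (Fin (q + 1)) ℝ} {Y : Fin n → ℝ} {α ξ lam₁ lam₂ : ℝ}

/-- The drift function `‖β‖² / σ²`. -/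
def drift (x : State q) : ℝ := ∑ i, x.1 i ^ 2 / (x.2 : ℝ)

lemma drift_nonneg (x : State q) : 0 ≤ drift x :=
  Finset.sum_nonneg fun _ _ => div_nonneg (sq_nonneg _) x.2.2.le

lemma measurable_drift : Measurable (drift : State q → ℝ) := by
  have hs : Measurable fun x : State q => (x.2 : ℝ) := measurable_state_snd measurable_id
  have hbi : ∀ i, Measurable fun x : State q => x.1 i :=
    fun i => (measurable_pi_apply i).comp measurable_fst
  unfold drift
  fun_prop

lemma sq_div_le_drift (x : State q) (i : Fin (q + 1)) : x.1 i ^ 2 / (x.2 : ℝ) ≤ drift x :=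
  Finset.single_le_sum (f := fun i => x.1 i ^ 2 / (x.2 : ℝ))
    (fun _ _ => div_nonneg (sq_nonneg _) x.2.2.le) (Finset.mem_univ i)

/-- The exponent must force decay as `s → 0` even when `ξ = 0` and `Y` lies in the range of `X`:
then either the residual is large or `Xβ` is close to `Y`, so that `‖β‖₁` is bounded away from zero
and half of the lasso penalty provides the decay. -/
lemma exists_le_exponent (X : Matrix (Fin n) (Fin (q + 1)) ℝ) (hξ : 0 ≤ ξ) (hY : 0 < ξ ∨ Y ≠ 0)
    (hlam₁ : 0 < lam₁) :
    ∃ δ C, 0 < δ ∧ ∀ (b : Fin (q + 1) → ℝ) (s : ℝ), 0 < s →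
      δ / √s + lam₁ / 2 * ((∑ i, |b i|) / √s) - C ≤
        ((Y - X *ᵥ b) ⬝ᵥ (Y - X *ᵥ b) + 2 * ξ) / 2 / s + lam₁ * ((∑ i, |b i|) / √s) := by
  have hsum : ∀ b : Fin (q + 1) → ℝ, 0 ≤ ∑ i, |b i| := fun b =>
    Finset.sum_nonneg fun _ _ => abs_nonneg _
  rcases hY with h | h
  -- From `(1/√s - 1)² ≥ 0` follows `ξ/s ≥ 2ξ/√s - ξ`.
  · refine ⟨2 * ξ, ξ, by positivity, fun b s hs => ?_⟩
    have hr : 0 < √s := sqrt_pos.2 hs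
    have hN : 0 ≤ (∑ i, |b i|) / √s := div_nonneg (hsum b) hr.le
    have h1 : 0 ≤ (Y - X *ᵥ b) ⬝ᵥ (Y - X *ᵥ b) / (2 * s) :=
      div_nonneg (dotProduct_self_nonneg' _) (by positivity)
    have h2 : ((Y - X *ᵥ b) ⬝ᵥ (Y - X *ᵥ b) + 2 * ξ) / 2 / s
        = (Y - X *ᵥ b) ⬝ᵥ (Y - X *ᵥ b) / (2 * s) + ξ * (1 / √s) ^ 2 := by
      rw [div_pow, sq_sqrt hs.le]
      field_simp
    have h3 : 2 * ξ / √s = 2 * ξ * (1 / √s) := by ring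
    rw [h2, h3]
    nlinarith [mul_nonneg h.le (sq_nonneg (1 / √s - 1)), mul_nonneg hlam₁.le hN]
  · obtain ⟨k, hk⟩ : ∃ k, Y k ≠ 0 := by
      by_contra! hc
      exact h (funext hc)
    obtain ⟨c, hc⟩ : ∃ c, c = ∑ i, |X k i| := ⟨_, rfl⟩
    have hc0 : 0 ≤ c := hc ▸ Finset.sum_nonneg fun _ _ => abs_nonneg _
    -- Small enough that `η c ≤ lam₁ / 2`. Multiplying `|Y k|/√s ≤ v + c ‖b‖₁/√s` by `η` and using
    -- `η v ≤ v²/2 + η²/2` yields both `δ = η |Y k|` and the constant `η²/2`.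
    obtain ⟨η, hη⟩ : ∃ η, η = lam₁ / (2 * (c + 1)) := ⟨_, rfl⟩
    have hη0 : 0 < η := by rw [hη]; positivity
    have hηc : η * c ≤ lam₁ / 2 := by
      rw [hη, div_mul_eq_mul_div, div_le_div_iff₀ (by positivity) (by positivity)]
      nlinarith
    refine ⟨η * |Y k|, η ^ 2 / 2, mul_pos hη0 (abs_pos.2 hk), fun b s hs => ?_⟩
    have hr : 0 < √s := sqrt_pos.2 hs
    have hN : 0 ≤ (∑ i, |b i|) / √s := div_nonneg (hsum b) hr.le
    obtain ⟨v, hv⟩ : ∃ v, v = |Y k - (X *ᵥ b) k| / √s := ⟨_, rfl⟩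
    have h1 : |(X *ᵥ b) k| ≤ c * ∑ i, |b i| := by
      rw [mulVec, dotProduct]
      calc _ ≤ ∑ i, |X k i * b i| := Finset.abs_sum_le_sum_abs _ _
        _ ≤ ∑ i, |X k i| * ∑ j, |b j| := by
          refine Finset.sum_le_sum fun i _ => ?_
          rw [abs_mul]
          gcongr
          exact Finset.single_le_sum (f := fun i => |b i|) (fun _ _ => abs_nonneg _)
            (Finset.mem_univ i)
        _ = _ := by rw [← Finset.sum_mul, hc]
    have h2 : |Y k| / √s ≤ v + c * ((∑ i, |b i|) / √s) := by
      rw [hv, ← mul_div_assoc, ← add_div]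
      gcongr
      calc |Y k| = |(Y k - (X *ᵥ b) k) + (X *ᵥ b) k| := by rw [sub_add_cancel]
        _ ≤ _ := (abs_add_le _ _).trans (by gcongr)
    have h3 : v ^ 2 / 2 ≤ ((Y - X *ᵥ b) ⬝ᵥ (Y - X *ᵥ b) + 2 * ξ) / 2 / s := by
      have h4 : (Y k - (X *ᵥ b) k) ^ 2 ≤ (Y - X *ᵥ b) ⬝ᵥ (Y - X *ᵥ b) := by
        rw [sq]
        exact Finset.single_le_sum (f := fun i => (Y - X *ᵥ b) i * (Y - X *ᵥ b) i)
          (fun _ _ => mul_self_nonneg _) (Finset.mem_univ k)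
      rw [hv, div_pow, sq_sqrt hs.le, sq_abs, div_right_comm]
      gcongr
      linarith
    have h5 : η * |Y k| / √s = η * (|Y k| / √s) := by ring
    rw [h5]
    nlinarith [sq_nonneg (v - η), mul_le_mul_of_nonneg_left h2 hη0.le,
      mul_le_mul_of_nonneg_right hηc hN]

lemma one_add_sq_le_exp {ε N : ℝ} (hε : 0 < ε) (hN : 0 ≤ N) :
    1 + N ^ 2 ≤ (1 + 2 / ε ^ 2) * exp (ε * N) := by
  have h1 := quadratic_le_exp_of_nonneg (mul_nonneg hε.le hN)
  have h2 : 1 ≤ exp (ε * N) := one_le_exp (mul_nonneg hε.le hN)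
  have h3 : N ^ 2 ≤ 2 / ε ^ 2 * exp (ε * N) := by
    rw [div_mul_eq_mul_div, le_div_iff₀ (by positivity)]
    nlinarith [mul_nonneg hε.le hN]
  linarith

lemma drift_le_sq (b : Fin (q + 1) → ℝ) {s : ℝ} (hs : 0 < s) :
    ∑ i, b i ^ 2 / s ≤ ((∑ i, |b i|) / √s) ^ 2 := by
  rw [div_pow, sq_sqrt hs.le, ← Finset.sum_div]
  gcongr
  rw [sq, Finset.sum_mul]
  refine Finset.sum_le_sum fun i _ => ?_
  rw [← sq_abs, sq]
  gcongr
  exact Finset.single_le_sum (f := fun i => |b i|) (fun _ _ => abs_nonneg _) (Finset.mem_univ i)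

variable (hn : 0 < n) (hα : 0 ≤ α) (hξ : 0 ≤ ξ) (hY : 0 < ξ ∨ Y ≠ 0)
  (hlam₁ : 0 < lam₁) (hlam₂ : 0 < lam₂)

include hξ hY hlam₁ hlam₂ in
-- Of the remaining rate `lam₁ / 2`, one half pays for the polynomial factor `1 + drift`; the other
-- half keeps `β` integrable.
lemma exists_stateMarginal_mul_le : ∃ δ K, 0 < δ ∧ 0 < K ∧ ∀ x : State q,
    stateMarginal X Y α ξ lam₁ lam₂ x * (1 + drift x) ≤
      K * ((x.2 : ℝ) ^ (-((n + (q + 1 : ℕ) + 2 * α) / 2) - 1) * exp (-δ / √x.2)) *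
        exp (-(lam₁ / 4) * ((∑ i, |x.1 i|) / √x.2)) := by
  obtain ⟨δ, C, hδ, hC⟩ := exists_le_exponent X hξ hY hlam₁
  have hg := gaussConst_pos n q
  refine ⟨δ, gaussConst n q * (lam₁ / √(2 * π))⁻¹ ^ (q + 1) * (lam₂ / √(2 * π))⁻¹ ^ q *
    (exp C * (1 + 2 / (lam₁ / 4) ^ 2)), hδ, by positivity, fun x => ?_⟩
  obtain ⟨b, s, hs⟩ := x
  have hs : 0 < s := hs
  have hr : 0 < √s := sqrt_pos.2 hs
  have h1 := hC b s hs
  obtain ⟨N, hN⟩ : ∃ N, N = (∑ i, |b i|) / √s := ⟨_, rfl⟩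
  have hN0 : 0 ≤ N := hN ▸ div_nonneg (Finset.sum_nonneg fun _ _ => abs_nonneg _) hr.le
  have h2 : 1 + drift (b, (⟨s, hs⟩ : Ioi (0 : ℝ)))
      ≤ (1 + 2 / (lam₁ / 4) ^ 2) * exp (lam₁ / 4 * N) := by
    refine le_trans ?_ (one_add_sq_le_exp (by positivity) hN0)
    have := drift_le_sq b hs
    rw [← hN] at this
    exact add_le_add_right this 1
  have hF : 0 ≤ lam₂ * (∑ j : Fin q, |b j.succ - b j.castSucc|) / √s :=
    div_nonneg (mul_nonneg hlam₂.le (Finset.sum_nonneg fun _ _ => abs_nonneg _)) hr.le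
  have h3 : exp (-(((Y - X *ᵥ b) ⬝ᵥ (Y - X *ᵥ b) + 2 * ξ) / 2) / s) *
      exp (-((lam₁ * ∑ i, |b i| + lam₂ * ∑ j : Fin q, |b j.succ - b j.castSucc|) / √s)) ≤
      exp C * exp (-δ / √s) * exp (-(lam₁ / 2) * N) := by
    rw [← exp_add, ← exp_add, ← exp_add, exp_le_exp]
    rw [← hN] at h1
    have e1 : (lam₁ * ∑ i, |b i| + lam₂ * ∑ j : Fin q, |b j.succ - b j.castSucc|) / √s
        = lam₁ * N + lam₂ * (∑ j : Fin q, |b j.succ - b j.castSucc|) / √s := by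
      rw [hN]; ring
    have e2 : -(((Y - X *ᵥ b) ⬝ᵥ (Y - X *ᵥ b) + 2 * ξ) / 2) / s
        = -(((Y - X *ᵥ b) ⬝ᵥ (Y - X *ᵥ b) + 2 * ξ) / 2 / s) := by ring
    have e3 : -δ / √s = -(δ / √s) := by ring
    rw [e1, e2, e3]
    linarith
  have h4 : exp (-(lam₁ / 2) * N) * exp (lam₁ / 4 * N) = exp (-(lam₁ / 4) * N) := by
    rw [← exp_add]
    congr 1
    ring
  have hV := drift_nonneg (b, (⟨s, hs⟩ : Ioi (0 : ℝ)))
  unfold stateMarginal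
  simp only
  calc _ = gaussConst n q * (lam₁ / √(2 * π))⁻¹ ^ (q + 1) * (lam₂ / √(2 * π))⁻¹ ^ q *
        s ^ (-((n + (q + 1 : ℕ) + 2 * α) / 2) - 1) *
        ((exp (-(((Y - X *ᵥ b) ⬝ᵥ (Y - X *ᵥ b) + 2 * ξ) / 2) / s) *
        exp (-((lam₁ * ∑ i, |b i| + lam₂ * ∑ j : Fin q, |b j.succ - b j.castSucc|) / √s))) *
        (1 + drift (b, (⟨s, hs⟩ : Ioi (0 : ℝ))))) := by ring
    _ ≤ gaussConst n q * (lam₁ / √(2 * π))⁻¹ ^ (q + 1) * (lam₂ / √(2 * π))⁻¹ ^ q *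
        s ^ (-((n + (q + 1 : ℕ) + 2 * α) / 2) - 1) *
        ((exp C * exp (-δ / √s) * exp (-(lam₁ / 2) * N)) *
        ((1 + 2 / (lam₁ / 4) ^ 2) * exp (lam₁ / 4 * N))) := by gcongr
    _ = _ := by
      rw [← hN, ← h4]
      ring

lemma lintegral_exp_neg_sum_abs {c s : ℝ} (hc : 0 < c) (hs : 0 < s) :
    ∫⁻ b : Fin (q + 1) → ℝ, ENNReal.ofReal (exp (-c * ((∑ i, |b i|) / √s)))
      = ENNReal.ofReal ((2 / c) ^ (q + 1) * s ^ (((q + 1 : ℕ) : ℝ) / 2)) := by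
  have hr : 0 < √s := sqrt_pos.2 hs
  have h : ∀ b : Fin (q + 1) → ℝ, ENNReal.ofReal (exp (-c * ((∑ i, |b i|) / √s)))
      = ∏ i, ENNReal.ofReal (exp (-(c / √s) * |b i|)) := fun b => by
    rw [← ENNReal.ofReal_prod_of_nonneg (fun i _ => (exp_pos _).le), ← exp_sum, ← Finset.mul_sum]
    congr 2
    ring
  simp only [h]
  rw [volume_pi, lintegral_fin_prod (fun _ => volume)
    (f := fun _ x => ENNReal.ofReal (exp (-(c / √s) * |x|))) (fun i => by fun_prop),
    Finset.prod_const, lintegral_exp_neg_mul_abs (by positivity), Finset.card_univ,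
    Fintype.card_fin, ← ENNReal.ofReal_pow (by positivity), ← sqrt_pow_eq_rpow hs]
  congr 1
  have : √(s ^ (q + 1)) = √s ^ (q + 1) := by
    rw [sqrt_eq_iff_mul_self_eq (by positivity) (by positivity), ← mul_pow, mul_self_sqrt hs.le]
  rw [this, ← mul_pow]
  congr 1
  field_simp

include hn hα hξ hY hlam₁ hlam₂

/-- Integrating `β` first yields `s^(p/2)` and leaves `s^(-(n/2+α)-1) exp (-δ/√s)`: integrable at
infinity because `n/2 + α > 0`, even for an improper variance prior, and at zero by the exponential.
-/
lemma lintegral_stateMarginal_mul_one_add_drift_lt_top :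
    ∫⁻ x, ENNReal.ofReal (stateMarginal X Y α ξ lam₁ lam₂ x * (1 + drift x)) ∂(lebesgue q) < ∞ := by
  obtain ⟨δ, K, hδ, hK, h⟩ := exists_stateMarginal_mul_le (X := X) (Y := Y) (α := α) hξ hY hlam₁ hlam₂
  let F : (Fin (q + 1) → ℝ) × ℝ → ℝ≥0∞ := fun z =>
    ENNReal.ofReal (K * (z.2 ^ (-((n + (q + 1 : ℕ) + 2 * α) / 2) - 1) * exp (-δ / √z.2))) *
      ENNReal.ofReal (exp (-(lam₁ / 4) * ((∑ i, |z.1 i|) / √z.2)))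
  have hF : Measurable F := by
    have : Measurable fun z : (Fin (q + 1) → ℝ) × ℝ => ∑ i, |z.1 i| :=
      Finset.measurable_sum _ fun i _ => ((measurable_pi_apply i).comp measurable_fst).abs
    fun_prop
  have hint := integrableOn_rpow_mul_exp_neg_div_sqrt (shape₂_pos hn hα) hδ
  calc _ ≤ ∫⁻ x : State q, F (x.1, (x.2 : ℝ)) ∂(lebesgue q) := by
        refine lintegral_mono fun x => ?_
        have hs : (0 : ℝ) < x.2 := x.2.2
        simp only [F]
        rw [← ENNReal.ofReal_mul (by positivity)]
        exact ENNReal.ofReal_le_ofReal (h x)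
    _ = ∫⁻ s in Ioi (0 : ℝ), ∫⁻ b, F (b, s) := lintegral_lebesgue_symm hF
    _ = ∫⁻ s in Ioi (0 : ℝ), ENNReal.ofReal (K * (2 / (lam₁ / 4)) ^ (q + 1)) *
        ENNReal.ofReal (s ^ (-(n / 2 + α) - 1) * exp (-δ / √s)) := by
        refine setLIntegral_congr_fun measurableSet_Ioi fun s hs => ?_
        have hs : 0 < s := hs
        simp only [F]
        rw [lintegral_const_mul' _ _ ENNReal.ofReal_ne_top,
          lintegral_exp_neg_sum_abs (by positivity) hs, ← ENNReal.ofReal_mul (by positivity),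
          ← ENNReal.ofReal_mul (by positivity)]
        congr 1
        have hp : s ^ (-(n / 2 + α) - 1) = s ^ (-((n + (q + 1 : ℕ) + 2 * α) / 2) - 1) *
            s ^ (((q + 1 : ℕ) : ℝ) / 2) := by
          rw [← rpow_add hs]
          congr 1
          ring
        rw [hp]
        ring
    _ < ∞ := by
        rw [lintegral_const_mul' _ _ ENNReal.ofReal_ne_top]
        refine ENNReal.mul_lt_top ENNReal.ofReal_lt_top ?_
        have h0 : ∀ᵐ s ∂(volume.restrict (Ioi (0 : ℝ))),
            0 ≤ s ^ (-(n / 2 + α) - 1) * exp (-δ / √s) :=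
          (ae_restrict_iff' measurableSet_Ioi).2 (Filter.Eventually.of_forall fun s hs => by
            have hs : (0 : ℝ) < s := hs
            positivity)
        rw [← ofReal_integral_eq_lintegral_ofReal hint h0]
        exact ENNReal.ofReal_lt_top

lemma lintegral_stateMarginal_ne_top :
    ∫⁻ x, ENNReal.ofReal (stateMarginal X Y α ξ lam₁ lam₂ x) ∂(lebesgue q) ≠ ∞ := by
  refine ne_top_of_le_ne_top
    (lintegral_stateMarginal_mul_one_add_drift_lt_top (X := X) hn hα hξ hY hlam₁ hlam₂).ne
    (lintegral_mono fun x => ENNReal.ofReal_le_ofReal ?_)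
  have h1 := stateMarginal_pos (X := X) (Y := Y) (α := α) (ξ := ξ) hlam₁ hlam₂ x
  nlinarith [drift_nonneg x]

lemma lintegral_stateMarginal_ne_zero :
    ∫⁻ x, ENNReal.ofReal (stateMarginal X Y α ξ lam₁ lam₂ x) ∂(lebesgue q) ≠ 0 := by
  intro h
  rw [lintegral_eq_zero_iff (measurable_stateMarginal X Y α ξ lam₁ lam₂).ennreal_ofReal] at h
  have h0 : lebesgue q = 0 := ae_eq_bot.1 <|
    Filter.eventually_false_iff_eq_bot.1 <| h.mono fun x hx =>
      (ENNReal.ofReal_pos.2 (stateMarginal_pos hlam₁ hlam₂ x)).ne' hx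
  -- If Lebesgue measure on the state space vanished, a transition density could not have mass one.
  have h1 := lintegral_twoBlockDensity (X := X) hn hα hξ hY hlam₁ hlam₂ (0, ⟨1, mem_Ioi.2 one_pos⟩)
  rw [h0] at h1
  simp at h1

theorem isStationaryChain_twoBlockKernel :
    IsStationaryChain (twoBlockKernel X Y α ξ lam₁ lam₂) (posterior X Y α ξ lam₁ lam₂) := by
  unfold twoBlockKernel posterior
  rw [posteriorWeight_eq hlam₁ hlam₂]
  exact isStationaryChain_withDensity (measurable_stateMarginal X Y α ξ lam₁ lam₂).ennreal_ofReal
    (lintegral_stateMarginal_ne_zero hn hα hξ hY hlam₁ hlam₂)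
    (lintegral_stateMarginal_ne_top hn hα hξ hY hlam₁ hlam₂)
    (measurable_twoBlockDensity X Y α ξ lam₁ lam₂)
    (lintegral_twoBlockDensity hn hα hξ hY hlam₁ hlam₂)
    (lintegral_stateMarginal_mul_twoBlockDensity hn hα hξ hY hlam₁ hlam₂)

theorem isStationaryChain_threeBlockKernel :
    IsStationaryChain (threeBlockKernel X Y α ξ lam₁ lam₂) (posterior X Y α ξ lam₁ lam₂) := by
  unfold threeBlockKernel posterior
  rw [posteriorWeight_eq hlam₁ hlam₂]
  exact isStationaryChain_withDensity (measurable_stateMarginal X Y α ξ lam₁ lam₂).ennreal_ofReal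
    (lintegral_stateMarginal_ne_zero hn hα hξ hY hlam₁ hlam₂)
    (lintegral_stateMarginal_ne_top hn hα hξ hY hlam₁ hlam₂)
    (measurable_threeBlockDensity X Y α ξ lam₁ lam₂)
    (lintegral_threeBlockDensity hα hξ hY hlam₁ hlam₂)
    (lintegral_stateMarginal_mul_threeBlockDensity hn hα hξ hY hlam₁ hlam₂)

lemma integrable_drift_posterior : Integrable drift (posterior X Y α ξ lam₁ lam₂) := by
  have hm := (measurable_stateMarginal X Y α ξ lam₁ lam₂).ennreal_ofReal
  refine ⟨measurable_drift.aestronglyMeasurable, ?_⟩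
  rw [hasFiniteIntegral_iff_ofReal (Filter.Eventually.of_forall drift_nonneg)]
  unfold posterior
  rw [posteriorWeight_eq hlam₁ hlam₂, lintegral_smul_measure, withDensity_apply _ .univ,
    setLIntegral_univ, lintegral_withDensity_eq_lintegral_mul _ hm measurable_drift.ennreal_ofReal]
  refine ENNReal.mul_lt_top
    (ENNReal.inv_lt_top.2 (lintegral_stateMarginal_ne_zero hn hα hξ hY hlam₁ hlam₂).bot_lt) ?_
  refine lt_of_le_of_lt (lintegral_mono fun x => ?_)
    (lintegral_stateMarginal_mul_one_add_drift_lt_top (X := X) hn hα hξ hY hlam₁ hlam₂)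
  have h1 := stateMarginal_pos (X := X) (Y := Y) (α := α) (ξ := ξ) hlam₁ hlam₂ x
  rw [Pi.mul_apply, ← ENNReal.ofReal_mul h1.le]
  refine ENNReal.ofReal_le_ofReal ?_
  nlinarith

end FusedLasso

/-! ### Geometric ergodicity of the two-block chain -/

namespace FusedLasso

open Set Real Matrix

variable {n q : ℕ} {X : Matrix (Fin n) (Fin (q + 1)) ℝ} {Y : Fin n → ℝ} {α ξ lam₁ lam₂ : ℝ}

/-- The set of scales with all components in `[1, 2]`. -/
def scaleBox (q : ℕ) : Set ((Fin (q + 1) → ℝ) × (Fin q → ℝ)) :=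
  (Set.pi univ fun _ => Icc (1 : ℝ) 2) ×ˢ (Set.pi univ fun _ => Icc (1 : ℝ) 2)

lemma measurableSet_scaleBox (q : ℕ) : MeasurableSet (scaleBox q) :=
  (MeasurableSet.univ_pi fun _ => measurableSet_Icc).prod
    (MeasurableSet.univ_pi fun _ => measurableSet_Icc)

lemma pi_Icc_subset_posOrthant (k : ℕ) :
    (Set.pi univ fun _ => Icc (1 : ℝ) 2) ⊆ posOrthant k :=
  fun _ hv i => one_pos.trans_le (hv i trivial).1

lemma scaleMeasure_scaleBox (q : ℕ) : scaleMeasure q (scaleBox q) = 1 := by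
  have h : ∀ k, (volume.restrict (posOrthant k)) (Set.pi univ fun _ => Icc (1 : ℝ) 2) = 1 := by
    intro k
    rw [Measure.restrict_apply (MeasurableSet.univ_pi fun _ => measurableSet_Icc),
      inter_eq_self_of_subset_left (pi_Icc_subset_posOrthant k), volume_pi_pi]
    norm_num
  rw [scaleMeasure, scaleBox, Measure.prod_prod, h, h, one_mul]

lemma sqrt_sq_div_le {lam s b V : ℝ} (hlam : 0 < lam) (h : b ^ 2 / s ≤ V) :
    √(b ^ 2 / (lam ^ 2 * s)) ≤ √(V / lam ^ 2) := by
  refine sqrt_le_sqrt ?_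
  rw [mul_comm, ← div_div]
  gcongr

lemma sub_sq_div_le_drift (x : State q) (j : Fin q) :
    (x.1 j.succ - x.1 j.castSucc) ^ 2 / (x.2 : ℝ) ≤ 4 * drift x := by
  have hs : (0 : ℝ) < x.2 := x.2.2
  have h1 := sq_div_le_drift x j.succ
  have h2 := sq_div_le_drift x j.castSucc
  rw [div_le_iff₀ hs] at h1 h2 ⊢
  nlinarith [sq_nonneg (x.1 j.succ + x.1 j.castSucc)]

/-- The scale step has a density bounded below on sublevel sets of the drift function. -/
lemma exists_le_scaleCond (q : ℕ) (hlam₁ : 0 < lam₁) (hlam₂ : 0 < lam₂) (R : ℝ) :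
    ∃ c, 0 < c ∧ ∀ x : State q, drift x ≤ R → ∀ u ∈ scaleBox q,
      c ≤ scaleCond lam₁ lam₂ x u.1 u.2 := by
  obtain ⟨c₁, hc₁, h₁⟩ := exists_le_recipInvGaussianPdf (by positivity : 0 < lam₁ ^ 2) √(R / lam₁ ^ 2)
  obtain ⟨c₂, hc₂, h₂⟩ := exists_le_recipInvGaussianPdf (by positivity : 0 < lam₂ ^ 2)
    √(4 * R / lam₂ ^ 2)
  refine ⟨(∏ _i : Fin (q + 1), c₁) * ∏ _j : Fin q, c₂, by positivity, fun x hx u hu => ?_⟩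
  refine mul_le_mul (Finset.prod_le_prod (fun _ _ => hc₁.le) fun i _ => ?_)
    (Finset.prod_le_prod (fun _ _ => hc₂.le) fun j _ => ?_) (by positivity)
    (Finset.prod_nonneg fun _ _ => recipInvGaussianPdf_nonneg)
  · exact h₁ _ (sqrt_nonneg _) (sqrt_sq_div_le hlam₁ ((sq_div_le_drift x i).trans hx)) _
      (hu.1 i trivial)
  · exact h₂ _ (sqrt_nonneg _) (sqrt_sq_div_le hlam₂ ((sub_sq_div_le_drift x j).trans
      (by linarith))) _ (hu.2 j trivial)

/-- Mean of a local scale under the scale step. -/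
lemma lintegral_mul_scaleCondENN_le (hlam₁ : 0 < lam₁) (hlam₂ : 0 < lam₂) {C : ℝ}
    (hC : ∀ ν, 0 ≤ ν → ∫⁻ t in Ioi (0 : ℝ), ENNReal.ofReal
      (t * recipInvGaussianPdf ν (lam₁ ^ 2) t) ≤ ENNReal.ofReal (2 * ν + C))
    (x : State q) (i : Fin (q + 1)) :
    ∫⁻ u, ENNReal.ofReal (u.1 i) * scaleCondENN lam₁ lam₂ x u ∂(scaleMeasure q)
      ≤ ENNReal.ofReal (2 * √(x.1 i ^ 2 / (lam₁ ^ 2 * (x.2 : ℝ))) + C) := by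
  let ν : Fin (q + 1) → ℝ := fun i => √(x.1 i ^ 2 / (lam₁ ^ 2 * (x.2 : ℝ)))
  let ν' : Fin q → ℝ := fun j => √((x.1 j.succ - x.1 j.castSucc) ^ 2 / (lam₂ ^ 2 * (x.2 : ℝ)))
  -- The factor `t` is inserted in coordinate `i` only; all other coordinates integrate to one.
  let f : Fin (q + 1) → ℝ → ℝ≥0∞ := fun k t =>
    (if k = i then ENNReal.ofReal t else 1) * ENNReal.ofReal (recipInvGaussianPdf (ν k) (lam₁ ^ 2) t)
  let g : Fin q → ℝ → ℝ≥0∞ := fun j t => ENNReal.ofReal (recipInvGaussianPdf (ν' j) (lam₂ ^ 2) t)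
  have hm : ∀ ν l, Measurable fun t => ENNReal.ofReal (recipInvGaussianPdf ν l t) := fun ν l =>
    (measurable_recipInvGaussianPdf.comp
      (by fun_prop : Measurable fun t : ℝ => (ν, l, t))).ennreal_ofReal
  have hf : ∀ k, Measurable (f k) := fun k => by
    refine Measurable.mul ?_ (hm _ _)
    split_ifs
    · exact ENNReal.measurable_ofReal
    · exact measurable_const
  have hfg : ∀ u : (Fin (q + 1) → ℝ) × (Fin q → ℝ),
      ENNReal.ofReal (u.1 i) * scaleCondENN lam₁ lam₂ x u
        = (∏ k, f k (u.1 k)) * ∏ j, g j (u.2 j) := fun u => by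
    simp only [f, g, scaleCondENN, scaleCond, Finset.prod_mul_distrib, Finset.prod_ite_eq',
      Finset.mem_univ, if_true]
    rw [ENNReal.ofReal_mul (Finset.prod_nonneg fun _ _ => recipInvGaussianPdf_nonneg),
      ENNReal.ofReal_prod_of_nonneg fun _ _ => recipInvGaussianPdf_nonneg,
      ENNReal.ofReal_prod_of_nonneg fun _ _ => recipInvGaussianPdf_nonneg, mul_assoc]
  simp only [hfg]
  rw [lintegral_scaleMeasure_prod hf (fun j => hm _ _)]
  have hg1 : ∏ j, ∫⁻ t in Ioi (0 : ℝ), g j t = 1 := Finset.prod_eq_one fun j _ =>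
    lintegral_recipInvGaussianPdf (sqrt_nonneg _) (by positivity)
  rw [hg1, mul_one, Finset.prod_eq_single i]
  · simp only [f, if_true]
    refine le_trans (le_of_eq ?_) (hC (ν i) (sqrt_nonneg _))
    refine setLIntegral_congr_fun measurableSet_Ioi fun t ht => ?_
    have ht : 0 < t := ht
    rw [ENNReal.ofReal_mul ht.le]
  · intro k _ hk
    simp only [f, if_neg hk, one_mul]
    exact lintegral_recipInvGaussianPdf (sqrt_nonneg _) (by positivity)
  · simp

variable (hn : 0 < n) (hα : 0 ≤ α) (hξ : 0 ≤ ξ) (hY : 0 < ξ ∨ Y ≠ 0)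
  (hlam₁ : 0 < lam₁) (hlam₂ : 0 < lam₂)

lemma sq_div_le_penalizedRSS (b : Fin (q + 1) → ℝ) {t : Fin (q + 1) → ℝ} {w : Fin q → ℝ}
    (ht : t ∈ posOrthant (q + 1)) (hw : w ∈ posOrthant q) (i : Fin (q + 1)) :
    b i ^ 2 / t i ≤ penalizedRSS X Y t w b := by
  unfold penalizedRSS
  rw [priorPrecision_quadForm]
  have h2 := dotProduct_self_nonneg' (Y - X *ᵥ b)
  have h3 : b i ^ 2 / t i ≤ ∑ i, b i ^ 2 / t i :=
    Finset.single_le_sum (f := fun i => b i ^ 2 / t i)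
      (fun i _ => div_nonneg (sq_nonneg _) (ht i).le) (Finset.mem_univ i)
  have h4 : 0 ≤ ∑ j : Fin q, (b j.succ - b j.castSucc) ^ 2 / w j :=
    Finset.sum_nonneg fun j _ => div_nonneg (sq_nonneg _) (hw j).le
  linarith

/-- Each `bᵢ²/tᵢ` is one term of the criterion. Adding `2ξ` makes the last factor the inverse-gamma
scale divided by the variance, whose mean is known exactly. -/
lemma drift_le_mul_penalizedRSS (hξ : 0 ≤ ξ) (b : Fin (q + 1) → ℝ) {s : ℝ} (hs : 0 < s)
    {t : Fin (q + 1) → ℝ} {w : Fin q → ℝ} (ht : t ∈ posOrthant (q + 1)) (hw : w ∈ posOrthant q) :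
    ∑ i, b i ^ 2 / s ≤ 2 * (∑ i, t i) * ((penalizedRSS X Y t w b + 2 * ξ) / 2 / s) := by
  have h : ∀ i, b i ^ 2 ≤ t i * (penalizedRSS X Y t w b + 2 * ξ) := fun i => by
    have h1 := sq_div_le_penalizedRSS (X := X) (Y := Y) b ht hw i
    have h5 := ht i
    rw [div_le_iff₀ h5] at h1
    nlinarith [mul_nonneg h5.le hξ]
  calc ∑ i, b i ^ 2 / s ≤ ∑ i, t i * (penalizedRSS X Y t w b + 2 * ξ) / s :=
        Finset.sum_le_sum fun i _ => by have := h i; gcongr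
    _ = _ := by
        rw [← Finset.sum_div, ← Finset.sum_mul]
        field_simp

/-- The mean is linear in `ν`, the drift quadratic: `2aν ≤ lam₁²ν²/2 + 2a²/lam₁²`. The final `+ 1`
makes the drift constant strictly positive. -/
lemma sum_mean_le_drift (hlam₁ : 0 < lam₁) (a C : ℝ) (x : State q) :
    ∑ i, a * (2 * √(x.1 i ^ 2 / (lam₁ ^ 2 * (x.2 : ℝ))) + C)
      ≤ 1 / 2 * drift x + (∑ _i : Fin (q + 1), (a * C + 2 * a ^ 2 / lam₁ ^ 2) + 1) := by
  have hs : (0 : ℝ) < x.2 := x.2.2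
  have h : ∀ i, a * (2 * √(x.1 i ^ 2 / (lam₁ ^ 2 * (x.2 : ℝ))) + C)
      ≤ 1 / 2 * (x.1 i ^ 2 / (x.2 : ℝ)) + (a * C + 2 * a ^ 2 / lam₁ ^ 2) := fun i => by
    obtain ⟨ν, hν⟩ : ∃ ν, ν = √(x.1 i ^ 2 / (lam₁ ^ 2 * (x.2 : ℝ))) := ⟨_, rfl⟩
    have hν2 : x.1 i ^ 2 / (x.2 : ℝ) = lam₁ ^ 2 * ν ^ 2 := by
      rw [hν, sq_sqrt (by positivity)]
      field_simp
    rw [hν2, ← hν]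
    have h1 : 2 * a * ν ≤ 1 / 2 * (lam₁ ^ 2 * ν ^ 2) + 2 * a ^ 2 / lam₁ ^ 2 := by
      have h2 : 2 * a ^ 2 / lam₁ ^ 2 = 2 * (a / lam₁) ^ 2 := by ring
      have h3 : 2 * a * ν = 2 * (a / lam₁) * (lam₁ * ν) := by field_simp
      rw [h2, h3]
      nlinarith [sq_nonneg (lam₁ * ν - 2 * (a / lam₁))]
    linarith
  have hsum := Finset.sum_le_sum fun i (_ : i ∈ Finset.univ) => h i
  rw [Finset.sum_add_distrib] at hsum
  unfold drift
  rw [Finset.mul_sum]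
  linarith

include hn hα hξ hY hlam₁ hlam₂

/-- Given the scales, the drift function has mean at most `(n + p + 2α) ∑ τᵢ²`. -/
lemma lintegral_drift_mul_stateCond₂_le {u : (Fin (q + 1) → ℝ) × (Fin q → ℝ)}
    (ht : u.1 ∈ posOrthant (q + 1)) (hw : u.2 ∈ posOrthant q) :
    ∫⁻ y, ENNReal.ofReal (drift y) * stateCond₂ X Y α ξ u y ∂(lebesgue q)
      ≤ ENNReal.ofReal ((n + (q + 1 : ℕ) + 2 * α) * ∑ i, u.1 i) := by
  have hm0 := scaleMarginal_pos (X := X) (lam₁ := lam₁) (lam₂ := lam₂) hα hξ hY hn ht hw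
  obtain ⟨m, hm⟩ : ∃ m, m = ENNReal.ofReal (scaleMarginal X Y α ξ lam₁ lam₂ u.1 u.2) := ⟨_, rfl⟩
  have hmpos : m ≠ 0 := by rw [hm]; exact (ENNReal.ofReal_pos.2 hm0).ne'
  have hmtop : m ≠ ∞ := by rw [hm]; exact ENNReal.ofReal_ne_top
  have hT : 0 ≤ ∑ i, u.1 i := Finset.sum_nonneg fun i _ => (ht i).le
  -- After multiplication by the marginal `m` of the scales, the order of conditioning is reversed:
  -- instead of `β` given the variance, the variance is drawn given `β`. This makes the integral
  -- over the variance explicit.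
  have hexch : ∀ y, stateCond₂ X Y α ξ u y * m
      = ENNReal.ofReal (varianceCond₃ X Y α ξ y.1 u.1 u.2 y.2) *
        ENNReal.ofReal (coefScaleDensity X Y α ξ lam₁ lam₂ y.1 u.1 u.2) := fun y => by
    rw [hm, ← stateMarginal_mul_scaleCondENN₂ hn hα hξ hY hlam₁ hlam₂ y ht hw,
      stateMarginal_mul_scaleCondENN₃ hα hξ hY hlam₁ hlam₂ y ht hw]
  have hmv : Measurable fun z : (Fin (q + 1) → ℝ) × ℝ => ENNReal.ofReal
      (varianceCond₃ X Y α ξ z.1 u.1 u.2 z.2) :=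
    (measurable_varianceCond₃ X Y α ξ measurable_fst measurable_snd measurable_const
      measurable_const).ennreal_ofReal
  have hmc : Measurable fun z : (Fin (q + 1) → ℝ) × ℝ => ENNReal.ofReal
      (coefScaleDensity X Y α ξ lam₁ lam₂ z.1 u.1 u.2) :=
    ((measurable_coefScaleDensity u).comp measurable_fst).ennreal_ofReal
  have hmr : Measurable fun z : (Fin (q + 1) → ℝ) × ℝ =>
      (penalizedRSS X Y u.1 u.2 z.1 + 2 * ξ) / 2 / z.2 :=
    (((measurable_penalizedRSS X Y measurable_fst measurable_const
      measurable_const).add_const _).div_const 2).div measurable_snd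
  have hmass : ∫⁻ b, ENNReal.ofReal (coefScaleDensity X Y α ξ lam₁ lam₂ b u.1 u.2) = m := by
    have h1 : ∫⁻ y, stateCond₂ X Y α ξ u y * m ∂(lebesgue q) = m := by
      rw [lintegral_mul_const' _ _ hmtop, lintegral_stateCond₂ hn hα hξ hY ht hw, one_mul]
    simp only [hexch] at h1
    refine Eq.trans ?_ ((lintegral_lebesgue (hmv.mul hmc)).symm.trans h1)
    refine lintegral_congr fun b => ?_
    simp only [Pi.mul_apply]
    rw [lintegral_mul_const' _ _ ENNReal.ofReal_ne_top, lintegral_varianceCond₃ hα hξ hY b ht hw,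
      one_mul]
  -- The factor `m` is positive and finite, hence harmless, and cancels against the total mass
  -- `hmass` at the end.
  rw [← ENNReal.mul_le_mul_iff_left hmpos hmtop, ← lintegral_mul_const' _ _ hmtop]
  simp only [mul_assoc, hexch]
  calc _ ≤ ∫⁻ y, ENNReal.ofReal (2 * ∑ i, u.1 i) *
        (ENNReal.ofReal ((penalizedRSS X Y u.1 u.2 y.1 + 2 * ξ) / 2 / y.2) *
        (ENNReal.ofReal (varianceCond₃ X Y α ξ y.1 u.1 u.2 y.2) *
        ENNReal.ofReal (coefScaleDensity X Y α ξ lam₁ lam₂ y.1 u.1 u.2))) ∂(lebesgue q) := by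
        refine lintegral_mono fun y => ?_
        rw [← mul_assoc (ENNReal.ofReal (2 * ∑ i, u.1 i)),
          ← ENNReal.ofReal_mul (mul_nonneg two_pos.le hT)]
        refine mul_le_mul_left (ENNReal.ofReal_le_ofReal ?_) _
        exact drift_le_mul_penalizedRSS hξ y.1 y.2.2 ht hw
    _ = ∫⁻ b, ∫⁻ s in Ioi (0 : ℝ), ENNReal.ofReal (2 * ∑ i, u.1 i) *
        (ENNReal.ofReal ((penalizedRSS X Y u.1 u.2 b + 2 * ξ) / 2 / s) *
        (ENNReal.ofReal (varianceCond₃ X Y α ξ b u.1 u.2 s) *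
        ENNReal.ofReal (coefScaleDensity X Y α ξ lam₁ lam₂ b u.1 u.2))) :=
        lintegral_lebesgue ((hmr.ennreal_ofReal.mul (hmv.mul hmc)).const_mul _)
    _ = ∫⁻ b, ENNReal.ofReal (2 * ∑ i, u.1 i) *
        (ENNReal.ofReal ((n + (q + 1 : ℕ) + 2 * α) / 2) *
          ENNReal.ofReal (coefScaleDensity X Y α ξ lam₁ lam₂ b u.1 u.2)) := by
        refine lintegral_congr fun b => ?_
        rw [lintegral_const_mul' _ _ ENNReal.ofReal_ne_top]
        congr 1
        simp only [← mul_assoc]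
        rw [lintegral_mul_const' _ _ ENNReal.ofReal_ne_top]
        congr 1
        have hr := penalizedRSS_add_pos (X := X) hξ hY ht hw b
        rw [← lintegral_div_mul_invGammaPdf (shape₃_pos n q hα) hr]
        refine setLIntegral_congr_fun measurableSet_Ioi fun s hs => ?_
        rw [ENNReal.ofReal_mul (div_nonneg hr.le (le_of_lt hs))]
        rfl
    _ = _ := by
        rw [lintegral_const_mul' _ _ ENNReal.ofReal_ne_top,
          lintegral_const_mul' _ _ ENNReal.ofReal_ne_top, hmass, ← mul_assoc,
          ← ENNReal.ofReal_mul (by positivity)]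
        congr 2
        ring

/-- Geometric drift of the two-block chain. -/
lemma lintegral_drift_twoBlockKernel_le {a C : ℝ} (ha : a = n + (q + 1 : ℕ) + 2 * α) (hC0 : 0 ≤ C)
    (hC : ∀ ν, 0 ≤ ν → ∫⁻ t in Ioi (0 : ℝ), ENNReal.ofReal
      (t * recipInvGaussianPdf ν (lam₁ ^ 2) t) ≤ ENNReal.ofReal (2 * ν + C)) (x : State q) :
    ∫⁻ y, ENNReal.ofReal (drift y) ∂(twoBlockKernel X Y α ξ lam₁ lam₂ x)
      ≤ ENNReal.ofReal
        (1 / 2 * drift x + (∑ _i : Fin (q + 1), (a * C + 2 * a ^ 2 / lam₁ ^ 2) + 1)) := by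
  have ha0 : 0 ≤ a := by rw [ha]; positivity
  have hd : Measurable (twoBlockDensity X Y α ξ lam₁ lam₂ x) :=
    Measurable.of_uncurry_left (measurable_twoBlockDensity X Y α ξ lam₁ lam₂)
  unfold twoBlockKernel
  rw [Kernel.withDensity_apply _ (measurable_twoBlockDensity X Y α ξ lam₁ lam₂), Kernel.const_apply,
    lintegral_withDensity_eq_lintegral_mul _ hd measurable_drift.ennreal_ofReal]
  have hmix := lintegral_mixture (lam₁ := lam₁) (lam₂ := lam₂) (x := x)
    (c := fun y u => stateCond₂ X Y α ξ u y)
    (measurable_stateCond₂ X Y α ξ measurable_snd measurable_fst)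
    (F := fun y => ENNReal.ofReal (drift y)) measurable_drift.ennreal_ofReal
  calc _ = ∫⁻ y, ENNReal.ofReal (drift y) * ∫⁻ u, stateCond₂ X Y α ξ u y *
        scaleCondENN lam₁ lam₂ x u ∂(scaleMeasure q) ∂(lebesgue q) := by
        refine lintegral_congr fun y => ?_
        rw [Pi.mul_apply, ← twoBlockDensity_eq, mul_comm]
    _ = _ := hmix
    _ ≤ ∫⁻ u, ∑ i, ENNReal.ofReal a * (ENNReal.ofReal (u.1 i) * scaleCondENN lam₁ lam₂ x u)
        ∂(scaleMeasure q) := by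
        refine lintegral_mono_ae ?_
        filter_upwards [ae_scaleMeasure q] with u hu
        rw [← Finset.mul_sum, ← Finset.sum_mul, ← mul_assoc,
          ← ENNReal.ofReal_sum_of_nonneg fun i _ => (hu.1 i).le, ← ENNReal.ofReal_mul ha0, ha]
        gcongr
        exact lintegral_drift_mul_stateCond₂_le hn hα hξ hY hlam₁ hlam₂ hu.1 hu.2
    _ = ∑ i, ENNReal.ofReal a * ∫⁻ u, ENNReal.ofReal (u.1 i) * scaleCondENN lam₁ lam₂ x u
        ∂(scaleMeasure q) := by
        have hmi : ∀ i : Fin (q + 1), Measurable fun u : (Fin (q + 1) → ℝ) × (Fin q → ℝ) =>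
            ENNReal.ofReal (u.1 i) * scaleCondENN lam₁ lam₂ x u := fun i =>
          ((measurable_pi_apply i).comp measurable_fst).ennreal_ofReal.mul
            (measurable_scaleCondENN lam₁ lam₂ measurable_const measurable_id)
        rw [lintegral_finsetSum _ fun i _ => (hmi i).const_mul _]
        exact Finset.sum_congr rfl fun i _ => lintegral_const_mul' _ _ ENNReal.ofReal_ne_top
    _ ≤ ∑ i, ENNReal.ofReal a *
        ENNReal.ofReal (2 * √(x.1 i ^ 2 / (lam₁ ^ 2 * (x.2 : ℝ))) + C) := by
        gcongr with i
        exact lintegral_mul_scaleCondENN_le hlam₁ hlam₂ hC x i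
    _ = ENNReal.ofReal (∑ i, a * (2 * √(x.1 i ^ 2 / (lam₁ ^ 2 * (x.2 : ℝ))) + C)) := by
        rw [ENNReal.ofReal_sum_of_nonneg fun i _ => by positivity]
        exact Finset.sum_congr rfl fun i _ => (ENNReal.ofReal_mul ha0).symm
    _ ≤ _ := by
        exact ENNReal.ofReal_le_ofReal (sum_mean_le_drift hlam₁ a C x)

lemma exists_drift_condition : ∃ K, 0 < K ∧ ∀ x : State q,
    ∫⁻ y, ENNReal.ofReal (drift y) ∂(twoBlockKernel X Y α ξ lam₁ lam₂ x)
      ≤ ENNReal.ofReal (1 / 2 * drift x + K) := by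
  obtain ⟨C, hC0, hC⟩ := exists_lintegral_mul_recipInvGaussianPdf_le (pow_pos hlam₁ 2)
  exact ⟨_, add_pos_of_nonneg_of_pos (Finset.sum_nonneg fun _ _ => by positivity) one_pos,
    lintegral_drift_twoBlockKernel_le hn hα hξ hY hlam₁ hlam₂ rfl hC0 hC⟩

/-- On a sublevel set of the drift the scale density is at least `c` on the box, and restricting the
mixture to the box leaves a density in `y` alone. Its mass is `c`, since the box has volume one. -/
lemma exists_minorization (R : ℝ) : ∃ ν : Measure (State q), ν univ ≠ 0 ∧
    ∀ x, drift x ≤ R → ν ≤ twoBlockKernel X Y α ξ lam₁ lam₂ x := by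
  obtain ⟨c, hc, h⟩ := exists_le_scaleCond q hlam₁ hlam₂ R
  refine ⟨(lebesgue q).withDensity fun y =>
    ∫⁻ u in scaleBox q, stateCond₂ X Y α ξ u y * ENNReal.ofReal c ∂(scaleMeasure q), ?_, ?_⟩
  · rw [withDensity_apply _ .univ, setLIntegral_univ, lintegral_lintegral_swap
      (((measurable_stateCond₂ X Y α ξ measurable_snd measurable_fst).mul_const _).aemeasurable)]
    have h1 : ∫⁻ u in scaleBox q, ∫⁻ y, stateCond₂ X Y α ξ u y * ENNReal.ofReal c
        ∂(lebesgue q) ∂(scaleMeasure q) = ∫⁻ _u in scaleBox q, ENNReal.ofReal c ∂(scaleMeasure q) := by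
      refine setLIntegral_congr_fun (measurableSet_scaleBox q) fun u hu => ?_
      rw [lintegral_mul_const' _ _ ENNReal.ofReal_ne_top,
        lintegral_stateCond₂ hn hα hξ hY (pi_Icc_subset_posOrthant _ hu.1)
        (pi_Icc_subset_posOrthant _ hu.2), one_mul]
    rw [h1, setLIntegral_const, scaleMeasure_scaleBox, mul_one]
    exact (ENNReal.ofReal_pos.2 hc).ne'
  · intro x hx
    unfold twoBlockKernel
    rw [Kernel.withDensity_apply _ (measurable_twoBlockDensity X Y α ξ lam₁ lam₂),
      Kernel.const_apply]
    refine withDensity_mono (Filter.Eventually.of_forall fun y => ?_)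
    simp only
    rw [twoBlockDensity_eq]
    refine le_trans (setLIntegral_mono' (measurableSet_scaleBox q) fun u hu => ?_)
      (setLIntegral_le_lintegral _ _)
    gcongr
    exact ENNReal.ofReal_le_ofReal (h x hx u hu)

theorem geometricallyErgodic_twoBlockKernel :
    GeometricallyErgodic (twoBlockKernel X Y α ξ lam₁ lam₂) (posterior X Y α ξ lam₁ lam₂) := by
  obtain ⟨K, hK, hdrift⟩ := exists_drift_condition (X := X) hn hα hξ hY hlam₁ hlam₂
  -- With `γ = 1/2` Harris' theorem needs `R > 4K`.
  obtain ⟨ν, hν, hmin⟩ := exists_minorization (X := X) hn hα hξ hY hlam₁ hlam₂ (5 * K)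
  refine geometricallyErgodic_of_drift_of_minorization
    (isStationaryChain_twoBlockKernel hn hα hξ hY hlam₁ hlam₂) measurable_drift drift_nonneg
    (by norm_num) (by norm_num) hK hdrift (R := 5 * K) (by linarith) hν hmin
    ⟨(0, ⟨1, mem_Ioi.2 one_pos⟩), ?_⟩ (integrable_drift_posterior hn hα hξ hY hlam₁ hlam₂)
  have : drift ((0, ⟨1, mem_Ioi.2 one_pos⟩) : State q) = 0 := by simp [drift]
  rw [this]
  positivity

end FusedLasso

/-! ### The three-block operator is not Hilbert–Schmidt -/

namespace FusedLasso

open Set Real Matrix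

variable {n q : ℕ} {X : Matrix (Fin n) (Fin (q + 1)) ℝ} {Y : Fin n → ℝ} {α ξ lam₁ lam₂ : ℝ}

/-- Monotonicity of the determinant read off from normal integrals: the smaller form has the larger
integral. -/
lemma sqrt_det_le_sqrt_det {k : ℕ} {P Q : Matrix (Fin k) (Fin k) ℝ} (hP : P.PosDef) (hQ : Q.PosDef)
    (h : ∀ x, x ⬝ᵥ (P *ᵥ x) ≤ x ⬝ᵥ (Q *ᵥ x)) : √P.det ≤ √Q.det := by
  have hle : ENNReal.ofReal (√((2 * π) ^ k) / √Q.det) ≤ ENNReal.ofReal (√((2 * π) ^ k) / √P.det) := by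
    rw [← lintegral_exp_neg_quadForm hP 0, ← lintegral_exp_neg_quadForm hQ 0]
    refine lintegral_mono fun x => ENNReal.ofReal_le_ofReal (exp_le_exp.2 ?_)
    have := h (x - 0)
    linarith
  have hP0 := sqrt_pos.2 hP.det_pos
  have hQ0 := sqrt_pos.2 hQ.det_pos
  have h2 : 0 < √((2 * π) ^ k) := by positivity
  rw [ENNReal.ofReal_le_ofReal_iff (by positivity)] at hle
  exact (div_le_div_iff_of_pos_left h2 hQ0 hP0).1 hle

/-- In the box every local scale is at most `2`, so the precision matrix dominates half the
identity. -/
lemma le_sqrt_det_postPrecision (X : Matrix (Fin n) (Fin (q + 1)) ℝ)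
    {u : (Fin (q + 1) → ℝ) × (Fin q → ℝ)} (hu : u ∈ scaleBox q) :
    √((1 / 2 : ℝ) ^ (q + 1)) ≤ √(postPrecision X u.1 u.2).det := by
  have ht := pi_Icc_subset_posOrthant _ hu.1
  have hw := pi_Icc_subset_posOrthant _ hu.2
  have hP : ((1 / 2 : ℝ) • (1 : Matrix (Fin (q + 1)) (Fin (q + 1)) ℝ)).PosDef :=
    PosDef.one.smul (by norm_num)
  have h := sqrt_det_le_sqrt_det hP (posDef_postPrecision X ht hw) fun b => ?_
  · rwa [det_smul, det_one, mul_one, Fintype.card_fin] at h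
  · have h1 : b ⬝ᵥ ((Xᵀ * X) *ᵥ b) = (X *ᵥ b) ⬝ᵥ (X *ᵥ b) := by
      rw [← mulVec_mulVec, dotProduct_mulVec, vecMul_transpose]
    unfold postPrecision
    rw [add_mulVec, dotProduct_add, h1, priorPrecision_quadForm, smul_mulVec, one_mulVec,
      dotProduct_smul]
    have h2 := dotProduct_self_nonneg' (X *ᵥ b)
    have h3 : 0 ≤ ∑ j : Fin q, (b j.succ - b j.castSucc) ^ 2 / u.2 j :=
      Finset.sum_nonneg fun j _ => div_nonneg (sq_nonneg _) (hw j).le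
    have h4 : (1 / 2 : ℝ) • (b ⬝ᵥ b) ≤ ∑ i, b i ^ 2 / u.1 i := by
      rw [dotProduct, smul_eq_mul, Finset.mul_sum]
      refine Finset.sum_le_sum fun i _ => ?_
      rw [le_div_iff₀ (ht i)]
      nlinarith [(hu.1 i trivial).2, sq_nonneg (b i)]
    linarith

/-- The set where all coefficients are in `(r, 2r)` and the variance is in `(r², 4r²)`. -/
def scaledBox (q : ℕ) (r : ℝ) : Set (State q) :=
  (Set.pi univ fun _ => Ioo r (2 * r)) ×ˢ (Subtype.val ⁻¹' Ioo (r ^ 2) (4 * r ^ 2))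

lemma measurableSet_scaledBox (q : ℕ) (r : ℝ) : MeasurableSet (scaledBox q r) :=
  (MeasurableSet.univ_pi fun _ => measurableSet_Ioo).prod
    (measurable_subtype_coe measurableSet_Ioo)

lemma lebesgue_scaledBox (q : ℕ) {r : ℝ} (hr : 0 < r) :
    lebesgue q (scaledBox q r) = ENNReal.ofReal (r ^ (q + 1) * (3 * r ^ 2)) := by
  rw [lebesgue, scaledBox, Measure.prod_prod, comap_subtype_coe_apply measurableSet_Ioi,
    Subtype.image_preimage_coe, inter_eq_self_of_subset_right, volume_pi_pi, Real.volume_Ioo]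
  · simp only [Real.volume_Ioo, Finset.prod_const, Finset.card_univ, Fintype.card_fin]
    rw [← ENNReal.ofReal_pow (by linarith), ← ENNReal.ofReal_mul (pow_nonneg (by linarith) _)]
    ring_nf
  · exact fun s hs => (pow_pos hr 2).trans hs.1

/-- On the box with side `r ≥ 1` the generalized-ridge criterion is of order at most `r²`. -/
lemma exists_penalizedRSS_le (X : Matrix (Fin n) (Fin (q + 1)) ℝ) (Y : Fin n → ℝ) (hξ : 0 ≤ ξ) :
    ∃ C, ∀ r, 1 ≤ r → ∀ x ∈ scaledBox q r, ∀ u ∈ scaleBox q,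
      penalizedRSS X Y u.1 u.2 x.1 + 2 * ξ ≤ 2 * C * r ^ 2 := by
  -- Since `r ≥ 1`, the fixed quantities `|Y k|` and `ξ` are absorbed into the orders `r` and `r²`.
  refine ⟨(∑ k, (|Y k| + 2 * ∑ i, |X k i|) ^ 2 + ∑ _i : Fin (q + 1), 4 + ∑ _j : Fin q, 4 + 2 * ξ) / 2,
    fun r hr x hx u hu => ?_⟩
  have hr0 : 0 < r := one_pos.trans_le hr
  have hr2 : 1 ≤ r ^ 2 := one_le_pow₀ hr
  have hb : ∀ i, r < x.1 i ∧ x.1 i < 2 * r := fun i => hx.1 i trivial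
  have h1 : (Y - X *ᵥ x.1) ⬝ᵥ (Y - X *ᵥ x.1) ≤ ∑ k, (|Y k| + 2 * ∑ i, |X k i|) ^ 2 * r ^ 2 := by
    refine Finset.sum_le_sum fun k _ => ?_
    rw [← sq, ← mul_pow, Pi.sub_apply]
    refine sq_le_sq' ?_ ?_ <;> [rw [neg_le]; skip]
    all_goals
      refine (le_abs_self _).trans ?_
      try rw [abs_neg]
      refine (abs_sub _ _).trans ?_
      rw [add_mul]
      refine add_le_add (le_mul_of_one_le_right (abs_nonneg _) hr) ?_
      rw [mulVec, dotProduct]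
      refine (Finset.abs_sum_le_sum_abs _ _).trans ?_
      rw [mul_assoc, mul_comm, mul_assoc, Finset.sum_mul]
      refine Finset.sum_le_sum fun i _ => ?_
      rw [abs_mul]
      have := hb i
      rw [abs_of_pos (hr0.trans this.1)]
      nlinarith [abs_nonneg (X k i)]
  have h2 : ∑ i, x.1 i ^ 2 / u.1 i ≤ ∑ _i : Fin (q + 1), 4 * r ^ 2 := by
    refine Finset.sum_le_sum fun i _ => ?_
    have hu1 := hu.1 i trivial
    have := hb i
    rw [div_le_iff₀ (by linarith [hu1.1])]
    nlinarith [hu1.1]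
  have h3 : ∑ j : Fin q, (x.1 j.succ - x.1 j.castSucc) ^ 2 / u.2 j ≤ ∑ _j : Fin q, 4 * r ^ 2 := by
    refine Finset.sum_le_sum fun j _ => ?_
    have hu2 := hu.2 j trivial
    have h4 := hb j.succ
    have h5 := hb j.castSucc
    have h6 : (x.1 j.succ - x.1 j.castSucc) ^ 2 ≤ r ^ 2 := sq_le_sq' (by linarith) (by linarith)
    rw [div_le_iff₀ (by linarith [hu2.1])]
    nlinarith [hu2.1]
  unfold penalizedRSS
  rw [priorPrecision_quadForm]
  rw [← Finset.sum_mul] at h1 h2 h3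
  nlinarith

lemma le_penalizedRSS_of_mem {r : ℝ} (hr : 0 < r) {x : State q} (hx : x ∈ scaledBox q r)
    {u : (Fin (q + 1) → ℝ) × (Fin q → ℝ)} (hu : u ∈ scaleBox q) :
    r ^ 2 / 2 ≤ penalizedRSS X Y u.1 u.2 x.1 := by
  have ht := pi_Icc_subset_posOrthant _ hu.1
  have hw := pi_Icc_subset_posOrthant _ hu.2
  refine le_trans ?_ (sq_div_le_penalizedRSS x.1 ht hw 0)
  have h1 : r < x.1 0 := (hx.1 0 trivial).1
  exact div_le_div₀ (sq_nonneg _) (by gcongr) (ht 0) (hu.1 0 trivial).2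

/-- The bound does not involve `r`, so a single lower bound for the scale step serves all boxes. -/
lemma drift_le_of_mem {r : ℝ} (hr : 0 < r) {x : State q} (hx : x ∈ scaledBox q r) :
    drift x ≤ 4 * (q + 1 : ℕ) := by
  calc drift x ≤ ∑ _i : Fin (q + 1), 4 := by
        refine Finset.sum_le_sum fun i _ => ?_
        have hb := hx.1 i trivial
        have hs : r ^ 2 < x.2 := hx.2.1
        rw [div_le_iff₀ ((pow_pos hr 2).trans hs)]
        nlinarith [hb.1, hb.2]
    _ = 4 * (q + 1 : ℕ) := by
        rw [Finset.sum_const, Finset.card_univ, Fintype.card_fin, nsmul_eq_mul, mul_comm]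

/-- Scale parameter and argument are both of order `r²`, so the density is of order `r⁻²`; the
number `1/16` is the ratio of `r²/4` to `4r²`. -/
lemma le_invGammaPdf {a C r b s : ℝ} (ha : 0 < a) (hr : 0 < r) (hb : r ^ 2 / 4 ≤ b)
    (hbC : b ≤ C * r ^ 2) (hs : s ∈ Ioo (r ^ 2) (4 * r ^ 2)) :
    (1 / 16) ^ a / Gamma a * exp (-C) / 4 * (r ^ 2)⁻¹ ≤ invGammaPdf a b s := by
  have hr2 := pow_pos hr 2
  have hs0 : 0 < s := hr2.trans hs.1
  have hb0 : 0 < b := lt_of_lt_of_le (by positivity) hb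
  have hΓ := Gamma_pos_of_pos ha
  have h1 : (r ^ 2 / 4) ^ a ≤ b ^ a := rpow_le_rpow (by positivity) hb ha.le
  have h2 : (4 * r ^ 2) ^ (-a - 1) ≤ s ^ (-a - 1) :=
    rpow_le_rpow_of_nonpos hs0 hs.2.le (by linarith)
  have h3 : exp (-C) ≤ exp (-b / s) := by
    refine exp_le_exp.2 ?_
    rw [neg_div, neg_le_neg_iff, div_le_iff₀ hs0]
    have hC : 0 ≤ C := by
      by_contra! h
      nlinarith
    nlinarith [hs.1]
  have h4 : (r ^ 2 / 4) ^ a * (4 * r ^ 2) ^ (-a - 1) = (1 / 16) ^ a / 4 * (r ^ 2)⁻¹ := by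
    rw [rpow_sub (by positivity), rpow_neg (by positivity), rpow_one,
      show r ^ 2 / 4 = 1 / 16 * (4 * r ^ 2) by ring, mul_rpow (by norm_num) (by positivity)]
    have : (4 * r ^ 2) ^ a ≠ 0 := by positivity
    field_simp
  calc (1 / 16) ^ a / Gamma a * exp (-C) / 4 * (r ^ 2)⁻¹
      = (r ^ 2 / 4) ^ a * (4 * r ^ 2) ^ (-a - 1) / Gamma a * exp (-C) := by rw [h4]; ring
    _ = (r ^ 2 / 4) ^ a / Gamma a * (4 * r ^ 2) ^ (-a - 1) * exp (-C) := by ring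
    _ ≤ _ := by
        unfold invGammaPdf
        gcongr

/-- The exponent is bounded because the criterion is of order at most `r²` and the variance exceeds
`r²`, while `minRSS ≥ 0` only helps. The normalization has order `r⁻ᵖ`. -/
lemma le_betaCond {C r : ℝ} (hξ : 0 ≤ ξ) (hr : 0 < r)
    {x : State q} (hx : x ∈ scaledBox q r) {u : (Fin (q + 1) → ℝ) × (Fin q → ℝ)}
    (hu : u ∈ scaleBox q) (hC : penalizedRSS X Y u.1 u.2 x.1 + 2 * ξ ≤ 2 * C * r ^ 2) :
    (√((2 * π) ^ (q + 1)))⁻¹ * (2 ^ (q + 1))⁻¹ * √((1 / 2 : ℝ) ^ (q + 1)) * exp (-C) *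
      (r ^ (q + 1))⁻¹ ≤ betaCond X Y x.2 u.1 u.2 x.1 := by
  have ht := pi_Icc_subset_posOrthant _ hu.1
  have hw := pi_Icc_subset_posOrthant _ hu.2
  have hs0 : (0 : ℝ) < x.2 := x.2.2
  have hs1 : r ^ 2 < x.2 := hx.2.1
  have hs2 : x.2 < 4 * r ^ 2 := hx.2.2
  have hmin : 0 ≤ minRSS X Y u.1 u.2 := by
    rw [minRSS_eq_penalizedRSS X Y ht hw]
    exact penalizedRSS_nonneg X Y ht hw _
  have hR := penalizedRSS_nonneg X Y ht hw x.1
  have h1 : √((x.2 : ℝ) ^ (q + 1)) ≤ 2 ^ (q + 1) * r ^ (q + 1) := by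
    rw [← mul_pow]
    refine sqrt_le_iff.2 ⟨by positivity, ?_⟩
    rw [← pow_mul, mul_comm (q + 1), pow_mul]
    refine pow_le_pow_left₀ hs0.le ?_ _
    nlinarith
  have h2 : exp (-C) ≤ exp (-(penalizedRSS X Y u.1 u.2 x.1 - minRSS X Y u.1 u.2) / (2 * x.2)) := by
    refine exp_le_exp.2 ?_
    rw [neg_div, neg_le_neg_iff, div_le_iff₀ (by positivity)]
    have hC : 0 ≤ C := by
      by_contra! h
      nlinarith [pow_pos hr 2]
    nlinarith
  unfold betaCond
  rw [normalPdf_smul_inv (posDef_postPrecision X ht hw) hs0, penalizedRSS_eq X Y ht hw]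
  calc _ = (√((2 * π) ^ (q + 1)))⁻¹ * (2 ^ (q + 1) * r ^ (q + 1))⁻¹ * √((1 / 2 : ℝ) ^ (q + 1)) *
        exp (-C) := by
        rw [mul_inv]
        ring
    _ ≤ _ := by
        have := le_sqrt_det_postPrecision X hu
        gcongr

/-- The three-block chain stays in each of the boxes with probability bounded below. -/
lemma exists_le_threeBlockKernel_scaledBox (X : Matrix (Fin n) (Fin (q + 1)) ℝ) (Y : Fin n → ℝ)
    (hα : 0 ≤ α) (hξ : 0 ≤ ξ) (hlam₁ : 0 < lam₁) (hlam₂ : 0 < lam₂) :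
    ∃ c, 0 < c ∧ ∀ r, 1 ≤ r → ∀ x ∈ scaledBox q r,
      ENNReal.ofReal c ≤ threeBlockKernel X Y α ξ lam₁ lam₂ x (scaledBox q r) := by
  obtain ⟨c₁, hc₁, h₁⟩ := exists_le_scaleCond q hlam₁ hlam₂ (4 * (q + 1 : ℕ))
  obtain ⟨C, hC⟩ := exists_penalizedRSS_le X Y hξ
  have ha := shape₃_pos n q hα
  obtain ⟨a, haeq⟩ : ∃ a : ℝ, a = (n + (q + 1 : ℕ) + 2 * α) / 2 := ⟨_, rfl⟩
  rw [← haeq] at ha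
  obtain ⟨c₂, hc₂⟩ : ∃ c, c = (1 / 16) ^ a / Gamma a * exp (-C) / 4 := ⟨_, rfl⟩
  obtain ⟨c₃, hc₃⟩ : ∃ c, c = (√((2 * π) ^ (q + 1)))⁻¹ * (2 ^ (q + 1))⁻¹ *
    √((1 / 2 : ℝ) ^ (q + 1)) * exp (-C) := ⟨_, rfl⟩
  have hc₂0 : 0 < c₂ := by
    have := Gamma_pos_of_pos ha
    rw [hc₂]
    positivity
  have hc₃0 : 0 < c₃ := by
    rw [hc₃]
    positivity
  -- The transition density on the box is at least of order `r⁻ᵖ r⁻²`, and the box has volume `3 rᵖ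
  -- r²`; all powers of `r` cancel.
  refine ⟨3 * (c₃ * c₂ * c₁), by positivity, fun r hr x hx => ?_⟩
  have hr0 : 0 < r := one_pos.trans_le hr
  have hd : ∀ y ∈ scaledBox q r, ENNReal.ofReal (c₃ * (r ^ (q + 1))⁻¹ * (c₂ * (r ^ 2)⁻¹) * c₁)
      ≤ threeBlockDensity X Y α ξ lam₁ lam₂ x y := fun y hy => by
    rw [threeBlockDensity_eq]
    calc _ = ∫⁻ _u in scaleBox q,
          ENNReal.ofReal (c₃ * (r ^ (q + 1))⁻¹ * (c₂ * (r ^ 2)⁻¹) * c₁) ∂(scaleMeasure q) := by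
          rw [setLIntegral_const, scaleMeasure_scaleBox, mul_one]
      _ ≤ ∫⁻ u in scaleBox q, stateCond₃ X Y α ξ x.1 u y * scaleCondENN lam₁ lam₂ x u
          ∂(scaleMeasure q) := by
          refine setLIntegral_mono' (measurableSet_scaleBox q) fun u hu => ?_
          rw [ENNReal.ofReal_mul (by positivity), ENNReal.ofReal_mul (by positivity)]
          refine mul_le_mul' (mul_le_mul' (ENNReal.ofReal_le_ofReal ?_) (ENNReal.ofReal_le_ofReal ?_))
            (ENNReal.ofReal_le_ofReal (h₁ x (drift_le_of_mem hr0 hx) u hu))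
          · rw [hc₃]
            exact le_betaCond hξ hr0 hy hu (hC r hr y hy u hu)
          -- The criterion is evaluated at the old coefficients `x.1`, known to be of order `r`;
          -- this is how the variance step retains the size of the state.
          · rw [varianceCond₃_eq, ← haeq, hc₂]
            have hlow := le_penalizedRSS_of_mem (X := X) (Y := Y) hr0 hx hu
            have hupp := hC r hr x hx u hu
            exact le_invGammaPdf ha hr0 (by linarith) (by linarith) hy.2
      _ ≤ _ := setLIntegral_le_lintegral _ _
  unfold threeBlockKernel
  rw [Kernel.withDensity_apply' _ (measurable_threeBlockDensity X Y α ξ lam₁ lam₂),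
    Kernel.const_apply]
  refine le_trans (le_of_eq ?_) (setLIntegral_mono' (measurableSet_scaledBox q r) hd)
  rw [setLIntegral_const, lebesgue_scaledBox q hr0, ← ENNReal.ofReal_mul (by positivity)]
  congr 1
  field_simp

/-- The variances alone separate the boxes: they lie in the intervals `(4^k, 4^(k+1))`. -/
lemma pairwise_disjoint_scaledBox (q : ℕ) :
    Pairwise (Function.onFun Disjoint fun k : ℕ => scaledBox q (2 ^ k)) := by
  refine (pairwise_disjoint_on _).2 fun k l hkl => Set.disjoint_left.2 fun x hx hy => ?_
  have h1 : (x.2 : ℝ) < 4 * (2 ^ k) ^ 2 := hx.2.2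
  have h2 : ((2 : ℝ) ^ l) ^ 2 < x.2 := hy.2.1
  have h3 : (2 : ℝ) ^ (k + 1) ≤ 2 ^ l := pow_le_pow_right₀ one_le_two hkl
  have h4 : ((2 : ℝ) ^ (k + 1)) ^ 2 ≤ (2 ^ l) ^ 2 := pow_le_pow_left₀ (by positivity) h3 2
  rw [pow_succ (2 : ℝ) k, mul_pow] at h4
  nlinarith

variable (hn : 0 < n) (hα : 0 ≤ α) (hξ : 0 ≤ ξ) (hY : 0 < ξ ∨ Y ≠ 0)
  (hlam₁ : 0 < lam₁) (hlam₂ : 0 < lam₂)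
include hn hα hξ hY hlam₁ hlam₂

lemma posterior_scaledBox_ne_zero {r : ℝ} (hr : 0 < r) :
    posterior X Y α ξ lam₁ lam₂ (scaledBox q r) ≠ 0 := by
  unfold posterior
  rw [posteriorWeight_eq hlam₁ hlam₂, Measure.smul_apply, smul_eq_mul]
  refine mul_ne_zero (ENNReal.inv_ne_zero.2 ?_) ?_
  · rw [withDensity_apply _ .univ, setLIntegral_univ]
    exact lintegral_stateMarginal_ne_top hn hα hξ hY hlam₁ hlam₂
  · intro h
    rw [withDensity_apply_eq_zero
      (measurable_stateMarginal X Y α ξ lam₁ lam₂).ennreal_ofReal] at h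
    have hall : {x : State q | ENNReal.ofReal (stateMarginal X Y α ξ lam₁ lam₂ x) ≠ 0} = univ :=
      eq_univ_of_forall fun x => (ENNReal.ofReal_pos.2 (stateMarginal_pos hlam₁ hlam₂ x)).ne'
    rw [hall, univ_inter, lebesgue_scaledBox q hr] at h
    exact (ENNReal.ofReal_pos.2 (by positivity)).ne' h

theorem not_isHilbertSchmidt_threeBlock
    {T : Lp ℝ 2 (posterior X Y α ξ lam₁ lam₂) →L[ℝ] Lp ℝ 2 (posterior X Y α ξ lam₁ lam₂)}
    (hT : IsMarkovOperator (threeBlockKernel X Y α ξ lam₁ lam₂) (posterior X Y α ξ lam₁ lam₂) T) :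
    ¬ IsHilbertSchmidt T := by
  have hst := isStationaryChain_threeBlockKernel (X := X) hn hα hξ hY hlam₁ hlam₂
  have := hst.markov
  obtain ⟨c, hc, h⟩ := exists_le_threeBlockKernel_scaledBox X Y hα hξ hlam₁ hlam₂
  exact not_isHilbertSchmidt_of_pairwise_disjoint hst hT (fun k => measurableSet_scaledBox q (2 ^ k))
    (pairwise_disjoint_scaledBox q)
    (fun k => posterior_scaledBox_ne_zero hn hα hξ hY hlam₁ hlam₂ (by positivity)) hc
    fun k x hx => (ENNReal.ofReal_le_iff_le_toReal (measure_ne_top _ _)).1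
      (h (2 ^ k) (one_le_pow₀ one_le_two) x hx)

end FusedLasso

end

theorem theorem3 {n q : ℕ} (hn : 0 < n)
    (X : Matrix (Fin n) (Fin (q + 1)) ℝ) (Y : Fin n → ℝ)
    (α ξ lam₁ lam₂ : ℝ) (hα : 0 ≤ α) (hξ : 0 ≤ ξ) (hlam₁ : 0 < lam₁) (hlam₂ : 0 < lam₂)
    (hY : 0 < ξ ∨ Y ≠ 0) :
    GeometricallyErgodic (FusedLasso.twoBlockKernel X Y α ξ lam₁ lam₂)
        (FusedLasso.posterior X Y α ξ lam₁ lam₂) ∧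
      IsStationaryChain (FusedLasso.threeBlockKernel X Y α ξ lam₁ lam₂)
        (FusedLasso.posterior X Y α ξ lam₁ lam₂) ∧
      ∃ T : Lp ℝ 2 (FusedLasso.posterior X Y α ξ lam₁ lam₂) →L[ℝ]
          Lp ℝ 2 (FusedLasso.posterior X Y α ξ lam₁ lam₂),
        IsMarkovOperator (FusedLasso.threeBlockKernel X Y α ξ lam₁ lam₂)
          (FusedLasso.posterior X Y α ξ lam₁ lam₂) T ∧
        ¬ IsHilbertSchmidt T := by
  have hst := FusedLasso.isStationaryChain_threeBlockKernel (X := X) hn hα hξ hY hlam₁ hlam₂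
  obtain ⟨T, hT⟩ := hst.exists_isMarkovOperator
  exact ⟨FusedLasso.geometricallyErgodic_twoBlockKernel hn hα hξ hY hlam₁ hlam₂, hst, T, hT,
    FusedLasso.not_isHilbertSchmidt_threeBlock hn hα hξ hY hlam₁ hlam₂ hT⟩
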